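/- Let $P\subset\mathbf{R}^2$ be the moment polygon of a smooth polarised toric surface, that is, an integral Delzant polygon: a compact convex polygon with non-empty interior $P=\{x : h_k(x)\ge c_k,\ k=1,\dots,m\}$, where each $h_k$ is a primitive integral covector, $c_k\in\mathbf{Z}$, each inequality defines its own edge of $P$, and the two covectors of the edges meeting at any vertex form a basis of the dual lattice. Let $d\mu$ be Lebesgue measure on $P$, and let $d\sigma$ be the measure on $\partial P$ which on the edge $h_k=c_k$ is the constant $1$-form with $dh_k\wedge d\sigma=\pm d\mu$. Put $a=\mathrm{Vol}(\partial P,d\sigma)/\mathrm{Vol}(P,d\mu)$ and \[ \mathcal{L}(f)=\int_{\partial P} f\,d\sigma-a\int_P f\,d\mu . \] Let $\pi$ denote the orthogonal projection of $L^2(P,d\mu)$ onto the orthogonal complement of the space of affine linear functions. Suppose that $P$ (i.e. the toric surface) is K-polystable with respect to toric degenerations: $\mathcal{L}(f)\ge 0$ for every rational piecewise-linear convex function $f$ on $P$ (a maximum of finitely many affine linear functions with rational coefficients), and for such $f$ one has $\mathcal{L}(f)=0$ if and only if $f$ is affine linear on $P$. Then $P$ is uniformly K-polystable with respect to toric degenerations: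 there is a constant $\lambda>0$ such that every convex function $f:P\to\mathbf{R}$ is in $L^1(\partial P,d\sigma)$ and in $L^2(P,d\mu)$, and satisfies \[ \mathcal{L}(f)\ \ge\ \lambda\,\Vert\pi(f)\Vert_{L^2(P)} . \] -/

import Mathlib

open MeasureTheory
open scoped ENNReal

noncomputable section

/-- The half-plane intersection `{x ∈ ℝ² | h_k(x) ≥ c_k for all k}`, where the covector
`h_k = (a_k, b_k)` acts by `h_k(x) = a_k x₁ + b_k x₂`. -/
def halfPlaneInter {m : ℕ} (h : Fin m → ℤ × ℤ) (c : Fin m → ℤ) : Set (ℝ × ℝ) :=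
  {x | ∀ k, (c k : ℝ) ≤ ((h k).1 : ℝ) * x.1 + ((h k).2 : ℝ) * x.2}

/-- The part of `{h ≥ c}` lying on the line `h_k = c_k`. -/
def halfPlaneFacet {m : ℕ} (h : Fin m → ℤ × ℤ) (c : Fin m → ℤ) (k : Fin m) : Set (ℝ × ℝ) :=
  {x ∈ halfPlaneInter h c | ((h k).1 : ℝ) * x.1 + ((h k).2 : ℝ) * x.2 = (c k : ℝ)}

/-- The moment polygons of smooth polarised toric surfaces (integral Delzant polygons): compact
polygons with non-empty interior, cut out by finitely many inequalities `h_k(x) ≥ c_k` with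
`h_k` primitive integral covectors and `c_k` integers, each inequality defining its own edge, and
such that the two covectors at each vertex form a basis of the dual lattice. (It follows that the
vertices are lattice points.) -/
structure DelzantPolygon where
  /-- the number of edges -/
  numEdges : ℕ
  /-- the primitive inward conormals of the edges -/
  h : Fin numEdges → ℤ × ℤ
  /-- the constants of the defining inequalities -/
  c : Fin numEdges → ℤ
  primitive : ∀ k, IsCoprime (h k).1 (h k).2
  isCompact : IsCompact (halfPlaneInter h c)
  nonempty_interior : (interior (halfPlaneInter h c)).Nonempty
  h_injective : Function.Injective h
  /-- each inequality defines an edge, not just a point or the empty set -/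
  facet_nontrivial : ∀ k, (halfPlaneFacet h c k).Nontrivial
  /-- smoothness at the vertices -/
  smooth : ∀ j k, j ≠ k → (halfPlaneFacet h c j ∩ halfPlaneFacet h c k).Nonempty →
    IsUnit ((h j).1 * (h k).2 - (h j).2 * (h k).1)

namespace DelzantPolygon

variable (P : DelzantPolygon)

/-- The closed polygon. -/
def carrier : Set (ℝ × ℝ) := halfPlaneInter P.h P.c

/-- The `k`-th edge. -/
def edge (k : Fin P.numEdges) : Set (ℝ × ℝ) := halfPlaneFacet P.h P.c k

/-- Lebesgue measure `dμ` on the polygon. -/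
def areaMeasure : Measure (ℝ × ℝ) := volume.restrict P.carrier

/-- Parametrisation `t ↦ (c / |h|²) (a, b) + t (-b, a)` of the line `h = c`, for `h = h_k = (a, b)`
and `c = c_k`. The map `(s, t) ↦ (s / |h|²) (a, b) + t (-b, a)` has determinant `1` and
its first coordinate `s` is the value of `h`, so `dh ∧ dt = dμ`. -/
def edgeLine (k : Fin P.numEdges) (t : ℝ) : ℝ × ℝ :=
  ((P.c k : ℝ) / (((P.h k).1 : ℝ) ^ 2 + ((P.h k).2 : ℝ) ^ 2)) •
      ((((P.h k).1 : ℝ), ((P.h k).2 : ℝ)) : ℝ × ℝ) +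
    t • ((-((P.h k).2 : ℝ), ((P.h k).1 : ℝ)) : ℝ × ℝ)

/-- The measure `dσ` on the boundary: on the edge on `h_k = c_k` it is the translation invariant
measure with `dh_k ∧ dσ = ± dμ`. -/
def boundaryMeasure : Measure (ℝ × ℝ) :=
  ∑ k : Fin P.numEdges, (Measure.map (P.edgeLine k) volume).restrict (P.edge k)

/-- The constant `a = Vol(∂P, dσ) / Vol(P, dμ)`. -/
def avgConst : ℝ := P.boundaryMeasure.real Set.univ / P.areaMeasure.real Set.univ

/-- The (rescaled) Futaki invariant `𝓛(f) = ∫_{∂P} f dσ - a ∫_P f dμ`. -/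
def futaki (f : ℝ × ℝ → ℝ) : ℝ :=
  (∫ x, f x ∂P.boundaryMeasure) - P.avgConst * ∫ x, f x ∂P.areaMeasure

/-- `f` is affine linear on the polygon. -/
def IsAffineOn (f : ℝ × ℝ → ℝ) : Prop :=
  ∃ g : (ℝ × ℝ) →ᵃ[ℝ] ℝ, Set.EqOn f g P.carrier

/-- `f` is a rational piecewise-linear convex function on the polygon: the maximum of finitely many
affine linear functions `q₁ x₁ + q₂ x₂ + q₃` with rational coefficients. -/
def IsRationalPLConvex (f : ℝ × ℝ → ℝ) : Prop :=
  ∃ (s : Finset (ℚ × ℚ × ℚ)) (hs : s.Nonempty), ∀ x ∈ P.carrier,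
    f x = s.sup' hs fun q => (q.1 : ℝ) * x.1 + (q.2.1 : ℝ) * x.2 + (q.2.2 : ℝ)

/-- K-semistability for toric test-configurations. -/
def IsKSemistable : Prop :=
  ∀ f : ℝ × ℝ → ℝ, P.IsRationalPLConvex f → 0 ≤ P.futaki f

/-- K-polystability for toric test-configurations. -/
def IsKPolystable : Prop :=
  P.IsKSemistable ∧
    ∀ f : ℝ × ℝ → ℝ, P.IsRationalPLConvex f → (P.futaki f = 0 ↔ P.IsAffineOn f)

/-- The subspace of `L²(P, dμ)` consisting of the (classes of) affine linear functions. -/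
def affineLp : Submodule ℝ (Lp ℝ 2 P.areaMeasure) where
  carrier := {u | ∃ g : (ℝ × ℝ) →ᵃ[ℝ] ℝ, u =ᵐ[P.areaMeasure] g}
  zero_mem' := ⟨0, Lp.coeFn_zero _ _ _⟩
  add_mem' := by
    rintro u v ⟨g, hg⟩ ⟨k, hk⟩
    exact ⟨g + k, (Lp.coeFn_add u v).trans (hg.add hk)⟩
  smul_mem' := by
    rintro r u ⟨g, hg⟩
    exact ⟨r • g, (Lp.coeFn_smul r u).trans (hg.const_smul r)⟩

/-- The projection `π` onto the `L²`-orthogonal complement of the affine linear functions. -/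
def proj : Lp ℝ 2 P.areaMeasure →L[ℝ] Lp ℝ 2 P.areaMeasure :=
  P.affineLpᗮ.starProjection

/-- Uniform K-polystability with respect to toric degenerations: there is `lam > 0` with
`𝓛(f) ≥ lam ‖π(f)‖_{L²}` for all convex functions `f` on the polygon; that `𝓛(f)` and `π(f)` make
sense, i.e. `f ∈ L¹(∂P, dσ)` and `f ∈ L²(P, dμ)`, is part of the assertion. -/
def IsUniformlyKPolystable : Prop :=
  ∃ lam : ℝ, 0 < lam ∧ ∀ f : ℝ × ℝ → ℝ, ConvexOn ℝ P.carrier f →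
    Integrable f P.boundaryMeasure ∧
      ∃ hf : MemLp f 2 P.areaMeasure, lam * ‖P.proj (hf.toLp f)‖ ≤ P.futaki f

end DelzantPolygon

end

/-!
Write `𝓛` for the Futaki invariant, and call `(aff v)⁺ = max (aff v) 0` a *crease*. The proof has
three ingredients.

**Reduction to creases.** A convex function on the polygon is approximated from above, in mean on
the boundary, by functions `affine + sum of creases` (`exists_creaseSum_approx`). The reason is that
finitely many values of a convex function at boundary nodes can be matched from below by such a sum
which still dominates the function on the whole polygon (`exists_aff_add_creaseSum`): interpolate
affinely at two nodes, push up until a third node is touched, and recurse into the two regions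
beyond the sides of the triangle formed by them (`exists_isCreaseApprox`). Since `𝓛` is linear and
vanishes on affine functions, and `a > 0`, it suffices to bound `𝓛` from below on creases by the
boundary integral, up to replacing `(aff v)⁺` by `(-aff v)⁺`, which differs by an affine function.
The `L²` norm is then controlled by two estimates: `‖u‖_{L²(P)} ≤ C ∫_{∂P} u` for nonnegative convex
`u` (`exists_integral_sq_le`), and a pointwise lower bound for a convex function in terms of its
mean (`integral_le_of_convexOn`).

**Strict positivity.** For a crease whose line cuts the polygon, `𝓛 > 0`
(`IsHonest.futaki_pos`). If the line is rational this is polystability; for real lines `𝓛 ≥ 0` by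
density, and it has to be excluded that `𝓛` vanishes at an irrational line. Euler's identity for the
homogeneous function `(aff v)⁺` about a point `p` of the line,
`3 ∫_P (aff v)⁺ dμ = ∑_k (h_k(p) - c_k) ∫_{E_k} (aff v)⁺ dσ` (`three_mul_integral_crease`), turns
`𝓛` into a sum of edge integrals (`futaki_crease_eq`). Hence `𝓛` is locally a polynomial with
rational coefficients in the positions of the two end points of the chord. A zero is a local
minimum, so a critical point.
* If one end point is rational, keep it fixed: then `𝓛` is a rational quadratic polynomial in the
  other one with a double zero, which is rational unless the polynomial vanishes identically; in
  either case there is a zero at a rational line (`IsHonest.futaki_pos_of_left_mem`).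
* If the two edges are parallel, the polynomial is quadratic in both variables, and has a nearby
  zero with one rational coordinate (`exists_rational_zero_of_local_min`).
* Otherwise, comparing the two expressions obtained by placing `p` at either end point determines
  the shape of the polynomial (`matching_coefficients`), and the critical equations, with the
  vanishing of the value, force one of the end points to be rational (`mem_ratField_of_local_min`).

**Uniformity.** The bound `δ min (∫_{∂P} (aff v)⁺) (∫_{∂P} (-aff v)⁺) ≤ 𝓛((aff v)⁺)` is homogeneous in
`v`, so it is enough to prove it locally on the unit sphere
(`exists_mul_min_le_futaki_crease`). Near a line cutting the polygon this is continuity and strict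
positivity. Near the other ones, `(aff v)⁺` or `(-aff v)⁺` is supported on a set of small area, so
that the `L²` estimate makes the area term small compared to the boundary term.
-/

open MeasureTheory Filter Topology Set
/-- The rational numbers, as a subfield of `ℝ`. -/
noncomputable def ratField : Subfield ℝ := (algebraMap ℚ ℝ).fieldRange

lemma intCast_mem_ratField (n : ℤ) : (n : ℝ) ∈ ratField := intCast_mem ratField n

lemma ofNat_mem_ratField (n : ℕ) [n.AtLeastTwo] : (OfNat.ofNat n : ℝ) ∈ ratField :=
  ofNat_mem ratField n

/-! ### The polygon and its boundary -/

namespace DelzantPolygon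

variable (P : DelzantPolygon)

/-- The affine function `h_k - c_k`, which is nonnegative on the polygon and vanishes on the
`k`-th edge. -/
def ldist (k : Fin P.numEdges) (z : ℝ × ℝ) : ℝ :=
  ((P.h k).1 : ℝ) * z.1 + ((P.h k).2 : ℝ) * z.2 - (P.c k : ℝ)

/-- The determinant of the conormals of two edges. -/
def cross (j k : Fin P.numEdges) : ℝ :=
  ((P.h j).1 : ℝ) * ((P.h k).2 : ℝ) - ((P.h j).2 : ℝ) * ((P.h k).1 : ℝ)

lemma mem_carrier_iff {z : ℝ × ℝ} : z ∈ P.carrier ↔ ∀ k, 0 ≤ P.ldist k z := by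
  simp only [carrier, halfPlaneInter, Set.mem_ofPred_eq, ldist, sub_nonneg]

lemma mem_edge_iff {k : Fin P.numEdges} {z : ℝ × ℝ} :
    z ∈ P.edge k ↔ z ∈ P.carrier ∧ P.ldist k z = 0 := by
  simp only [edge, halfPlaneFacet, Set.mem_ofPred_eq, ldist, sub_eq_zero]
  rfl

lemma isCompact_carrier : IsCompact P.carrier := P.isCompact

lemma measurableSet_carrier : MeasurableSet P.carrier := P.isCompact_carrier.measurableSet

lemma interior_carrier_nonempty : (interior P.carrier).Nonempty := P.nonempty_interior

lemma ldist_combo (k : Fin P.numEdges) {s t : ℝ} (hst : s + t = 1) (z w : ℝ × ℝ) :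
    P.ldist k (s • z + t • w) = s * P.ldist k z + t * P.ldist k w := by
  simp only [ldist, Prod.fst_add, Prod.snd_add, Prod.smul_fst, Prod.smul_snd, smul_eq_mul]
  linear_combination (P.c k : ℝ) * hst

lemma convex_carrier : Convex ℝ P.carrier := by
  intro z hz w hw s t hs ht hst
  rw [mem_carrier_iff] at *
  intro k
  rw [P.ldist_combo k hst]
  exact add_nonneg (mul_nonneg hs (hz k)) (mul_nonneg ht (hw k))

lemma continuous_ldist (k : Fin P.numEdges) : Continuous (P.ldist k) := by
  unfold ldist; fun_prop

lemma normSq_pos (k : Fin P.numEdges) :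
    0 < ((P.h k).1 : ℝ) ^ 2 + ((P.h k).2 : ℝ) ^ 2 := by
  by_contra hcon
  have h1 : ((P.h k).1 : ℝ) = 0 := by nlinarith [sq_nonneg ((P.h k).1 : ℝ), sq_nonneg ((P.h k).2 : ℝ)]
  have h2 : ((P.h k).2 : ℝ) = 0 := by nlinarith [sq_nonneg ((P.h k).1 : ℝ), sq_nonneg ((P.h k).2 : ℝ)]
  have := P.primitive k
  rw [show (P.h k).1 = 0 by exact_mod_cast h1, show (P.h k).2 = 0 by exact_mod_cast h2] at this
  exact not_isCoprime_zero_zero this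

lemma edgeLine_fst (k : Fin P.numEdges) (t : ℝ) : (P.edgeLine k t).1 =
    (P.c k : ℝ) / (((P.h k).1 : ℝ) ^ 2 + ((P.h k).2 : ℝ) ^ 2) * (P.h k).1 - t * (P.h k).2 := by
  simp [edgeLine]; ring

lemma edgeLine_snd (k : Fin P.numEdges) (t : ℝ) : (P.edgeLine k t).2 =
    (P.c k : ℝ) / (((P.h k).1 : ℝ) ^ 2 + ((P.h k).2 : ℝ) ^ 2) * (P.h k).2 + t * (P.h k).1 := by
  simp [edgeLine]

lemma ldist_edgeLine_self (k : Fin P.numEdges) (t : ℝ) : P.ldist k (P.edgeLine k t) = 0 := by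
  have := (P.normSq_pos k).ne'
  rw [ldist, edgeLine_fst, edgeLine_snd]
  field_simp
  ring

lemma ldist_edgeLine (j k : Fin P.numEdges) (t : ℝ) :
    P.ldist j (P.edgeLine k t) = P.ldist j (P.edgeLine k 0) + P.cross k j * t := by
  simp only [ldist, edgeLine_fst, edgeLine_snd, cross]
  ring

lemma edgeLine_fst_mem {k : Fin P.numEdges} {t : ℝ} (ht : t ∈ ratField) :
    (P.edgeLine k t).1 ∈ ratField := by
  rw [edgeLine_fst]
  have h1 := intCast_mem_ratField (P.h k).1
  have h2 := intCast_mem_ratField (P.h k).2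
  have h3 := intCast_mem_ratField (P.c k)
  exact sub_mem (mul_mem (div_mem h3 (add_mem (pow_mem h1 2) (pow_mem h2 2))) h1) (mul_mem ht h2)

lemma edgeLine_snd_mem {k : Fin P.numEdges} {t : ℝ} (ht : t ∈ ratField) :
    (P.edgeLine k t).2 ∈ ratField := by
  rw [edgeLine_snd]
  have h1 := intCast_mem_ratField (P.h k).1
  have h2 := intCast_mem_ratField (P.h k).2
  have h3 := intCast_mem_ratField (P.c k)
  exact add_mem (mul_mem (div_mem h3 (add_mem (pow_mem h1 2) (pow_mem h2 2))) h2) (mul_mem ht h1)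

lemma ldist_mem {k : Fin P.numEdges} {z : ℝ × ℝ} (h1 : z.1 ∈ ratField) (h2 : z.2 ∈ ratField) :
    P.ldist k z ∈ ratField :=
  sub_mem (add_mem (mul_mem (intCast_mem_ratField _) h1) (mul_mem (intCast_mem_ratField _) h2))
    (intCast_mem_ratField _)

lemma cross_mem (j k : Fin P.numEdges) : P.cross j k ∈ ratField :=
  sub_mem (mul_mem (intCast_mem_ratField _) (intCast_mem_ratField _))
    (mul_mem (intCast_mem_ratField _) (intCast_mem_ratField _))

lemma exists_edgeLine_eq {k : Fin P.numEdges} {z : ℝ × ℝ} (hz : P.ldist k z = 0) :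
    ∃ t, P.edgeLine k t = z := by
  have hn := (P.normSq_pos k).ne'
  rw [ldist, sub_eq_zero] at hz
  refine ⟨(-((P.h k).2 : ℝ) * z.1 + (P.h k).1 * z.2) /
    (((P.h k).1 : ℝ) ^ 2 + ((P.h k).2 : ℝ) ^ 2), Prod.ext ?_ ?_⟩
  · rw [edgeLine_fst, ← hz]; field_simp; ring
  · rw [edgeLine_snd, ← hz]; field_simp; ring

lemma continuous_edgeLine (k : Fin P.numEdges) : Continuous (P.edgeLine k) := by
  unfold edgeLine; fun_prop

lemma edgeLine_leftInverse (k : Fin P.numEdges) : Function.LeftInverse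
    (fun z : ℝ × ℝ => (-((P.h k).2 : ℝ) * z.1 + (P.h k).1 * z.2) /
      (((P.h k).1 : ℝ) ^ 2 + ((P.h k).2 : ℝ) ^ 2)) (P.edgeLine k) := by
  intro t
  have hn := (P.normSq_pos k).ne'
  simp only [edgeLine_fst, edgeLine_snd]
  field_simp
  ring

lemma isClosedEmbedding_edgeLine (k : Fin P.numEdges) : IsClosedEmbedding (P.edgeLine k) :=
  (P.edgeLine_leftInverse k).isClosedEmbedding (by fun_prop) (P.continuous_edgeLine k)

lemma edgeLine_combo (k : Fin P.numEdges) {r s : ℝ} (hrs : r + s = 1) (t u : ℝ) :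
    P.edgeLine k (r * t + s * u) = r • P.edgeLine k t + s • P.edgeLine k u := by
  ext
  · simp only [edgeLine_fst, Prod.fst_add, Prod.smul_fst, smul_eq_mul]
    linear_combination -((P.c k : ℝ) / (((P.h k).1 : ℝ) ^ 2 + ((P.h k).2 : ℝ) ^ 2) * (P.h k).1) * hrs
  · simp only [edgeLine_snd, Prod.snd_add, Prod.smul_snd, smul_eq_mul]
    linear_combination -((P.c k : ℝ) / (((P.h k).1 : ℝ) ^ 2 + ((P.h k).2 : ℝ) ^ 2) * (P.h k).2) * hrs

/-- The parameters of the points of the `k`-th edge. -/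
def edgeParam (k : Fin P.numEdges) : Set ℝ := P.edgeLine k ⁻¹' P.carrier

/-- The parameter of the first end point of the `k`-th edge. -/
noncomputable def lo (k : Fin P.numEdges) : ℝ := sInf (P.edgeParam k)

/-- The parameter of the second end point of the `k`-th edge. -/
noncomputable def hi (k : Fin P.numEdges) : ℝ := sSup (P.edgeParam k)

lemma edgeLine_image_edgeParam (k : Fin P.numEdges) :
    P.edgeLine k '' P.edgeParam k = P.edge k := by
  ext z
  constructor
  · rintro ⟨t, ht, rfl⟩
    exact P.mem_edge_iff.2 ⟨ht, P.ldist_edgeLine_self k t⟩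
  · intro hz
    obtain ⟨hz1, hz2⟩ := P.mem_edge_iff.1 hz
    obtain ⟨t, rfl⟩ := P.exists_edgeLine_eq hz2
    exact ⟨t, hz1, rfl⟩

lemma edgeParam_nontrivial (k : Fin P.numEdges) : (P.edgeParam k).Nontrivial := by
  have := P.facet_nontrivial k
  change (P.edge k).Nontrivial at this
  rw [← edgeLine_image_edgeParam] at this
  exact Set.nontrivial_of_image _ _ this

lemma edgeParam_eq_Icc (k : Fin P.numEdges) : P.edgeParam k = Icc (P.lo k) (P.hi k) := by
  refine eq_Icc_of_connected_compact ⟨(P.edgeParam_nontrivial k).nonempty, ?_⟩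
    ((P.isClosedEmbedding_edgeLine k).isCompact_preimage P.isCompact_carrier)
  refine Convex.isPreconnected fun t ht u hu r s hr hs hrs => ?_
  change P.edgeLine k (r * t + s * u) ∈ P.carrier
  rw [P.edgeLine_combo k hrs]
  exact P.convex_carrier ht hu hr hs hrs

lemma edgeLine_mem_carrier_iff {k : Fin P.numEdges} {t : ℝ} :
    P.edgeLine k t ∈ P.carrier ↔ t ∈ Icc (P.lo k) (P.hi k) := by
  rw [← edgeParam_eq_Icc]; rfl

lemma edge_eq_image (k : Fin P.numEdges) : P.edge k = P.edgeLine k '' Icc (P.lo k) (P.hi k) := by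
  rw [← edgeParam_eq_Icc, edgeLine_image_edgeParam]

lemma lo_lt_hi (k : Fin P.numEdges) : P.lo k < P.hi k := by
  have := P.edgeParam_nontrivial k
  rw [edgeParam_eq_Icc] at this
  by_contra hcon
  exact Set.not_subsingleton_iff.2 this (Set.subsingleton_Icc_of_ge (not_lt.1 hcon))

lemma edgeLine_lo_mem (k : Fin P.numEdges) : P.edgeLine k (P.lo k) ∈ P.carrier :=
  P.edgeLine_mem_carrier_iff.2 (left_mem_Icc.2 (P.lo_lt_hi k).le)

lemma edgeLine_hi_mem (k : Fin P.numEdges) : P.edgeLine k (P.hi k) ∈ P.carrier :=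
  P.edgeLine_mem_carrier_iff.2 (right_mem_Icc.2 (P.lo_lt_hi k).le)

/-- An end point of an edge lies on a line transversal to the edge: otherwise the edge could be
prolonged. -/
lemma exists_tight_of_endpoint {k : Fin P.numEdges} {t : ℝ} (ht : P.edgeLine k t ∈ P.carrier)
    (hlim : ∃ᶠ s in 𝓝 t, P.edgeLine k s ∉ P.carrier) :
    ∃ j, P.cross k j ≠ 0 ∧ P.ldist j (P.edgeLine k t) = 0 := by
  by_contra! hcon
  refine hlim ?_
  have : ∀ j, ∀ᶠ s in 𝓝 t, 0 ≤ P.ldist j (P.edgeLine k s) := by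
    intro j
    by_cases hj : P.cross k j = 0
    · filter_upwards with s
      have := P.mem_carrier_iff.1 ht j
      rw [ldist_edgeLine, hj, zero_mul] at this ⊢
      exact this
    · have hpos : 0 < P.ldist j (P.edgeLine k t) :=
        lt_of_le_of_ne (P.mem_carrier_iff.1 ht j) (Ne.symm (hcon j hj))
      have hc : Continuous fun s => P.ldist j (P.edgeLine k s) :=
        (P.continuous_ldist j).comp (P.continuous_edgeLine k)
      exact (hc.continuousAt.eventually (lt_mem_nhds hpos)).mono fun s hs => hs.le
  filter_upwards [eventually_all.2 this] with s hs
  rw [not_not, mem_carrier_iff]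
  exact hs

lemma mem_ratField_of_tight {j k : Fin P.numEdges} {t : ℝ} (hc : P.cross k j ≠ 0)
    (h0 : P.ldist j (P.edgeLine k t) = 0) : t ∈ ratField := by
  rw [ldist_edgeLine] at h0
  have : t = -P.ldist j (P.edgeLine k 0) / P.cross k j := by
    rw [eq_div_iff hc]; linarith
  rw [this]
  exact div_mem (neg_mem (P.ldist_mem (P.edgeLine_fst_mem (zero_mem _))
    (P.edgeLine_snd_mem (zero_mem _)))) (P.cross_mem _ _)

lemma lo_mem (k : Fin P.numEdges) : P.lo k ∈ ratField := by
  obtain ⟨j, hj, h0⟩ := P.exists_tight_of_endpoint (P.edgeLine_lo_mem k) (by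
    refine Frequently.filter_mono ?_ (nhdsWithin_le_nhds (s := Iio (P.lo k)))
    refine (eventually_mem_nhdsWithin.mono fun s hs => ?_).frequently
    rw [edgeLine_mem_carrier_iff]
    exact fun h => not_lt.2 h.1 hs)
  exact P.mem_ratField_of_tight hj h0

lemma hi_mem (k : Fin P.numEdges) : P.hi k ∈ ratField := by
  obtain ⟨j, hj, h0⟩ := P.exists_tight_of_endpoint (P.edgeLine_hi_mem k) (by
    refine Frequently.filter_mono ?_ (nhdsWithin_le_nhds (s := Ioi (P.hi k)))
    refine (eventually_mem_nhdsWithin.mono fun s hs => ?_).frequently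
    rw [edgeLine_mem_carrier_iff]
    exact fun h => not_lt.2 h.2 hs)
  exact P.mem_ratField_of_tight hj h0

lemma eq_or_neg_of_cross_eq_zero {j k : Fin P.numEdges} (h0 : P.cross j k = 0) :
    P.h j = P.h k ∨ P.h j = -P.h k := by
  have h : (P.h j).1 * (P.h k).2 = (P.h j).2 * (P.h k).1 := by
    rw [cross, sub_eq_zero] at h0; exact_mod_cast h0
  have hj := P.primitive j
  have hk := P.primitive k
  have d1 : (P.h j).1 ∣ (P.h k).1 := hj.dvd_of_dvd_mul_left ⟨_, h.symm⟩
  have d2 : (P.h k).1 ∣ (P.h j).1 := hk.dvd_of_dvd_mul_right ⟨(P.h j).2, by rw [h]; ring⟩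
  have e2 : (P.h j).2 ∣ (P.h k).2 := hj.symm.dvd_of_dvd_mul_left ⟨_, h⟩
  have f2 : (P.h k).2 ∣ (P.h j).2 := hk.symm.dvd_of_dvd_mul_right ⟨(P.h j).1, by rw [← h]; ring⟩
  have a1 := Int.natAbs_eq_natAbs_iff.1 (Int.natAbs_eq_of_dvd_dvd d1 d2)
  have a2 := Int.natAbs_eq_natAbs_iff.1 (Int.natAbs_eq_of_dvd_dvd e2 f2)
  have key : ∀ {x y : ℤ}, x * y = -(y * x) → x = 0 ∨ y = 0 := fun h =>
    mul_eq_zero.1 (by linarith)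
  simp only [Prod.ext_iff, Prod.fst_neg, Prod.snd_neg]
  rcases a1 with a1 | a1 <;> rcases a2 with a2 | a2
  · exact Or.inl ⟨a1, a2⟩
  · have := key (x := (P.h k).1) (y := (P.h k).2) (by rw [a1, a2] at h; linarith)
    omega
  · have := key (x := (P.h k).1) (y := (P.h k).2) (by rw [a1, a2] at h; linarith)
    omega
  · exact Or.inr ⟨a1, a2⟩

/-- Two edges with parallel conormals do not meet. -/
lemma cross_ne_zero_of_tight {j k : Fin P.numEdges} (hjk : j ≠ k) {z : ℝ × ℝ}
    (hj : P.ldist j z = 0) (hk : P.ldist k z = 0) : P.cross j k ≠ 0 := by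
  intro h0
  rcases P.eq_or_neg_of_cross_eq_zero h0 with h | h
  · exact hjk (P.h_injective h)
  have hsum : ∀ w, P.ldist j w + P.ldist k w = 0 := by
    intro w
    simp only [ldist, h, Prod.fst_neg, Prod.snd_neg, Int.cast_neg] at hj hk ⊢
    linarith
  -- The polygon would be contained in the line on which `ldist k` vanishes.
  obtain ⟨w, hw⟩ := P.interior_carrier_nonempty
  have hopen : ∀ᶠ e : ℝ in 𝓝 0, w + e • (((P.h k).1 : ℝ), ((P.h k).2 : ℝ)) ∈ P.carrier := by
    have hc : Continuous fun e : ℝ => w + e • ((((P.h k).1 : ℝ), ((P.h k).2 : ℝ)) : ℝ × ℝ) := by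
      fun_prop
    refine hc.continuousAt.eventually (mem_interior_iff_mem_nhds.1 ?_)
    simpa using hw
  have hz : ∀ w ∈ P.carrier, P.ldist k w = 0 := fun w hw => le_antisymm
    (by linarith [hsum w, P.mem_carrier_iff.1 hw j]) (P.mem_carrier_iff.1 hw k)
  obtain ⟨e, he, hne⟩ := ((hopen.filter_mono nhdsWithin_le_nhds).and
    (eventually_mem_nhdsWithin (a := (0 : ℝ)) (s := Ioi 0))).exists
  have h1 := hz _ he
  have h2 := hz w (interior_subset hw)
  simp only [ldist, Prod.fst_add, Prod.snd_add, Prod.smul_fst, Prod.smul_snd, smul_eq_mul] at h1 h2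
  have := P.normSq_pos k
  have he0 : (0 : ℝ) < e := hne
  nlinarith [mul_pos he0 this]

lemma cross_swap (j k : Fin P.numEdges) : P.cross j k = -P.cross k j := by
  simp only [cross]; ring

/-- The relative interior of an edge does not meet the other edges. -/
lemma ldist_edgeLine_pos {j k : Fin P.numEdges} (hjk : j ≠ k) {t : ℝ}
    (ht : t ∈ Ioo (P.lo k) (P.hi k)) : 0 < P.ldist j (P.edgeLine k t) := by
  have hmem := P.edgeLine_mem_carrier_iff.2 (Ioo_subset_Icc_self ht)
  refine lt_of_le_of_ne (P.mem_carrier_iff.1 hmem j) fun h0 => ?_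
  have hc := P.cross_ne_zero_of_tight hjk h0.symm (P.ldist_edgeLine_self k t)
  have h1 := P.mem_carrier_iff.1 (P.edgeLine_lo_mem k) j
  have h2 := P.mem_carrier_iff.1 (P.edgeLine_hi_mem k) j
  rw [ldist_edgeLine] at h1 h2 h0
  rw [cross_swap, neg_ne_zero] at hc
  rcases lt_or_gt_of_ne hc with hc | hc
  · nlinarith [ht.2]
  · nlinarith [ht.1]

/-! ### Integration over the boundary -/

lemma boundaryMeasure_eq : P.boundaryMeasure =
    ∑ k, (volume.restrict (Icc (P.lo k) (P.hi k))).map (P.edgeLine k) := by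
  unfold boundaryMeasure
  refine Finset.sum_congr rfl fun k _ => ?_
  rw [(P.isClosedEmbedding_edgeLine k).measurableEmbedding.restrict_map]
  congr 2
  ext t
  rw [Set.mem_preimage, mem_edge_iff, edgeLine_mem_carrier_iff]
  simp [ldist_edgeLine_self]

lemma integrable_boundary_iff {f : ℝ × ℝ → ℝ} : Integrable f P.boundaryMeasure ↔
    ∀ k, IntegrableOn (fun t => f (P.edgeLine k t)) (Icc (P.lo k) (P.hi k)) := by
  rw [boundaryMeasure_eq, integrable_finsetSum_measure]
  simp only [Finset.mem_univ, true_implies]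
  refine forall_congr' fun k => ?_
  rw [(P.isClosedEmbedding_edgeLine k).measurableEmbedding.integrable_map_iff]
  rfl

lemma integral_boundary {f : ℝ × ℝ → ℝ} (hf : Integrable f P.boundaryMeasure) :
    ∫ z, f z ∂P.boundaryMeasure =
      ∑ k, ∫ t in Icc (P.lo k) (P.hi k), f (P.edgeLine k t) := by
  rw [boundaryMeasure_eq] at hf ⊢
  rw [integral_finsetSum_measure fun k _ => integrable_finsetSum_measure.1 hf k (Finset.mem_univ k)]
  exact Finset.sum_congr rfl fun k _ =>
    (P.isClosedEmbedding_edgeLine k).measurableEmbedding.integral_map _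

lemma integrable_boundary_of_continuous {f : ℝ × ℝ → ℝ} (hf : Continuous f) :
    Integrable f P.boundaryMeasure :=
  P.integrable_boundary_iff.2 fun k =>
    (hf.comp (P.continuous_edgeLine k)).continuousOn.integrableOn_Icc

lemma integrable_area_of_continuous {f : ℝ × ℝ → ℝ} (hf : Continuous f) :
    Integrable f P.areaMeasure :=
  hf.continuousOn.integrableOn_compact P.isCompact_carrier

instance : IsFiniteMeasure P.areaMeasure :=
  ⟨by rw [areaMeasure, Measure.restrict_apply_univ]; exact P.isCompact_carrier.measure_lt_top⟩

lemma ae_area_mem : ∀ᵐ z ∂P.areaMeasure, z ∈ P.carrier :=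
  ae_restrict_mem P.measurableSet_carrier

lemma area_pos : 0 < P.areaMeasure.real univ := by
  rw [Measure.real, areaMeasure, Measure.restrict_apply_univ]
  refine ENNReal.toReal_pos ?_ P.isCompact_carrier.measure_lt_top.ne
  exact (Measure.measure_pos_of_nonempty_interior _ P.interior_carrier_nonempty).ne'

end DelzantPolygon

/-! ### Integration over a planar polygon by vertical slices -/

section Region

variable {ι : Type*} (a b c : ι → ℝ)

/-- The intersection of the half-planes `a_k x + b_k y ≥ c_k`. -/
def region : Set (ℝ × ℝ) := {z | ∀ k, c k ≤ a k * z.1 + b k * z.2}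

/-- The height of the line `a_k x + b_k y = c_k` over `x`. -/
noncomputable def lineHeight (k : ι) (x : ℝ) : ℝ := (c k - a k * x) / b k

variable {a b c}

lemma le_lineHeight {k : ι} (hb : b k < 0) {x y : ℝ} (h : (x, y) ∈ region a b c) :
    y ≤ lineHeight a b c k x := by
  rw [lineHeight, le_div_iff_of_neg hb]
  linarith [h k]

lemma lineHeight_le {k : ι} (hb : 0 < b k) {x y : ℝ} (h : (x, y) ∈ region a b c) :
    lineHeight a b c k x ≤ y := by
  rw [lineHeight, div_le_iff₀ hb]
  linarith [h k]

/-- A point of the region at which no inequality with `b_k < 0` is tight can be moved upwards. -/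
lemma exists_gt_mem_region [Finite ι] {x y : ℝ} (h : (x, y) ∈ region a b c)
    (hne : ∀ k, b k < 0 → y ≠ lineHeight a b c k x) : ∃ y' > y, (x, y') ∈ region a b c := by
  have : ∀ k, ∀ᶠ s in 𝓝[>] y, c k ≤ a k * x + b k * s := by
    intro k
    rcases lt_or_ge (b k) 0 with hb | hb
    · have h1 : y < lineHeight a b c k x := lt_of_le_of_ne (le_lineHeight hb h) (hne k hb)
      rw [lineHeight, lt_div_iff_of_neg hb] at h1
      have hc : Continuous fun s => a k * x + b k * s := by fun_prop
      have h2 : c k < a k * x + b k * y := by linarith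
      exact ((hc.continuousAt.eventually (lt_mem_nhds h2)).mono fun s hs => hs.le).filter_mono
        nhdsWithin_le_nhds
    · filter_upwards [self_mem_nhdsWithin] with s hs
      have := h k
      simp only at this
      nlinarith [mul_le_mul_of_nonneg_left (le_of_lt (show y < s from hs)) hb]
  obtain ⟨s, hs, hs'⟩ := ((eventually_all.2 this).and self_mem_nhdsWithin).exists
  exact ⟨s, hs', hs⟩

lemma exists_lt_mem_region [Finite ι] {x y : ℝ} (h : (x, y) ∈ region a b c)
    (hne : ∀ k, 0 < b k → y ≠ lineHeight a b c k x) : ∃ y' < y, (x, y') ∈ region a b c := by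
  have h' : (x, -y) ∈ region a (fun k => -b k) c := fun k => by
    have := h k; simp only at this ⊢; linarith
  obtain ⟨y', hy, hy'⟩ := exists_gt_mem_region h' fun k hk => by
    have := hne k (by linarith)
    rw [lineHeight] at this ⊢
    rw [div_neg]
    exact fun hcon => this (neg_injective hcon)
  exact ⟨-y', by linarith, fun k => by have := hy' k; simp only at this ⊢; linarith⟩

lemma convex_region : Convex ℝ (region a b c) := by
  intro z hz w hw s t hs ht hst k
  simp only [Prod.fst_add, Prod.snd_add, Prod.smul_fst, Prod.smul_snd, smul_eq_mul]
  calc c k = s * c k + t * c k := by rw [← add_mul, hst, one_mul]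
    _ ≤ s * (a k * z.1 + b k * z.2) + t * (a k * w.1 + b k * w.2) :=
      add_le_add (mul_le_mul_of_nonneg_left (hz k) hs) (mul_le_mul_of_nonneg_left (hw k) ht)
    _ = _ := by ring

/-- The vertical slices of a compact region are intervals whose end points lie on the lower and
the upper edges. -/
lemma exists_slice [Finite ι] (hK : IsCompact (region a b c)) {x y : ℝ}
    (h : (x, y) ∈ region a b c) :
    ∃ j k, 0 < b j ∧ b k < 0 ∧ ∀ s, (x, s) ∈ region a b c ↔
      s ∈ Icc (lineHeight a b c j x) (lineHeight a b c k x) := by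
  set S : Set ℝ := (fun s => (x, s)) ⁻¹' region a b c with hS
  have hemb : IsClosedEmbedding fun s : ℝ => (x, s) :=
    Function.LeftInverse.isClosedEmbedding (f := Prod.snd) (fun _ => rfl) (by fun_prop)
      (by fun_prop)
  have hSc : IsCompact S := hemb.isCompact_preimage hK
  have hIcc : S = Icc (sInf S) (sSup S) := by
    refine eq_Icc_of_connected_compact ⟨⟨y, h⟩, Convex.isPreconnected ?_⟩ hSc
    intro s hs t ht p q hp hq hpq
    have := convex_region hs ht hp hq hpq
    have e : p • (x, s) + q • (x, t) = (x, p • s + q • t) := by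
      ext <;> simp [← add_mul, hpq]
    rw [e] at this
    exact this
  have hne : S.Nonempty := ⟨y, h⟩
  obtain ⟨k, hk, hk'⟩ : ∃ k, b k < 0 ∧ sSup S = lineHeight a b c k x := by
    by_contra! hcon
    obtain ⟨y', hy', hmem⟩ := exists_gt_mem_region (hSc.sSup_mem hne) hcon
    exact not_lt.2 (le_csSup hSc.bddAbove hmem) hy'
  obtain ⟨j, hj, hj'⟩ : ∃ k, 0 < b k ∧ sInf S = lineHeight a b c k x := by
    by_contra! hcon
    obtain ⟨y', hy', hmem⟩ := exists_lt_mem_region (hSc.sInf_mem hne) hcon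
    exact not_lt.2 (csInf_le hSc.bddBelow hmem) hy'
  refine ⟨j, k, hj, hk, fun s => ?_⟩
  rw [← hj', ← hk', ← hIcc]
  rfl

lemma continuous_lineHeight (k : ι) : Continuous (lineHeight a b c k) := by
  unfold lineHeight; fun_prop

lemma integrable_lineHeight (hK : IsCompact (region a b c)) (k : ι) {g : ℝ × ℝ → ℝ}
    (hg : Continuous g) :
    Integrable fun x => (region a b c).indicator g (x, lineHeight a b c k x) := by
  have hc : Continuous fun x => (x, lineHeight a b c k x) :=
    continuous_id.prodMk (continuous_lineHeight k)
  have hemb : IsClosedEmbedding fun x => (x, lineHeight a b c k x) :=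
    Function.LeftInverse.isClosedEmbedding (f := Prod.fst) (fun _ => rfl) (by fun_prop) hc
  have hS := hemb.isCompact_preimage hK
  have : (fun x => (region a b c).indicator g (x, lineHeight a b c k x)) =
      ((fun x => (x, lineHeight a b c k x)) ⁻¹' region a b c).indicator
        fun x => g (x, lineHeight a b c k x) := by
    ext x; rfl
  rw [this, integrable_indicator_iff hS.measurableSet]
  exact (hg.comp hc).continuousOn.integrableOn_compact hS

/-- Fubini and the fundamental theorem of calculus on vertical slices: if `G = ∂g/∂y` then
`∫ G` over the region is the boundary integral of `g`, parametrised by the first coordinate. -/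
theorem integral_region_eq [Fintype ι] (hK : IsCompact (region a b c))
    (hnull : ∀ j k, j ≠ k → 0 < b j * b k →
      {x | lineHeight a b c j x = lineHeight a b c k x ∧
        (x, lineHeight a b c j x) ∈ region a b c}.Countable)
    {G g : ℝ × ℝ → ℝ} (hG : IntegrableOn G (region a b c)) (hg : Continuous g)
    (hFTC : ∀ x y₁ y₂, y₁ ≤ y₂ → ∫ y in y₁..y₂, G (x, y) = g (x, y₂) - g (x, y₁)) :
    ∫ z in region a b c, G z = -∑ k, (SignType.sign (b k) : ℝ) *
      ∫ x, (region a b c).indicator g (x, lineHeight a b c k x) := by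
  classical
  have hint : ∀ k, Integrable fun x => (SignType.sign (b k) : ℝ) *
      (region a b c).indicator g (x, lineHeight a b c k x) := fun k =>
    (integrable_lineHeight hK k hg).const_mul _
  rw [← integral_indicator hK.measurableSet]
  rw [← integrable_indicator_iff hK.measurableSet, Measure.volume_eq_prod] at hG
  rw [Measure.volume_eq_prod, integral_prod _ hG]
  simp_rw [← integral_const_mul]
  rw [← integral_finsetSum _ fun k _ => hint k, ← integral_neg]
  refine integral_congr_ae ?_
  have hN : ∀ᵐ x : ℝ, ∀ j k, j ≠ k → 0 < b j * b k →
      ¬ (lineHeight a b c j x = lineHeight a b c k x ∧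
        (x, lineHeight a b c j x) ∈ region a b c) := by
    rw [ae_all_iff]; intro j
    rw [ae_all_iff]; intro k
    by_cases h : j ≠ k ∧ 0 < b j * b k
    · have := (hnull j k h.1 h.2).measure_zero volume
      rw [measure_eq_zero_iff_ae_notMem] at this
      filter_upwards [this] with x hx _ _ hcon using hx hcon
    · exact ae_of_all _ fun x h1 h2 => absurd ⟨h1, h2⟩ h
  filter_upwards [hN] with x hx
  by_cases hne : ∃ y, (x, y) ∈ region a b c
  swap
  · push Not at hne
    simp [indicator, hne]
  obtain ⟨y, hy⟩ := hne
  obtain ⟨j, k, hj, hk, hjk⟩ := exists_slice hK hy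
  have hle : lineHeight a b c j x ≤ lineHeight a b c k x := by
    have := (hjk y).1 hy; exact this.1.trans this.2
  have hjm := (hjk _).2 (left_mem_Icc.2 hle)
  have hkm := (hjk _).2 (right_mem_Icc.2 hle)
  have hterm : ∀ i, (SignType.sign (b i) : ℝ) *
      (region a b c).indicator g (x, lineHeight a b c i x) =
      (if i = j then g (x, lineHeight a b c j x) else 0) -
        (if i = k then g (x, lineHeight a b c k x) else 0) := by
    intro i
    rcases lt_trichotomy (b i) 0 with hb | hb | hb
    · have hij : i ≠ j := by rintro rfl; linarith
      rw [sign_neg hb, if_neg hij]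
      by_cases hik : i = k
      · subst hik; rw [if_pos rfl, indicator_of_mem hkm]; simp
      · rw [if_neg hik, indicator_of_notMem]
        · simp
        intro hcon
        refine hx i k hik (mul_pos_of_neg_of_neg hb hk) ⟨?_, hcon⟩
        exact le_antisymm ((hjk _).1 hcon).2 (le_lineHeight hb hkm)
    · have hij : i ≠ j := by rintro rfl; linarith
      have hik : i ≠ k := by rintro rfl; linarith
      simp [hb, hij, hik]
    · have hik : i ≠ k := by rintro rfl; linarith
      rw [sign_pos hb, if_neg hik]
      by_cases hij : i = j
      · subst hij; rw [if_pos rfl, indicator_of_mem hjm]; simp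
      · rw [if_neg hij, indicator_of_notMem]
        · simp
        intro hcon
        refine hx i j hij (mul_pos hb hj) ⟨?_, hcon⟩
        exact le_antisymm (lineHeight_le hb hjm) ((hjk _).1 hcon).1
  rw [Finset.sum_congr rfl fun i _ => hterm i, Finset.sum_sub_distrib]
  simp only [Finset.sum_ite_eq', Finset.mem_univ, if_true, neg_sub]
  have hind : (fun y => (region a b c).indicator G (x, y)) =
      (Icc (lineHeight a b c j x) (lineHeight a b c k x)).indicator fun y => G (x, y) := by
    ext s
    by_cases hs : (x, s) ∈ region a b c
    · rw [indicator_of_mem hs, indicator_of_mem ((hjk s).1 hs)]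
    · rw [indicator_of_notMem hs, indicator_of_notMem fun h => hs ((hjk s).2 h)]
  rw [hind, integral_indicator measurableSet_Icc, integral_Icc_eq_integral_Ioc,
    ← intervalIntegral.integral_of_le hle, hFTC _ _ _ hle]

/-- A nonnegative convex function is bounded on a vertical slice by the sum of its values over
the boundary points of the slice. -/
lemma le_sum_lineHeight [Fintype ι] (hK : IsCompact (region a b c)) {u : ℝ × ℝ → ℝ}
    (hu : ConvexOn ℝ (region a b c) u) (hu0 : ∀ z, 0 ≤ u z) {x y : ℝ}
    (h : (x, y) ∈ region a b c) :
    u (x, y) ≤ ∑ k, |(SignType.sign (b k) : ℝ)| *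
      (region a b c).indicator u (x, lineHeight a b c k x) := by
  obtain ⟨j, k, hj, hk, hjk⟩ := exists_slice hK h
  have hy := (hjk y).1 h
  have hle : lineHeight a b c j x ≤ lineHeight a b c k x := hy.1.trans hy.2
  have hjm := (hjk _).2 (left_mem_Icc.2 hle)
  have hkm := (hjk _).2 (right_mem_Icc.2 hle)
  have hnn : ∀ i ∈ Finset.univ, 0 ≤ |(SignType.sign (b i) : ℝ)| *
      (region a b c).indicator u (x, lineHeight a b c i x) := fun i _ =>
    mul_nonneg (abs_nonneg _) (indicator_nonneg (fun z _ => hu0 z) _)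
  have hseg : (x, y) ∈ segment ℝ (x, lineHeight a b c j x) (x, lineHeight a b c k x) := by
    obtain ⟨p, q, hp, hq, hpq, hval⟩ := (segment_eq_Icc hle).symm ▸ hy
    refine ⟨p, q, hp, hq, hpq, Prod.ext ?_ ?_⟩
    · simp [← add_mul, hpq]
    · simpa using hval
  refine (hu.le_max_of_mem_segment hjm hkm hseg).trans (max_le ?_ ?_)
  · refine le_trans (le_of_eq ?_) (Finset.single_le_sum hnn (Finset.mem_univ j))
    rw [sign_pos hj, indicator_of_mem hjm]; simp
  · refine le_trans (le_of_eq ?_) (Finset.single_le_sum hnn (Finset.mem_univ k))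
    rw [sign_neg hk, indicator_of_mem hkm]; simp

end Region

/-! ### Euler's identity for the integral of a crease -/

/-- The affine function `z ↦ v₁ z₁ + v₂ z₂ + v₃`. -/
def aff (v : ℝ × ℝ × ℝ) (z : ℝ × ℝ) : ℝ := v.1 * z.1 + v.2.1 * z.2 + v.2.2

/-- The simple piecewise linear function `max (v₁ z₁ + v₂ z₂ + v₃) 0`. -/
def crease (v : ℝ × ℝ × ℝ) (z : ℝ × ℝ) : ℝ := max (aff v z) 0

@[fun_prop]
lemma continuous_aff (v : ℝ × ℝ × ℝ) : Continuous (aff v) := by unfold aff; fun_prop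

@[fun_prop]
lemma continuous_crease (v : ℝ × ℝ × ℝ) : Continuous (crease v) := by unfold crease; fun_prop

lemma crease_nonneg (v : ℝ × ℝ × ℝ) (z : ℝ × ℝ) : 0 ≤ crease v z := le_max_right _ _

lemma integral_deriv_crease_mul (α β p y₁ y₂ : ℝ) :
    ∫ y in y₁..y₂, (max (α * y + β) 0 + if 0 < α * y + β then α * (y - p) else 0) =
      max (α * y₂ + β) 0 * (y₂ - p) - max (α * y₁ + β) 0 * (y₁ - p) := by
  refine integral_eq_of_hasDerivAt_off_countable (fun y => max (α * y + β) 0 * (y - p)) _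
    (s := {y | α ≠ 0 ∧ α * y + β = 0}) ?_ (by fun_prop) ?_ ?_
  · refine Set.Subsingleton.countable fun y hy y' hy' => ?_
    have : α * y = α * y' := by linarith [hy.2, hy'.2]
    exact mul_left_cancel₀ hy.1 this
  · rintro y ⟨-, hy⟩
    have hlin : HasDerivAt (fun y => α * y + β) α y := by
      simpa using ((hasDerivAt_id y).const_mul α).add_const β
    have hid : HasDerivAt (fun y => y - p) 1 y := (hasDerivAt_id y).sub_const p
    rcases lt_trichotomy (α * y + β) 0 with h | h | h
    · rw [max_eq_right h.le, if_neg h.not_gt, add_zero]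
      refine (hasDerivAt_const y (0 : ℝ)).congr_of_eventuallyEq ?_
      filter_upwards [hlin.continuousAt.eventually (gt_mem_nhds h)] with s hs
      rw [max_eq_right (le_of_lt hs), zero_mul]
    · have hα : α = 0 := by
        by_contra hα; exact hy ⟨hα, h⟩
      subst hα
      have hβ : β = 0 := by simpa using h
      subst hβ
      simpa using hasDerivAt_const y (0 : ℝ)
    · rw [max_eq_left h.le, if_pos h]
      have := hlin.mul hid
      refine (this.congr_deriv (by ring)).congr_of_eventuallyEq ?_
      filter_upwards [hlin.continuousAt.eventually (lt_mem_nhds h)] with s hs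
      rw [max_eq_left (le_of_lt hs)]
      rfl
  · refine IntervalIntegrable.add (Continuous.intervalIntegrable (by fun_prop) _ _) ?_
    have : (fun y => if 0 < α * y + β then α * (y - p) else 0) =
        {y | 0 < α * y + β}.indicator fun y => α * (y - p) := by
      ext y; simp [indicator]
    rw [this, intervalIntegrable_iff]
    refine IntegrableOn.indicator ?_ (measurableSet_lt (by fun_prop) (by fun_prop))
    rw [← intervalIntegrable_iff]
    exact Continuous.intervalIntegrable (by fun_prop) _ _

namespace DelzantPolygon

variable (P : DelzantPolygon)

lemma carrier_eq_region : P.carrier =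
    region (fun k => ((P.h k).1 : ℝ)) (fun k => ((P.h k).2 : ℝ)) (fun k => (P.c k : ℝ)) := rfl

lemma preimage_swap_carrier : Prod.swap ⁻¹' P.carrier =
    region (fun k => ((P.h k).2 : ℝ)) (fun k => ((P.h k).1 : ℝ)) (fun k => (P.c k : ℝ)) := by
  ext z
  simp only [carrier_eq_region, region, mem_preimage, mem_ofPred_eq, Prod.fst_swap, Prod.snd_swap]
  exact forall_congr' fun k => by rw [add_comm]

/-- Substitution `x = C - b t`, where `b` may vanish. -/
lemma sign_mul_integral_comp (b C : ℝ) (ψ : ℝ → ℝ) :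
    (SignType.sign b : ℝ) * ∫ x, ψ x = b * ∫ t, ψ (C - b * t) := by
  rcases eq_or_ne b 0 with rfl | hb
  · simp
  rw [Measure.integral_comp_mul_left (fun s => ψ (C - s)) b, integral_sub_left_eq_self ψ volume C,
    smul_eq_mul, ← mul_assoc]
  congr 1
  rw [abs_inv]
  rcases lt_or_gt_of_ne hb with h | h
  · rw [sign_neg h, abs_of_neg h]; simp; field_simp
  · rw [sign_pos h, abs_of_pos h]; simp; field_simp

/-- The integral over an edge of a function, with respect to the boundary measure. -/
noncomputable def edgeInt (k : Fin P.numEdges) (f : ℝ × ℝ → ℝ) : ℝ :=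
  ∫ t in Icc (P.lo k) (P.hi k), f (P.edgeLine k t)

lemma edgeInt_eq (k : Fin P.numEdges) (f : ℝ × ℝ → ℝ) :
    P.edgeInt k f = ∫ t, P.carrier.indicator f (P.edgeLine k t) := by
  rw [edgeInt, ← integral_indicator measurableSet_Icc]
  congr 1
  ext t
  simp only [indicator, edgeLine_mem_carrier_iff]

lemma edgeLine_eq_lineHeight (k : Fin P.numEdges) (hb : ((P.h k).2 : ℝ) ≠ 0) (t : ℝ) :
    P.edgeLine k t = ((P.edgeLine k t).1, lineHeight (fun k => ((P.h k).1 : ℝ))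
      (fun k => ((P.h k).2 : ℝ)) (fun k => (P.c k : ℝ)) k (P.edgeLine k t).1) := by
  refine Prod.ext rfl ?_
  have := P.ldist_edgeLine_self k t
  rw [ldist] at this
  simp only [lineHeight]
  rw [eq_div_iff hb]
  linarith

lemma edgeLine_eq_lineHeight_swap (k : Fin P.numEdges) (hb : ((P.h k).1 : ℝ) ≠ 0) (t : ℝ) :
    P.edgeLine k t = (lineHeight (fun k => ((P.h k).2 : ℝ))
      (fun k => ((P.h k).1 : ℝ)) (fun k => (P.c k : ℝ)) k (P.edgeLine k t).2,
      (P.edgeLine k t).2) := by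
  refine Prod.ext ?_ rfl
  have := P.ldist_edgeLine_self k t
  rw [ldist] at this
  simp only [lineHeight]
  rw [eq_div_iff hb]
  linarith

lemma sign_mul_integral_lineHeight (k : Fin P.numEdges) (f : ℝ × ℝ → ℝ) :
    (SignType.sign ((P.h k).2 : ℝ) : ℝ) * ∫ x, P.carrier.indicator f
      (x, lineHeight (fun k => ((P.h k).1 : ℝ)) (fun k => ((P.h k).2 : ℝ))
        (fun k => (P.c k : ℝ)) k x) = (P.h k).2 * P.edgeInt k f := by
  rcases eq_or_ne ((P.h k).2 : ℝ) 0 with hb | hb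
  · simp [hb]
  rw [sign_mul_integral_comp _ (P.edgeLine k 0).1, edgeInt_eq]
  congr 2
  ext t
  rw [P.edgeLine_eq_lineHeight k hb t]
  have : (P.edgeLine k 0).1 - (P.h k).2 * t = (P.edgeLine k t).1 := by
    simp only [edgeLine_fst]; ring
  rw [this]

lemma abs_sign_mul_integral_lineHeight (k : Fin P.numEdges) (f : ℝ × ℝ → ℝ) :
    |(SignType.sign ((P.h k).2 : ℝ) : ℝ)| * ∫ x, P.carrier.indicator f
      (x, lineHeight (fun k => ((P.h k).1 : ℝ)) (fun k => ((P.h k).2 : ℝ))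
        (fun k => (P.c k : ℝ)) k x) = |((P.h k).2 : ℝ)| * P.edgeInt k f := by
  have := P.sign_mul_integral_lineHeight k f
  rcases lt_trichotomy ((P.h k).2 : ℝ) 0 with hb | hb | hb
  · rw [sign_neg hb] at this ⊢; rw [abs_of_neg hb]; simp at this ⊢; linarith
  · simp [hb]
  · rw [sign_pos hb] at this ⊢; rw [abs_of_pos hb]; simp at this ⊢; linarith

lemma sign_mul_integral_lineHeight_swap (k : Fin P.numEdges) (f : ℝ × ℝ → ℝ) :
    (SignType.sign ((P.h k).1 : ℝ) : ℝ) * ∫ y, (Prod.swap ⁻¹' P.carrier).indicator (f ∘ Prod.swap)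
      (y, lineHeight (fun k => ((P.h k).2 : ℝ)) (fun k => ((P.h k).1 : ℝ))
        (fun k => (P.c k : ℝ)) k y) = (P.h k).1 * P.edgeInt k f := by
  rcases eq_or_ne ((P.h k).1 : ℝ) 0 with hb | hb
  · simp [hb]
  have hneg := sign_mul_integral_comp (-((P.h k).1 : ℝ)) (P.edgeLine k 0).2
    fun y => (Prod.swap ⁻¹' P.carrier).indicator (f ∘ Prod.swap)
      (y, lineHeight (fun k => ((P.h k).2 : ℝ)) (fun k => ((P.h k).1 : ℝ))
        (fun k => (P.c k : ℝ)) k y)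
  rw [Left.sign_neg, SignType.coe_neg, neg_mul, neg_mul, neg_inj] at hneg
  rw [hneg, edgeInt_eq]
  congr 2
  ext t
  rw [P.edgeLine_eq_lineHeight_swap k hb t]
  have : (P.edgeLine k 0).2 - -((P.h k).1 : ℝ) * t = (P.edgeLine k t).2 := by
    simp only [edgeLine_snd]; ring
  rw [this]
  rfl

lemma abs_sign_mul_integral_lineHeight_swap (k : Fin P.numEdges) (f : ℝ × ℝ → ℝ) :
    |(SignType.sign ((P.h k).1 : ℝ) : ℝ)| * ∫ y, (Prod.swap ⁻¹' P.carrier).indicator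
      (f ∘ Prod.swap) (y, lineHeight (fun k => ((P.h k).2 : ℝ)) (fun k => ((P.h k).1 : ℝ))
        (fun k => (P.c k : ℝ)) k y) = |((P.h k).1 : ℝ)| * P.edgeInt k f := by
  have := P.sign_mul_integral_lineHeight_swap k f
  rcases lt_trichotomy ((P.h k).1 : ℝ) 0 with hb | hb | hb
  · rw [sign_neg hb] at this ⊢; rw [abs_of_neg hb]; simp at this ⊢; linarith
  · simp [hb]
  · rw [sign_pos hb] at this ⊢; rw [abs_of_pos hb]; simp at this ⊢; linarith

lemma isCompact_preimage_swap : IsCompact (Prod.swap ⁻¹' P.carrier) :=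
  (Homeomorph.prodComm ℝ ℝ).isClosedEmbedding.isCompact_preimage P.isCompact_carrier

lemma eq_of_tight {j k : Fin P.numEdges} (hjk : j ≠ k) {z w : ℝ × ℝ}
    (h1 : P.ldist j z = 0) (h2 : P.ldist k z = 0) (h3 : P.ldist j w = 0) (h4 : P.ldist k w = 0) :
    z = w := by
  have hc := P.cross_ne_zero_of_tight hjk h1 h2
  simp only [ldist, cross] at *
  have e1 : (((P.h j).1 : ℝ) * (P.h k).2 - (P.h j).2 * (P.h k).1) * (z.1 - w.1) = 0 := by
    linear_combination ((P.h k).2 : ℝ) * (h1 - h3) - ((P.h j).2 : ℝ) * (h2 - h4)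
  have e2 : (((P.h j).1 : ℝ) * (P.h k).2 - (P.h j).2 * (P.h k).1) * (z.2 - w.2) = 0 := by
    linear_combination -((P.h k).1 : ℝ) * (h1 - h3) + ((P.h j).1 : ℝ) * (h2 - h4)
  exact Prod.ext (sub_eq_zero.1 ((mul_eq_zero.1 e1).resolve_left hc))
    (sub_eq_zero.1 ((mul_eq_zero.1 e2).resolve_left hc))

lemma ldist_lineHeight {k : Fin P.numEdges} (hb : ((P.h k).2 : ℝ) ≠ 0) (x : ℝ) :
    P.ldist k (x, lineHeight (fun k => ((P.h k).1 : ℝ)) (fun k => ((P.h k).2 : ℝ))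
      (fun k => (P.c k : ℝ)) k x) = 0 := by
  simp only [ldist, lineHeight]; field_simp; ring

lemma ldist_lineHeight_swap {k : Fin P.numEdges} (hb : ((P.h k).1 : ℝ) ≠ 0) (y : ℝ) :
    P.ldist k (lineHeight (fun k => ((P.h k).2 : ℝ)) (fun k => ((P.h k).1 : ℝ))
      (fun k => (P.c k : ℝ)) k y, y) = 0 := by
  simp only [ldist, lineHeight]; field_simp; ring

lemma integrableOn_deriv_crease (v : ℝ × ℝ × ℝ) {φ : ℝ × ℝ → ℝ} (hφ : Continuous φ) :
    IntegrableOn (fun z => crease v z + if 0 < aff v z then φ z else 0) P.carrier := by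
  refine Integrable.add ((continuous_crease v).continuousOn.integrableOn_compact
    P.isCompact_carrier) ?_
  have : (fun z => if 0 < aff v z then φ z else 0) = {z | 0 < aff v z}.indicator φ := by
    ext y; simp [indicator]
  rw [this]
  exact (hφ.continuousOn.integrableOn_compact P.isCompact_carrier).indicator
    (measurableSet_lt (by fun_prop) (by fun_prop))

/-- The divergence theorem for the vertical vector field `max (aff v) 0 · (z₂ - p₂)`. -/
lemma integral_deriv_crease_snd (v : ℝ × ℝ × ℝ) (p : ℝ) :
    ∫ z in P.carrier, (crease v z + if 0 < aff v z then v.2.1 * (z.2 - p) else 0) =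
      -∑ k, ((P.h k).2 : ℝ) * P.edgeInt k fun z => crease v z * (z.2 - p) := by
  simp_rw [← sign_mul_integral_lineHeight]
  refine integral_region_eq P.isCompact_carrier ?_ (P.integrableOn_deriv_crease v (by fun_prop))
    (g := fun z => crease v z * (z.2 - p)) (by fun_prop) ?_
  · intro j k hjk hb
    refine Set.Subsingleton.countable fun x hx x' hx' => ?_
    have hbj : ((P.h j).2 : ℝ) ≠ 0 := by rintro h; simp [h] at hb
    have hbk : ((P.h k).2 : ℝ) ≠ 0 := by rintro h; simp [h] at hb
    exact (Prod.ext_iff.1 (P.eq_of_tight hjk (P.ldist_lineHeight hbj x)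
      (hx.1 ▸ P.ldist_lineHeight hbk x) (P.ldist_lineHeight hbj x')
      (hx'.1 ▸ P.ldist_lineHeight hbk x'))).1
  · intro x y₁ y₂ _
    have := integral_deriv_crease_mul v.2.1 (v.1 * x + v.2.2) p y₁ y₂
    simp only [crease, aff]
    convert this using 3 <;> ring_nf

lemma integral_deriv_crease_fst (v : ℝ × ℝ × ℝ) (p : ℝ) :
    ∫ z in P.carrier, (crease v z + if 0 < aff v z then v.1 * (z.1 - p) else 0) =
      -∑ k, ((P.h k).1 : ℝ) * P.edgeInt k fun z => crease v z * (z.1 - p) := by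
  simp_rw [← sign_mul_integral_lineHeight_swap]
  have hmp : MeasurePreserving (Prod.swap : ℝ × ℝ → ℝ × ℝ) volume volume :=
    Measure.measurePreserving_swap
  rw [← hmp.setIntegral_preimage_emb MeasurableEquiv.prodComm.measurableEmbedding,
    preimage_swap_carrier]
  refine integral_region_eq (P.preimage_swap_carrier ▸ P.isCompact_preimage_swap) ?_ ?_
    (g := (fun z => crease v z * (z.1 - p)) ∘ Prod.swap)
    (Continuous.comp (by fun_prop) continuous_swap) ?_
  · intro j k hjk hb
    refine Set.Subsingleton.countable fun x hx x' hx' => ?_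
    have hbj : ((P.h j).1 : ℝ) ≠ 0 := by rintro h; simp [h] at hb
    have hbk : ((P.h k).1 : ℝ) ≠ 0 := by rintro h; simp [h] at hb
    exact (Prod.ext_iff.1 (P.eq_of_tight hjk (P.ldist_lineHeight_swap hbj x)
      (hx.1 ▸ P.ldist_lineHeight_swap hbk x) (P.ldist_lineHeight_swap hbj x')
      (hx'.1 ▸ P.ldist_lineHeight_swap hbk x'))).2
  · rw [← preimage_swap_carrier]
    exact (hmp.integrableOn_comp_preimage MeasurableEquiv.prodComm.measurableEmbedding).2
      (P.integrableOn_deriv_crease v (φ := fun z => v.1 * (z.1 - p)) (by fun_prop))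
  · intro x y₁ y₂ _
    have := integral_deriv_crease_mul v.1 (v.2.1 * x + v.2.2) p y₁ y₂
    simp only [crease, aff, Function.comp, Prod.fst_swap, Prod.snd_swap]
    convert this using 3 <;> ring_nf

lemma integrableOn_edge {f : ℝ × ℝ → ℝ} (hf : Continuous f) (k : Fin P.numEdges) :
    IntegrableOn (fun t => f (P.edgeLine k t)) (Icc (P.lo k) (P.hi k)) :=
  (hf.comp (P.continuous_edgeLine k)).continuousOn.integrableOn_Icc

/-- Euler's identity: the divergence of `max (aff v) 0 · (z - p)` is `3 max (aff v) 0` if `aff v`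
vanishes at `p`. -/
theorem three_mul_integral_crease (v : ℝ × ℝ × ℝ) {p : ℝ × ℝ} (hp : aff v p = 0) :
    3 * ∫ z, crease v z ∂P.areaMeasure =
      ∑ k, P.ldist k p * P.edgeInt k (crease v) := by
  have h1 := P.integral_deriv_crease_fst v p.1
  have h2 := P.integral_deriv_crease_snd v p.2
  have h3 := integral_add (P.integrableOn_deriv_crease v (φ := fun z => v.1 * (z.1 - p.1))
    (by fun_prop)) (P.integrableOn_deriv_crease v (φ := fun z => v.2.1 * (z.2 - p.2))
    (by fun_prop))
  rw [h1, h2] at h3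
  rw [areaMeasure, ← integral_const_mul]
  have e : (fun z => 3 * crease v z) = fun z =>
      (crease v z + if 0 < aff v z then v.1 * (z.1 - p.1) else 0) +
      (crease v z + if 0 < aff v z then v.2.1 * (z.2 - p.2) else 0) := by
    ext z
    unfold crease
    split_ifs with h
    · rw [max_eq_left h.le]
      simp only [aff] at hp ⊢
      linear_combination hp
    · rw [max_eq_right (not_lt.1 h)]; ring
  rw [e, h3, ← neg_add, ← Finset.sum_add_distrib, ← Finset.sum_neg_distrib]
  refine Finset.sum_congr rfl fun k _ => ?_
  simp only [edgeInt]
  rw [← integral_const_mul, ← integral_const_mul, ← integral_const_mul, ← integral_add,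
    ← integral_neg]
  · refine integral_congr_ae (ae_of_all _ fun t => ?_)
    have := P.ldist_edgeLine_self k t
    simp only [ldist] at this ⊢
    linear_combination (-crease v (P.edgeLine k t)) * this
  · exact (P.integrableOn_edge (f := fun z => crease v z * (z.1 - p.1)) (by fun_prop) k).const_mul _
  · exact (P.integrableOn_edge (f := fun z => crease v z * (z.2 - p.2)) (by fun_prop) k).const_mul _

lemma edgeInt_nonneg {u : ℝ × ℝ → ℝ} (hu0 : ∀ z, 0 ≤ u z) (k : Fin P.numEdges) :
    0 ≤ P.edgeInt k u := integral_nonneg fun _ => hu0 _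

/-- The planar Sobolev inequality for convex functions: on `P` one has `u(x, y)² ≤ A(x) B(y)`,
where `A(x)` and `B(y)` are the sums of the values of `u` over the boundary points of the vertical
and horizontal lines through `(x, y)`. -/
theorem exists_integral_sq_le : ∃ C > 0, ∀ u : ℝ × ℝ → ℝ, Continuous u → (∀ z, 0 ≤ u z) →
    ConvexOn ℝ P.carrier u →
      ∫ z, u z ^ 2 ∂P.areaMeasure ≤ (C * ∫ z, u z ∂P.boundaryMeasure) ^ 2 := by
  set M : ℝ := ∑ k, (|((P.h k).1 : ℝ)| + |((P.h k).2 : ℝ)|) with hM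
  have hM0 : 0 ≤ M := Finset.sum_nonneg fun k _ => by positivity
  refine ⟨M + 1, by positivity, fun u hc hu0 hu => ?_⟩
  have hcs : Continuous (u ∘ Prod.swap) := hc.comp continuous_swap
  have hus : ConvexOn ℝ (Prod.swap ⁻¹' P.carrier) (u ∘ Prod.swap) :=
    hu.comp_linearMap (LinearEquiv.prodComm ℝ ℝ ℝ).toLinearMap
  set I := ∫ z, u z ∂P.boundaryMeasure with hI
  have hIk : I = ∑ k, P.edgeInt k u := P.integral_boundary (P.integrable_boundary_of_continuous hc)
  have hI0 : 0 ≤ I := integral_nonneg hu0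
  have hkI : ∀ k, P.edgeInt k u ≤ I := fun k => hIk ▸
    Finset.single_le_sum (fun k _ => P.edgeInt_nonneg hu0 k) (Finset.mem_univ k)
  set A : ℝ → ℝ := fun x => ∑ k, |(SignType.sign ((P.h k).2 : ℝ) : ℝ)| * P.carrier.indicator u
      (x, lineHeight (fun k => ((P.h k).1 : ℝ)) (fun k => ((P.h k).2 : ℝ))
        (fun k => (P.c k : ℝ)) k x) with hA
  set B : ℝ → ℝ := fun y => ∑ k, |(SignType.sign ((P.h k).1 : ℝ) : ℝ)| *
      (Prod.swap ⁻¹' P.carrier).indicator (u ∘ Prod.swap)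
      (y, lineHeight (fun k => ((P.h k).2 : ℝ)) (fun k => ((P.h k).1 : ℝ))
        (fun k => (P.c k : ℝ)) k y) with hB
  have hAk : ∀ k ∈ Finset.univ, Integrable fun x => |(SignType.sign ((P.h k).2 : ℝ) : ℝ)| *
      P.carrier.indicator u (x, lineHeight (fun k => ((P.h k).1 : ℝ)) (fun k => ((P.h k).2 : ℝ))
        (fun k => (P.c k : ℝ)) k x) := fun k _ =>
    (integrable_lineHeight P.isCompact_carrier k hc).const_mul _
  have hBk : ∀ k ∈ Finset.univ, Integrable fun y => |(SignType.sign ((P.h k).1 : ℝ) : ℝ)| *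
      (Prod.swap ⁻¹' P.carrier).indicator (u ∘ Prod.swap) (y, lineHeight
        (fun k => ((P.h k).2 : ℝ)) (fun k => ((P.h k).1 : ℝ)) (fun k => (P.c k : ℝ)) k y) := by
    intro k _
    refine Integrable.const_mul ?_ _
    rw [preimage_swap_carrier]
    exact integrable_lineHeight (P.preimage_swap_carrier ▸ P.isCompact_preimage_swap) k hcs
  have hA0 : ∀ x, 0 ≤ A x := fun x => Finset.sum_nonneg fun k _ =>
    mul_nonneg (abs_nonneg _) (indicator_nonneg (fun z _ => hu0 z) _)
  have hB0 : ∀ x, 0 ≤ B x := fun x => Finset.sum_nonneg fun k _ =>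
    mul_nonneg (abs_nonneg _) (indicator_nonneg (fun z _ => hu0 _) _)
  have hAint : Integrable A := integrable_finsetSum _ hAk
  have hBint : Integrable B := integrable_finsetSum _ hBk
  have hAle : ∫ x, A x ≤ (M + 1) * I := by
    rw [hA, integral_finsetSum _ hAk]
    simp_rw [integral_const_mul, abs_sign_mul_integral_lineHeight]
    calc ∑ k, |((P.h k).2 : ℝ)| * P.edgeInt k u
        ≤ ∑ k, (|((P.h k).1 : ℝ)| + |((P.h k).2 : ℝ)|) * I := Finset.sum_le_sum fun k _ =>
          mul_le_mul (le_add_of_nonneg_left (abs_nonneg _)) (hkI k) (P.edgeInt_nonneg hu0 k)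
            (by positivity)
      _ = M * I := by rw [hM, Finset.sum_mul]
      _ ≤ (M + 1) * I := by nlinarith
  have hBle : ∫ y, B y ≤ (M + 1) * I := by
    rw [hB, integral_finsetSum _ hBk]
    simp_rw [integral_const_mul, abs_sign_mul_integral_lineHeight_swap]
    calc ∑ k, |((P.h k).1 : ℝ)| * P.edgeInt k u
        ≤ ∑ k, (|((P.h k).1 : ℝ)| + |((P.h k).2 : ℝ)|) * I := Finset.sum_le_sum fun k _ =>
          mul_le_mul (le_add_of_nonneg_right (abs_nonneg _)) (hkI k) (P.edgeInt_nonneg hu0 k)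
            (by positivity)
      _ = M * I := by rw [hM, Finset.sum_mul]
      _ ≤ (M + 1) * I := by nlinarith
  have hprod : Integrable fun z : ℝ × ℝ => A z.1 * B z.2 := by
    rw [Measure.volume_eq_prod]; exact hAint.mul_prod hBint
  calc ∫ z, u z ^ 2 ∂P.areaMeasure ≤ ∫ z, A z.1 * B z.2 ∂P.areaMeasure := by
        refine integral_mono_ae (P.integrable_area_of_continuous (by fun_prop))
          hprod.integrableOn ?_
        filter_upwards [P.ae_area_mem] with z hz
        rw [pow_two]
        refine mul_le_mul (le_sum_lineHeight P.isCompact_carrier hu hu0 hz) ?_ (hu0 _) (hA0 _)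
        have h := le_sum_lineHeight (P.preimage_swap_carrier ▸ P.isCompact_preimage_swap)
          (P.preimage_swap_carrier ▸ hus) (fun w => hu0 _) (x := z.2) (y := z.1)
          (P.preimage_swap_carrier ▸ hz)
        rw [← preimage_swap_carrier] at h
        exact h
    _ ≤ ∫ z : ℝ × ℝ, A z.1 * B z.2 := by
        refine setIntegral_le_integral hprod (ae_of_all _ fun z => ?_)
        exact mul_nonneg (hA0 _) (hB0 _)
    _ = (∫ x, A x) * ∫ y, B y := by
        rw [Measure.volume_eq_prod]; exact integral_prod_mul A B
    _ ≤ ((M + 1) * I) * ((M + 1) * I) := mul_le_mul hAle hBle (integral_nonneg hB0) (by positivity)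
    _ = _ := by ring

end DelzantPolygon

/-! ### The Futaki invariant of creases -/

lemma aff_add (v w : ℝ × ℝ × ℝ) (z : ℝ × ℝ) : aff (v + w) z = aff v z + aff w z := by
  simp only [aff, Prod.fst_add, Prod.snd_add]; ring

lemma aff_smul (r : ℝ) (v : ℝ × ℝ × ℝ) (z : ℝ × ℝ) : aff (r • v) z = r * aff v z := by
  simp only [aff, Prod.smul_fst, Prod.smul_snd, smul_eq_mul]; ring

lemma aff_neg (v : ℝ × ℝ × ℝ) (z : ℝ × ℝ) : aff (-v) z = -aff v z := by
  simp only [aff, Prod.fst_neg, Prod.snd_neg]; ring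

lemma aff_combo (v : ℝ × ℝ × ℝ) {s t : ℝ} (hst : s + t = 1) (z w : ℝ × ℝ) :
    aff v (s • z + t • w) = s * aff v z + t * aff v w := by
  simp only [aff, Prod.fst_add, Prod.snd_add, Prod.smul_fst, Prod.smul_snd, smul_eq_mul]
  linear_combination -v.2.2 * hst

lemma crease_sub_crease_neg (v : ℝ × ℝ × ℝ) (z : ℝ × ℝ) :
    crease v z = crease (-v) z + aff v z := by
  simp only [crease, aff_neg]
  rcases le_total (aff v z) 0 with h | h
  · rw [max_eq_right h, max_eq_left (by linarith)]; ring
  · rw [max_eq_left h, max_eq_right (by linarith)]; ring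

lemma crease_smul {r : ℝ} (hr : 0 ≤ r) (v : ℝ × ℝ × ℝ) (z : ℝ × ℝ) :
    crease (r • v) z = r * crease v z := by
  rw [crease, crease, aff_smul, mul_max_of_nonneg _ _ hr, mul_zero]

lemma convexOn_aff (s : Set (ℝ × ℝ)) (hs : Convex ℝ s) (v : ℝ × ℝ × ℝ) : ConvexOn ℝ s (aff v) :=
  ⟨hs, fun z _ w _ _ _ _ _ hpq => (aff_combo v hpq z w).le⟩

lemma convexOn_crease (s : Set (ℝ × ℝ)) (hs : Convex ℝ s) (v : ℝ × ℝ × ℝ) :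
    ConvexOn ℝ s (crease v) :=
  (convexOn_aff s hs v).sup (convexOn_const 0 hs)

/-- Lines are null sets. -/
lemma volume_aff_eq_zero {v : ℝ × ℝ × ℝ} (hv : v.1 ≠ 0 ∨ v.2.1 ≠ 0) :
    volume {z : ℝ × ℝ | aff v z = 0} = 0 := by
  rcases eq_empty_or_nonempty {z : ℝ × ℝ | aff v z = 0} with h | ⟨p, hp⟩
  · rw [h, measure_empty]
  set l : ℝ × ℝ →ₗ[ℝ] ℝ := v.1 • LinearMap.fst ℝ ℝ ℝ + v.2.1 • LinearMap.snd ℝ ℝ ℝ with hl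
  have hs : {z : ℝ × ℝ | aff v z = 0} = (AffineSubspace.mk' p (LinearMap.ker l) : Set (ℝ × ℝ)) := by
    ext z
    have hp' : aff v p = 0 := hp
    simp only [mem_ofPred_eq, SetLike.mem_coe, AffineSubspace.mem_mk', LinearMap.mem_ker, hl, aff,
      vsub_eq_sub, LinearMap.add_apply, LinearMap.smul_apply, LinearMap.fst_apply,
      LinearMap.snd_apply, Prod.fst_sub, Prod.snd_sub, smul_eq_mul] at hp' ⊢
    constructor <;> intro h <;> linarith
  rw [hs]
  refine Measure.addHaar_affineSubspace _ _ fun htop => ?_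
  have h1 : ∀ z, aff v z = 0 := fun z => by
    have : z ∈ {z : ℝ × ℝ | aff v z = 0} := by rw [hs, htop]; trivial
    exact this
  have e0 := h1 (0, 0)
  have e1 := h1 (1, 0)
  have e2 := h1 (0, 1)
  simp only [aff] at e0 e1 e2
  rcases hv with hv | hv
  · exact hv (by linarith)
  · exact hv (by linarith)

namespace DelzantPolygon

variable (P : DelzantPolygon)

/-- The line `aff v = 0` cuts the polygon into two parts with non-empty interior. -/
def IsHonest (v : ℝ × ℝ × ℝ) : Prop :=
  (∃ z ∈ P.carrier, aff v z < 0) ∧ ∃ z ∈ P.carrier, 0 < aff v z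

/-- The coefficients of the affine function `ldist k`. -/
noncomputable def ldistVec (k : Fin P.numEdges) : ℝ × ℝ × ℝ :=
  (((P.h k).1 : ℝ), ((P.h k).2 : ℝ), -(P.c k : ℝ))

lemma aff_ldistVec (k : Fin P.numEdges) (z : ℝ × ℝ) : aff (P.ldistVec k) z = P.ldist k z := by
  simp only [aff, ldistVec, ldist]; ring

lemma ldistVec_ne (k : Fin P.numEdges) : (P.ldistVec k).1 ≠ 0 ∨ (P.ldistVec k).2.1 ≠ 0 := by
  by_contra! hcon
  have := P.normSq_pos k
  simp only [ldistVec] at hcon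
  rw [hcon.1, hcon.2] at this
  simp at this

lemma futaki_add {f g : ℝ × ℝ → ℝ} (hf : Integrable f P.boundaryMeasure)
    (hf' : Integrable f P.areaMeasure) (hg : Integrable g P.boundaryMeasure)
    (hg' : Integrable g P.areaMeasure) :
    P.futaki (fun z => f z + g z) = P.futaki f + P.futaki g := by
  simp only [futaki]
  rw [integral_add hf hg, integral_add hf' hg']
  ring

lemma futaki_const_mul (r : ℝ) (f : ℝ × ℝ → ℝ) :
    P.futaki (fun z => r * f z) = r * P.futaki f := by
  simp only [futaki]
  rw [integral_const_mul, integral_const_mul]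
  ring

lemma isAffineOn_aff (v : ℝ × ℝ × ℝ) : P.IsAffineOn (aff v) := by
  refine ⟨((v.1 • LinearMap.fst ℝ ℝ ℝ + v.2.1 • LinearMap.snd ℝ ℝ ℝ).toAffineMap +
    AffineMap.const ℝ (ℝ × ℝ) v.2.2), fun z _ => ?_⟩
  simp [aff]

lemma futaki_aff_rat (hP : P.IsKPolystable) (q : ℚ × ℚ × ℚ) :
    P.futaki (aff ((q.1 : ℝ), (q.2.1 : ℝ), (q.2.2 : ℝ))) = 0 := by
  refine (hP.2 _ ⟨{q}, Finset.singleton_nonempty q, fun z _ => ?_⟩).2 (P.isAffineOn_aff _)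
  rw [Finset.sup'_singleton]
  rfl

lemma futaki_aff (hP : P.IsKPolystable) (v : ℝ × ℝ × ℝ) : P.futaki (aff v) = 0 := by
  have h1 := P.futaki_aff_rat hP (1, 0, 0)
  have h2 := P.futaki_aff_rat hP (0, 1, 0)
  have h3 := P.futaki_aff_rat hP (0, 0, 1)
  have i1 := fun w => P.integrable_boundary_of_continuous (continuous_aff w)
  have i2 := fun w => P.integrable_area_of_continuous (continuous_aff w)
  have e : aff v = fun z => v.1 * aff (((1 : ℚ) : ℝ), ((0 : ℚ) : ℝ), ((0 : ℚ) : ℝ)) z +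
      (v.2.1 * aff (((0 : ℚ) : ℝ), ((1 : ℚ) : ℝ), ((0 : ℚ) : ℝ)) z +
        v.2.2 * aff (((0 : ℚ) : ℝ), ((0 : ℚ) : ℝ), ((1 : ℚ) : ℝ)) z) := by
    ext z; simp [aff]; ring
  rw [e, futaki_add, futaki_add, futaki_const_mul, futaki_const_mul, futaki_const_mul, h1, h2, h3]
  · ring
  · exact (i1 _).const_mul _
  · exact (i2 _).const_mul _
  · exact (i1 _).const_mul _
  · exact (i2 _).const_mul _
  · exact (i1 _).const_mul _
  · exact (i2 _).const_mul _
  · exact ((i1 _).const_mul _).add ((i1 _).const_mul _)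
  · exact ((i2 _).const_mul _).add ((i2 _).const_mul _)

lemma futaki_add_aff (hP : P.IsKPolystable) {f : ℝ × ℝ → ℝ} (hf : Integrable f P.boundaryMeasure)
    (hf' : Integrable f P.areaMeasure) (v : ℝ × ℝ × ℝ) :
    P.futaki (fun z => f z + aff v z) = P.futaki f := by
  rw [P.futaki_add hf hf' (P.integrable_boundary_of_continuous (continuous_aff v))
    (P.integrable_area_of_continuous (continuous_aff v)), P.futaki_aff hP, add_zero]

lemma futaki_crease_neg (hP : P.IsKPolystable) (v : ℝ × ℝ × ℝ) :
    P.futaki (crease (-v)) = P.futaki (crease v) := by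
  rw [← P.futaki_add_aff hP (P.integrable_boundary_of_continuous (continuous_crease (-v)))
    (P.integrable_area_of_continuous (continuous_crease (-v))) v]
  congr 1
  ext z
  exact (crease_sub_crease_neg v z).symm

lemma isRationalPLConvex_crease (q : ℚ × ℚ × ℚ) :
    P.IsRationalPLConvex (crease ((q.1 : ℝ), (q.2.1 : ℝ), (q.2.2 : ℝ))) := by
  refine ⟨{q, 0}, Finset.insert_nonempty _ _, fun z _ => ?_⟩
  rw [Finset.sup'_insert (Finset.singleton_nonempty _), Finset.sup'_singleton]
  simp [crease, aff]

lemma not_isAffineOn_crease {v : ℝ × ℝ × ℝ} (hv : P.IsHonest v) : ¬ P.IsAffineOn (crease v) := by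
  rintro ⟨g, hg⟩
  obtain ⟨⟨z, hz, hz0⟩, w, hw, hw0⟩ := hv
  set s := aff v w / (aff v w - aff v z) with hs
  have hd : 0 < aff v w - aff v z := by linarith
  have hs0 : 0 ≤ s := div_nonneg hw0.le hd.le
  have ht0 : 0 < 1 - s := by
    rw [hs, sub_pos, div_lt_one hd]; linarith
  have hmem := P.convex_carrier hz hw hs0 ht0.le (by ring)
  have h1 := hg hmem
  have h2 : g (s • z + (1 - s) • w) = s * g z + (1 - s) * g w := by
    simpa using Convex.combo_affine_apply (f := g) (x := z) (y := w) (a := s) (b := 1 - s) (by ring)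
  rw [h2, ← hg hz, ← hg hw, crease, crease, crease, aff_combo v (by ring), max_eq_right hz0.le,
    max_eq_left hw0.le] at h1
  have h3 : s * aff v z + (1 - s) * aff v w = 0 := by
    rw [hs]; field_simp; ring
  rw [h3, max_self] at h1
  nlinarith [mul_pos ht0 hw0]

lemma futaki_crease_rat_pos (hP : P.IsKPolystable) {v : ℝ × ℝ × ℝ} (h1 : v.1 ∈ ratField)
    (h2 : v.2.1 ∈ ratField) (h3 : v.2.2 ∈ ratField) (hv : P.IsHonest v) :
    0 < P.futaki (crease v) := by
  obtain ⟨q1, hq1⟩ := h1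
  obtain ⟨q2, hq2⟩ := h2
  obtain ⟨q3, hq3⟩ := h3
  obtain rfl : v = ((q1 : ℝ), (q2 : ℝ), (q3 : ℝ)) := by
    ext <;> simp [← hq1, ← hq2, ← hq3]
  have hr := P.isRationalPLConvex_crease (q1, q2, q3)
  refine lt_of_le_of_ne (hP.1 _ hr) fun h0 => P.not_isAffineOn_crease hv ?_
  exact (hP.2 _ hr).1 h0.symm

lemma continuous_uncurry_crease : Continuous fun p : (ℝ × ℝ × ℝ) × (ℝ × ℝ) => crease p.1 p.2 := by
  unfold crease aff; fun_prop

lemma continuous_integral_crease :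
    Continuous fun v => ∫ z, crease v z ∂P.areaMeasure :=
  continuous_parametric_integral_of_continuous continuous_uncurry_crease P.isCompact_carrier

lemma integral_boundary_crease (v : ℝ × ℝ × ℝ) :
    ∫ z, crease v z ∂P.boundaryMeasure = ∑ k, P.edgeInt k (crease v) :=
  P.integral_boundary (P.integrable_boundary_of_continuous (continuous_crease v))

lemma continuous_integral_boundary_crease :
    Continuous fun v => ∫ z, crease v z ∂P.boundaryMeasure := by
  simp_rw [integral_boundary_crease, edgeInt]
  refine continuous_finsetSum _ fun k _ => ?_
  refine continuous_parametric_integral_of_continuous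
    (f := fun v t => crease v (P.edgeLine k t)) ?_ isCompact_Icc
  exact continuous_uncurry_crease.comp
    (continuous_fst.prodMk ((P.continuous_edgeLine k).comp continuous_snd))

lemma continuous_futaki_crease : Continuous fun v => P.futaki (crease v) := by
  unfold futaki
  exact P.continuous_integral_boundary_crease.sub (P.continuous_integral_crease.const_mul _)

lemma futaki_crease_nonneg (hP : P.IsKPolystable) (v : ℝ × ℝ × ℝ) :
    0 ≤ P.futaki (crease v) := by
  have hd : DenseRange fun q : ℚ × ℚ × ℚ => ((q.1 : ℝ), (q.2.1 : ℝ), (q.2.2 : ℝ)) :=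
    Rat.denseRange_cast.prodMap (Rat.denseRange_cast.prodMap Rat.denseRange_cast)
  refine hd.induction_on (p := fun v => 0 ≤ P.futaki (crease v)) v ?_ ?_
  · exact isClosed_le continuous_const P.continuous_futaki_crease
  · exact fun q => hP.1 _ (P.isRationalPLConvex_crease q)

/-- The Futaki invariant of a crease as a weighted boundary integral. -/
lemma futaki_crease_eq (v : ℝ × ℝ × ℝ) {p : ℝ × ℝ} (hp : aff v p = 0) :
    P.futaki (crease v) =
      ∑ k, (1 - P.avgConst / 3 * P.ldist k p) * P.edgeInt k (crease v) := by
  have h := P.three_mul_integral_crease v hp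
  rw [futaki, integral_boundary_crease]
  have : ∫ z, crease v z ∂P.areaMeasure = (∑ k, P.ldist k p * P.edgeInt k (crease v)) / 3 := by
    rw [← h]; ring
  rw [this]
  simp_rw [sub_mul, one_mul, Finset.sum_sub_distrib, mul_assoc, ← Finset.mul_sum]
  ring

lemma aff_edgeLine (v : ℝ × ℝ × ℝ) (k : Fin P.numEdges) (t : ℝ) :
    aff v (P.edgeLine k t) = aff v (P.edgeLine k 0) +
      (v.2.1 * (P.h k).1 - v.1 * (P.h k).2) * t := by
  simp only [aff, edgeLine_fst, edgeLine_snd]; ring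

lemma edgeInt_aff (k : Fin P.numEdges) (v : ℝ × ℝ × ℝ) :
    P.edgeInt k (aff v) = (P.hi k - P.lo k) *
      (aff v (P.edgeLine k (P.lo k)) + aff v (P.edgeLine k (P.hi k))) / 2 := by
  have h := P.lo_lt_hi k
  rw [edgeInt, integral_Icc_eq_integral_Ioc, ← intervalIntegral.integral_of_le h.le]
  rw [intervalIntegral.integral_congr fun t _ => P.aff_edgeLine v k t]
  rw [intervalIntegral.integral_add intervalIntegrable_const (Continuous.intervalIntegrable (by fun_prop) _ _),
    intervalIntegral.integral_const, intervalIntegral.integral_const_mul, integral_id, smul_eq_mul]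
  rw [P.aff_edgeLine v k (P.lo k), P.aff_edgeLine v k (P.hi k)]
  ring

lemma numEdges_pos : 0 < P.numEdges := by
  by_contra hcon
  have h0 : P.numEdges = 0 := by omega
  have huniv : P.carrier = univ := by
    ext z
    simp only [mem_carrier_iff, mem_univ, iff_true]
    intro k
    exact absurd k.2 (by omega)
  exact noncompact_univ (ℝ × ℝ) (huniv ▸ P.isCompact_carrier)

lemma boundary_real_univ : P.boundaryMeasure.real univ = ∑ k, (P.hi k - P.lo k) := by
  have := P.integral_boundary (f := fun _ => 1) (P.integrable_boundary_of_continuous (by fun_prop))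
  simp only [integral_const, smul_eq_mul, mul_one, measureReal_restrict_apply_univ,
    Real.volume_real_Icc] at this
  rw [this]
  exact Finset.sum_congr rfl fun k _ => max_eq_left (by linarith [P.lo_lt_hi k])

lemma avgConst_pos : 0 < P.avgConst := by
  refine div_pos ?_ P.area_pos
  rw [boundary_real_univ]
  exact Finset.sum_pos (fun k _ => by linarith [P.lo_lt_hi k]) ⟨⟨0, P.numEdges_pos⟩, Finset.mem_univ _⟩

lemma avgConst_mem (hP : P.IsKPolystable) : P.avgConst ∈ ratField := by
  let k : Fin P.numEdges := ⟨0, P.numEdges_pos⟩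
  set p := P.edgeLine k (P.lo k) with hp
  have hE := P.three_mul_integral_crease (P.ldistVec k) (p := p)
    (by rw [aff_ldistVec, hp, ldist_edgeLine_self])
  have heq : ∀ z ∈ P.carrier, crease (P.ldistVec k) z = aff (P.ldistVec k) z := fun z hz => by
    rw [crease, max_eq_left]
    rw [aff_ldistVec]; exact P.mem_carrier_iff.1 hz k
  have hedge : ∀ j, P.edgeInt j (crease (P.ldistVec k)) = P.edgeInt j (aff (P.ldistVec k)) :=
    fun j => setIntegral_congr_fun measurableSet_Icc fun t ht =>
      heq _ (P.edgeLine_mem_carrier_iff.2 ht)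
  have hmem : ∀ j, P.edgeInt j (aff (P.ldistVec k)) ∈ ratField := by
    intro j
    rw [edgeInt_aff, aff_ldistVec, aff_ldistVec]
    refine div_mem (mul_mem (sub_mem (P.hi_mem j) (P.lo_mem j)) (add_mem ?_ ?_))
      (ofNat_mem_ratField 2)
    · exact P.ldist_mem (P.edgeLine_fst_mem (P.lo_mem j)) (P.edgeLine_snd_mem (P.lo_mem j))
    · exact P.ldist_mem (P.edgeLine_fst_mem (P.hi_mem j)) (P.edgeLine_snd_mem (P.hi_mem j))
  have hf := P.futaki_aff hP (P.ldistVec k)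
  rw [futaki, P.integral_boundary (P.integrable_boundary_of_continuous (continuous_aff _))] at hf
  change (∑ j, P.edgeInt j (aff (P.ldistVec k))) - _ = 0 at hf
  have harea : ∫ z, crease (P.ldistVec k) z ∂P.areaMeasure =
      ∫ z, aff (P.ldistVec k) z ∂P.areaMeasure :=
    integral_congr_ae (P.ae_area_mem.mono fun z hz => heq z hz)
  rw [harea] at hE
  simp_rw [hedge] at hE
  have hI : ∫ z, aff (P.ldistVec k) z ∂P.areaMeasure ∈ ratField := by
    have : ∫ z, aff (P.ldistVec k) z ∂P.areaMeasure =
        (∑ j, P.ldist j p * P.edgeInt j (aff (P.ldistVec k))) / 3 := by rw [← hE]; ring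
    rw [this]
    exact div_mem (sum_mem fun j _ => mul_mem (P.ldist_mem (P.edgeLine_fst_mem (P.lo_mem k))
      (P.edgeLine_snd_mem (P.lo_mem k))) (hmem j)) (ofNat_mem_ratField 3)
  have hne : ∫ z, aff (P.ldistVec k) z ∂P.areaMeasure ≠ 0 := by
    intro h0
    have h1 : ∀ᵐ z ∂P.areaMeasure, aff (P.ldistVec k) z = 0 := by
      refine (integral_eq_zero_iff_of_nonneg_ae ?_
        (P.integrable_area_of_continuous (continuous_aff _))).1 h0
      filter_upwards [P.ae_area_mem] with z hz
      rw [aff_ldistVec]; exact P.mem_carrier_iff.1 hz k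
    refine P.area_pos.ne' ?_
    rw [Measure.real, ENNReal.toReal_eq_zero_iff]
    left
    refine measure_mono_null (t := {z | aff (P.ldistVec k) z = 0} ∪ {z | ¬ aff (P.ldistVec k) z = 0})
      (fun z _ => em _) (measure_union_null ?_ h1)
    exact Measure.absolutelyContinuous_of_le Measure.restrict_le_self
      (volume_aff_eq_zero (P.ldistVec_ne k))
  have : P.avgConst = (∑ j, P.edgeInt j (aff (P.ldistVec k))) /
      ∫ z, aff (P.ldistVec k) z ∂P.areaMeasure := by
    rw [eq_div_iff hne]; linarith
  rw [this]
  exact div_mem (sum_mem fun j _ => hmem j) hI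

end DelzantPolygon

/-! ### Rationality of double zeros -/

/-- A cubic elimination: under the stated bounds, three symmetric rational functions of `(X, Y)`
can only be rational if `X` is. The first three conditions force `X - 2` to be a root of two
rational cubics, hence of a rational quadratic `z² = s z + e`; comparing coefficients, either the
discriminant vanishes or `X Y = 3 (X + Y)`, which the bounds exclude. -/
lemma mem_ratField_of_cubics {X Y : ℝ} (hX : 0 < X) (hX3 : X < 3) (hY : 0 < Y) (hY3 : Y < 3)
    (hk : (X - 2) * (Y - 2) ∈ ratField) (h1 : X ^ 2 * (3 - Y) ∈ ratField)
    (h2 : Y ^ 2 * (3 - X) ∈ ratField) : X ∈ ratField := by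
  by_contra hirr
  have two := ofNat_mem_ratField 2
  have three := ofNat_mem_ratField 3
  have four := ofNat_mem_ratField 4
  obtain ⟨z, hz⟩ : ∃ z, z = X - 2 := ⟨_, rfl⟩
  obtain ⟨w, hw⟩ : ∃ w, w = Y - 2 := ⟨_, rfl⟩
  have hzirr : z ∉ ratField := fun h => hirr (by
    have := add_mem h two; rwa [hz, sub_add_cancel] at this)
  have hz0 : z ≠ 0 := fun h => hzirr (h ▸ zero_mem _)
  obtain ⟨k, hk'⟩ : ∃ k, k = (X - 2) * (Y - 2) := ⟨_, rfl⟩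
  obtain ⟨r₁, hr₁⟩ : ∃ r, r = X ^ 2 * (3 - Y) := ⟨_, rfl⟩
  obtain ⟨r₂, hr₂⟩ : ∃ r, r = Y ^ 2 * (3 - X) := ⟨_, rfl⟩
  rw [← hk'] at hk; rw [← hr₁] at h1; rw [← hr₂] at h2
  have hX' : X = z + 2 := by linarith
  have hY' : Y = w + 2 := by linarith
  subst hX' hY'
  have hzw : z * w = k := by rw [hk']; ring
  -- linear relations over `ℚ` between `1` and `z` are trivial
  have hlin : ∀ {α β : ℝ}, α ∈ ratField → β ∈ ratField → α + β * z = 0 → β = 0 ∧ α = 0 := by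
    intro α β hα hβ h
    have : β = 0 := by
      by_contra hβ0
      apply hzirr
      have : z = -α / β := by rw [eq_div_iff hβ0]; linarith
      rw [this]; exact div_mem (neg_mem hα) hβ
    subst this
    exact ⟨rfl, by linarith⟩
  have hk0 : k ≠ 0 := by
    intro hk0
    have hw0 : w = 0 := (mul_eq_zero.1 (hzw.trans hk0)).resolve_left hz0
    subst hw0
    apply hzirr
    have : z = 1 - r₂ / 4 := by rw [hr₂]; ring
    rw [this]; exact sub_mem (one_mem _) (div_mem h2 four)
  have hk16 : k - 16 ≠ 0 := by
    have : k < 16 := by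
      rw [← hzw]
      linarith [mul_pos (show (0 : ℝ) < 2 - z by linarith) hY,
        mul_pos hX (show (0 : ℝ) < 2 - w by linarith)]
    linarith
  have C1 : z ^ 3 + (4 - k) * z ^ 2 + (4 - 4 * k - r₁) * z - 4 * k = 0 := by
    rw [hr₁]; linear_combination (z ^ 2 + 4 * z + 4) * hzw
  have C2 : 4 * z ^ 3 + (4 * k - 4 + r₂) * z ^ 2 + (k ^ 2 - 4 * k) * z - k ^ 2 = 0 := by
    rw [hr₂, ← hzw]; ring
  have hQ : (20 - 8 * k - r₂) * z ^ 2 + (16 - 12 * k - 4 * r₁ - k ^ 2) * z + k * (k - 16) = 0 := by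
    linear_combination 4 * C1 - C2
  have m2 : 20 - 8 * k - r₂ ∈ ratField := sub_mem (sub_mem (ofNat_mem_ratField 20)
    (mul_mem (ofNat_mem_ratField 8) hk)) h2
  have m1 : 16 - 12 * k - 4 * r₁ - k ^ 2 ∈ ratField := sub_mem (sub_mem (sub_mem
    (ofNat_mem_ratField 16) (mul_mem (ofNat_mem_ratField 12) hk)) (mul_mem four h1)) (pow_mem hk 2)
  have m0 : k * (k - 16) ∈ ratField := mul_mem hk (sub_mem hk (ofNat_mem_ratField 16))
  have hN2 : 20 - 8 * k - r₂ ≠ 0 := by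
    intro h0
    rw [h0] at hQ
    exact mul_ne_zero hk0 hk16 (hlin m0 m1 (by linarith)).2
  obtain ⟨s, hs⟩ : ∃ s, s = -(16 - 12 * k - 4 * r₁ - k ^ 2) / (20 - 8 * k - r₂) := ⟨_, rfl⟩
  obtain ⟨e, he⟩ : ∃ e, e = -(k * (k - 16)) / (20 - 8 * k - r₂) := ⟨_, rfl⟩
  have hsm : s ∈ ratField := hs ▸ div_mem (neg_mem m1) m2
  have hem : e ∈ ratField := he ▸ div_mem (neg_mem m0) m2
  have he0 : e ≠ 0 := he ▸ div_ne_zero (neg_ne_zero.2 (mul_ne_zero hk0 hk16)) hN2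
  have hz2 : z ^ 2 = s * z + e := by
    have es : s * (20 - 8 * k - r₂) = -(16 - 12 * k - 4 * r₁ - k ^ 2) := by
      rw [hs, div_mul_cancel₀ _ hN2]
    have ee : e * (20 - 8 * k - r₂) = -(k * (k - 16)) := by rw [he, div_mul_cancel₀ _ hN2]
    refine mul_left_cancel₀ hN2 ?_
    linear_combination hQ - z * es - ee
  have A1 := hlin (α := s * e + (4 - k) * e - 4 * k)
    (β := s ^ 2 + e + (4 - k) * s + (4 - 4 * k - r₁))
    (sub_mem (add_mem (mul_mem hsm hem) (mul_mem (sub_mem four hk) hem)) (mul_mem four hk))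
    (add_mem (add_mem (add_mem (pow_mem hsm 2) hem) (mul_mem (sub_mem four hk) hsm))
      (sub_mem (sub_mem four (mul_mem four hk)) h1))
    (by linear_combination C1 - (z + (4 - k) + s) * hz2)
  have A2 := hlin (α := 4 * s * e + (4 * k - 4 + r₂) * e - k ^ 2)
    (β := 4 * (s ^ 2 + e) + (4 * k - 4 + r₂) * s + (k ^ 2 - 4 * k))
    (sub_mem (add_mem (mul_mem (mul_mem four hsm) hem) (mul_mem (add_mem (sub_mem (mul_mem four hk)
      four) h2) hem)) (pow_mem hk 2))
    (add_mem (add_mem (mul_mem four (add_mem (pow_mem hsm 2) hem)) (mul_mem (add_mem (sub_mem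
      (mul_mem four hk) four) h2) hsm)) (sub_mem (pow_mem hk 2) (mul_mem four hk)))
    (by linear_combination C2 - (4 * z + (4 * k - 4 + r₂) + 4 * s) * hz2)
  have E1 : e * (s + 4) = k * (4 + e) := by linear_combination A1.2
  have E2 : 4 * e ^ 2 + k ^ 2 * s + k ^ 2 * e - 4 * k * e = 0 := by
    linear_combination e * A2.1 - s * A2.2
  have E3 : (4 + e + (s + 4)) * (4 * (4 + e) - 8 * (s + 4) + (s + 4) ^ 2) = 0 := by
    have : e ^ 2 * ((4 + e + (s + 4)) * (4 * (4 + e) - 8 * (s + 4) + (s + 4) ^ 2)) = 0 := by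
      linear_combination (4 + e) ^ 2 * E2 + ((s + e) * (e * (s + 4) + k * (4 + e))
        - 4 * e * (4 + e)) * E1
    exact (mul_eq_zero.1 this).resolve_left (pow_ne_zero 2 he0)
  rcases mul_eq_zero.1 E3 with h | h
  · rcases eq_or_ne (4 + e) 0 with hE | hE
    · have hse : s = -4 := by linarith
      have hee : e = -4 := by linarith
      have : (z + 2) ^ 2 = 0 := by rw [hse, hee] at hz2; linear_combination hz2
      have := pow_eq_zero_iff (two_ne_zero) |>.1 this
      linarith
    · have hke : k = -e := by
        have : (4 + e) * (k + e) = 0 := by linear_combination -E1 + e * h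
        linarith [(mul_eq_zero.1 this).resolve_left hE]
      have hsk : s = k - 8 := by linarith
      have hzws : z + w = k - 8 := by
        have : z * (z + w - (k - 8)) = 0 := by
          rw [hsk, show e = -k by linarith] at hz2
          linear_combination hz2 + hzw
        linarith [(mul_eq_zero.1 this).resolve_left hz0]
      -- that is, `X Y = 3 (X + Y)`
      linarith [mul_pos hY (show (0 : ℝ) < 3 - (z + 2) by linarith)]
  · have : (2 * z - s) ^ 2 = 0 := by linear_combination 4 * hz2 + h
    have := pow_eq_zero_iff (two_ne_zero) |>.1 this
    apply hzirr
    rw [show z = s / 2 by linarith]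
    exact div_mem hsm two

/-- A quadratic function with a local minimum at `0`. -/
lemma quadratic_local_min {α β : ℝ} (h : ∀ᶠ t in 𝓝 (0 : ℝ), 0 ≤ α * t ^ 2 + β * t) :
    β = 0 ∧ 0 ≤ α := by
  obtain ⟨ε, hε, hball⟩ := Metric.eventually_nhds_iff.1 h
  have hb : ∀ t, |t| < ε → 0 ≤ α * t ^ 2 + β * t := fun t ht => hball (by simpa using ht)
  have hβ : β = 0 := by
    by_contra hne
    -- test with `t` of the sign opposite to `β` and small compared with `β / α`
    set s := min (ε / 2) (|β| / (2 * (|α| + 1))) with hs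
    have hs0 : 0 < s := lt_min (by linarith) (by positivity)
    have hs1 : s < ε := lt_of_le_of_lt (min_le_left _ _) (by linarith)
    have hs2 : s * (2 * (|α| + 1)) ≤ |β| := by
      rw [← le_div_iff₀ (by positivity)]; exact min_le_right _ _
    have hα := le_abs_self α
    have hpos : |α| * s < |β| := by nlinarith [abs_nonneg α, abs_pos.2 hne]
    rcases lt_or_gt_of_ne hne with hlt | hgt
    · have := hb s (by rwa [abs_of_pos hs0])
      rw [abs_of_neg hlt] at hpos
      nlinarith
    · have := hb (-s) (by rwa [abs_neg, abs_of_pos hs0])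
      rw [abs_of_pos hgt] at hpos
      nlinarith
  subst hβ
  refine ⟨rfl, ?_⟩
  have := hb (ε / 2) (by rw [abs_of_pos (by linarith)]; linarith)
  by_contra hneg
  nlinarith [mul_pos (neg_pos.2 (not_le.1 hneg)) (pow_pos hε 2)]

lemma eventually_fst_line {p : ℝ × ℝ → Prop} {x y : ℝ} (h : ∀ᶠ z in 𝓝 (x, y), p z) :
    ∀ᶠ t in 𝓝 (0 : ℝ), p (x + t, y) := by
  have hc : Continuous fun t : ℝ => (x + t, y) := by fun_prop
  exact hc.continuousAt.eventually (by simpa using h)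

lemma eventually_snd_line {p : ℝ × ℝ → Prop} {x y : ℝ} (h : ∀ᶠ z in 𝓝 (x, y), p z) :
    ∀ᶠ t in 𝓝 (0 : ℝ), p (x, y + t) := by
  have hc : Continuous fun t : ℝ => (x, y + t) := by fun_prop
  exact hc.continuousAt.eventually (by simpa using h)

/-- A zero of the local form of the Futaki invariant of a crease between two non-parallel edges, at
which it is locally minimal, has a rational coordinate. -/
lemma mem_ratField_of_local_min {a g e f U V : ℝ} (ha : 0 < a) (ham : a ∈ ratField)
    (hg : g ∈ ratField) (he : e ∈ ratField) (hf : f ∈ ratField) (hU : 0 < U) (hV : 0 < V)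
    (h0 : U * V * (U + V) - a / 3 * U ^ 2 * V ^ 2 + g * U * V + e * U + f * V = 0)
    (hmin : ∀ᶠ z : ℝ × ℝ in 𝓝 (U, V), 0 ≤ z.1 * z.2 * (z.1 + z.2) -
      a / 3 * z.1 ^ 2 * z.2 ^ 2 + g * z.1 * z.2 + e * z.1 + f * z.2) :
    U ∈ ratField ∨ V ∈ ratField := by
  have dU := quadratic_local_min (α := V - a / 3 * V ^ 2)
    (β := 2 * U * V + V ^ 2 - 2 * a / 3 * U * V ^ 2 + g * V + e)
    ((eventually_fst_line hmin).mono fun t ht => by simp only at ht; linarith)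
  have dV := quadratic_local_min (α := U - a / 3 * U ^ 2)
    (β := 2 * U * V + U ^ 2 - 2 * a / 3 * V * U ^ 2 + g * U + f)
    ((eventually_snd_line hmin).mono fun t ht => by simp only at ht; linarith)
  have three := ofNat_mem_ratField 3
  have hcrit : ∀ W : ℝ, 0 < W → 0 ≤ W - a / 3 * W ^ 2 → W ∉ ratField → a * W < 3 := by
    intro W hW hle hirr
    have h1 : a * W ≤ 3 := by
      by_contra hcon
      nlinarith [mul_pos hW (sub_pos.2 (not_le.1 hcon))]
    refine lt_of_le_of_ne h1 fun h => hirr ?_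
    rw [show W = 3 / a by rw [eq_div_iff ha.ne']; linarith]
    exact div_mem three ham
  by_cases hUr : U ∈ ratField
  · exact Or.inl hUr
  by_cases hVr : V ∈ ratField
  · exact Or.inr hVr
  left
  have hX3 := hcrit U hU dV.2 hUr
  have hY3 := hcrit V hV dU.2 hVr
  have ef : f = U ^ 2 * (1 - a * V / 3) := by
    have : V * (f - U ^ 2 * (1 - a * V / 3)) = 0 := by linear_combination h0 - U * dU.1
    linarith [(mul_eq_zero.1 this).resolve_left hV.ne']
  have ee : e = V ^ 2 * (1 - a * U / 3) := by
    have : U * (e - V ^ 2 * (1 - a * U / 3)) = 0 := by linear_combination h0 - V * dV.1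
    linarith [(mul_eq_zero.1 this).resolve_left hU.ne']
  have eg : 2 * U + 2 * V - a * U * V + g = 0 := by
    have : V * (2 * U + 2 * V - a * U * V + g) = 0 := by linear_combination dU.1 - ee
    exact (mul_eq_zero.1 this).resolve_left hV.ne'
  have hXm : a * U ∈ ratField := by
    refine mem_ratField_of_cubics (Y := a * V) (by positivity) hX3 (by positivity) hY3 ?_ ?_ ?_
    · rw [show (a * U - 2) * (a * V - 2) = a * g + 4 by linear_combination -a * eg]
      exact add_mem (mul_mem ham hg) (ofNat_mem_ratField 4)
    · rw [show (a * U) ^ 2 * (3 - a * V) = 3 * a ^ 2 * f by rw [ef]; ring]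
      exact mul_mem (mul_mem three (pow_mem ham 2)) hf
    · rw [show (a * V) ^ 2 * (3 - a * U) = 3 * a ^ 2 * e by rw [ee]; ring]
      exact mul_mem (mul_mem three (pow_mem ham 2)) he
  rw [show U = a * U / a by field_simp]
  exact div_mem hXm ham

/-- Two expressions for the Futaki invariant of the crease between two non-parallel edges, obtained
from Euler's identity at its two end points, determine its quadratic coefficients. -/
lemma matching_coefficients {a Ut Vs n1 n2 n3 n4 n6 m1 m2 m3 m4 m6 U V : ℝ}
    (h : ∀ᶠ z : ℝ × ℝ in 𝓝 (U, V),
      z.2 * (Ut - z.1) ^ 2 + (1 - a / 3 * z.1) * (z.1 * (Vs - z.2) ^ 2) +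
        (n1 * z.1 + n2 * z.2 + n3 * z.1 * z.2 + n4 * z.1 ^ 2 + n6 * z.1 ^ 2 * z.2) =
      (1 - a / 3 * z.2) * (z.2 * (Ut - z.1) ^ 2) + z.1 * (Vs - z.2) ^ 2 +
        (m1 * z.1 + m2 * z.2 + m3 * z.1 * z.2 + m4 * z.2 ^ 2 + m6 * z.1 * z.2 ^ 2)) :
    n4 = a / 3 * Vs ^ 2 ∧ n6 = -(2 * a / 3 * Vs) := by
  obtain ⟨ε, hε, hball⟩ := Metric.eventually_nhds_iff.1 h
  have key : ∀ v, |v - V| < ε → n4 - a / 3 * Vs ^ 2 + (n6 + 2 * a / 3 * Vs) * v = 0 := by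
    intro v hv
    have hb : ∀ u, |u - U| < ε → _ := fun u hu => hball (y := (u, v)) (by
      rw [Prod.dist_eq, max_lt_iff, Real.dist_eq, Real.dist_eq]; exact ⟨hu, hv⟩)
    have b0 := hb U (by simpa using hε)
    have b1 := hb (U + ε / 2) (by
      rw [add_sub_cancel_left, abs_of_pos (by linarith)]; linarith)
    have b2 := hb (U - ε / 2) (by
      rw [sub_sub_cancel_left, abs_neg, abs_of_pos (by linarith)]; linarith)
    simp only at b0 b1 b2
    have : ε ^ 2 * (n4 - a / 3 * Vs ^ 2 + (n6 + 2 * a / 3 * Vs) * v) = 0 := by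
      linear_combination 2 * b1 + 2 * b2 - 4 * b0
    exact (mul_eq_zero.1 this).resolve_left (by positivity)
  have k0 := key V (by simpa using hε)
  have k1 := key (V + ε / 2) (by
    rw [add_sub_cancel_left, abs_of_pos (by linarith)]; linarith)
  have : (n6 + 2 * a / 3 * Vs) * ε = 0 := by linear_combination 2 * k1 - 2 * k0
  have h6 := (mul_eq_zero.1 this).resolve_right hε.ne'
  rw [h6] at k0
  exact ⟨by linarith, by linarith⟩

/-- Near a local minimum with value `0`, a rational quadratic polynomial in two variables has a
zero with a rational coordinate. -/
lemma exists_rational_zero_of_local_min {α g β d e f x y : ℝ} (hα : α ∈ ratField)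
    (hg : g ∈ ratField) (hβ : β ∈ ratField) (hd : d ∈ ratField) (he : e ∈ ratField)
    (h0 : α * x ^ 2 + g * x * y + β * y ^ 2 + d * x + e * y + f = 0)
    (hmin : ∀ᶠ z : ℝ × ℝ in 𝓝 (x, y),
      0 ≤ α * z.1 ^ 2 + g * z.1 * z.2 + β * z.2 ^ 2 + d * z.1 + e * z.2 + f) :
    ∃ᶠ z : ℝ × ℝ in 𝓝 (x, y), (z.1 ∈ ratField ∨ z.2 ∈ ratField) ∧
      α * z.1 ^ 2 + g * z.1 * z.2 + β * z.2 ^ 2 + d * z.1 + e * z.2 + f = 0 := by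
  have dx := (quadratic_local_min (α := α) (β := 2 * α * x + g * y + d)
    ((eventually_fst_line hmin).mono fun t ht => by simp only at ht; linarith)).1
  have dy := (quadratic_local_min (α := β) (β := g * x + 2 * β * y + e)
    ((eventually_snd_line hmin).mono fun t ht => by simp only at ht; linarith)).1
  have two := ofNat_mem_ratField 2
  have four := ofNat_mem_ratField 4
  by_cases hdet : 4 * α * β - g ^ 2 = 0
  swap
  · have hx : x ∈ ratField := by
      have : x = (g * e - 2 * β * d) / (4 * α * β - g ^ 2) := by
        rw [eq_div_iff hdet]; linear_combination 2 * β * dx - g * dy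
      rw [this]
      exact div_mem (sub_mem (mul_mem hg he) (mul_mem (mul_mem two hβ) hd))
        (sub_mem (mul_mem (mul_mem four hα) hβ) (pow_mem hg 2))
    intro hcon
    exact hcon.self_of_nhds ⟨Or.inl hx, h0⟩
  -- the direction `(ξ, η)` spans the kernel of the Hessian
  obtain ⟨ξ, η, hne, h1, h2⟩ : ∃ ξ η : ℝ, (ξ ≠ 0 ∨ η ≠ 0) ∧ 2 * α * ξ + g * η = 0 ∧
      g * ξ + 2 * β * η = 0 := by
    by_cases hα0 : α = 0
    · have hg0 : g = 0 := by
        rw [hα0] at hdet; nlinarith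
      exact ⟨1, 0, Or.inl one_ne_zero, by rw [hα0, hg0]; ring, by rw [hg0]; ring⟩
    · exact ⟨g, -2 * α, Or.inr (by simpa using hα0), by ring, by linear_combination -hdet⟩
  have hzero : ∀ t : ℝ, α * (x + t * ξ) ^ 2 + g * (x + t * ξ) * (y + t * η) + β * (y + t * η) ^ 2 +
      d * (x + t * ξ) + e * (y + t * η) + f = 0 := fun t => by
    linear_combination h0 + t * ξ * dx + t * η * dy + t ^ 2 * (ξ * h1 + η * h2) / 2
  have hdense : Dense (ratField : Set ℝ) := Rat.denseRange_cast
  have hc : Continuous fun t : ℝ => (x + t * ξ, y + t * η) := by fun_prop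
  intro hcon
  have hev : ∀ᶠ t in 𝓝 (0 : ℝ), _ := (hc.tendsto' 0 (x, y) (by simp)).eventually hcon
  obtain ⟨ε, hε, hball⟩ := Metric.eventually_nhds_iff.1 hev
  have hfind : ∀ c b : ℝ, b ≠ 0 → ∃ t : ℝ, dist t 0 < ε ∧ c + t * b ∈ ratField := by
    intro c b hb
    have hcb : Continuous fun s : ℝ => (s - c) / b := by fun_prop
    have hopen : IsOpen {s : ℝ | dist ((s - c) / b) 0 < ε} :=
      isOpen_lt (hcb.dist continuous_const) continuous_const
    obtain ⟨s, hs, hsr⟩ := hdense.exists_mem_open hopen ⟨c, by simpa using hε⟩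
    exact ⟨(s - c) / b, hsr, by rw [div_mul_cancel₀ _ hb, add_sub_cancel]; exact hs⟩
  rcases hne with hξ | hη
  · obtain ⟨t, ht, htr⟩ := hfind x ξ hξ
    exact hball ht ⟨Or.inl htr, hzero t⟩
  · obtain ⟨t, ht, htr⟩ := hfind y η hη
    exact hball ht ⟨Or.inr htr, hzero t⟩

/-! ### Creases through two boundary points -/

/-- The coefficients of the affine function `z ↦ det (q - p, z - p)`, which vanishes on the line
through `p` and `q`. -/
def lineVec (p q : ℝ × ℝ) : ℝ × ℝ × ℝ :=
  (-(q.2 - p.2), q.1 - p.1, q.2 * p.1 - q.1 * p.2)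

lemma aff_lineVec (p q z : ℝ × ℝ) : aff (lineVec p q) z =
    (q.1 - p.1) * (z.2 - p.2) - (q.2 - p.2) * (z.1 - p.1) := by
  simp only [aff, lineVec]; ring

@[simp] lemma aff_lineVec_left (p q : ℝ × ℝ) : aff (lineVec p q) p = 0 := by
  rw [aff_lineVec]; ring

@[simp] lemma aff_lineVec_right (p q : ℝ × ℝ) : aff (lineVec p q) q = 0 := by
  rw [aff_lineVec]; ring

lemma lineVec_swap (p q : ℝ × ℝ) : lineVec q p = -lineVec p q := by
  simp only [lineVec, Prod.neg_mk, Prod.mk.injEq]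
  exact ⟨by ring, by ring, by ring⟩

lemma exists_eq_smul_lineVec {v : ℝ × ℝ × ℝ} {p q : ℝ × ℝ} (hpq : p ≠ q) (hp : aff v p = 0)
    (hq : aff v q = 0) : ∃ c : ℝ, v = c • lineVec p q := by
  have hn : (q.1 - p.1) ^ 2 + (q.2 - p.2) ^ 2 ≠ 0 := by
    intro h
    apply hpq
    have h1 : q.1 - p.1 = 0 := by nlinarith [sq_nonneg (q.1 - p.1), sq_nonneg (q.2 - p.2)]
    have h2 : q.2 - p.2 = 0 := by nlinarith [sq_nonneg (q.1 - p.1), sq_nonneg (q.2 - p.2)]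
    exact Prod.ext (by linarith) (by linarith)
  refine ⟨(v.2.1 * (q.1 - p.1) - v.1 * (q.2 - p.2)) / ((q.1 - p.1) ^ 2 + (q.2 - p.2) ^ 2), ?_⟩
  simp only [aff] at hp hq
  have e1 : v.1 = (v.2.1 * (q.1 - p.1) - v.1 * (q.2 - p.2)) /
      ((q.1 - p.1) ^ 2 + (q.2 - p.2) ^ 2) * -(q.2 - p.2) := by
    field_simp
    linear_combination (q.1 - p.1) * (hq - hp)
  have e2 : v.2.1 = (v.2.1 * (q.1 - p.1) - v.1 * (q.2 - p.2)) /
      ((q.1 - p.1) ^ 2 + (q.2 - p.2) ^ 2) * (q.1 - p.1) := by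
    field_simp
    linear_combination (q.2 - p.2) * (hq - hp)
  refine Prod.ext e1 (Prod.ext e2 ?_)
  simp only [lineVec, Prod.smul_snd, smul_eq_mul]
  linear_combination hp - p.1 * e1 - p.2 * e2

namespace DelzantPolygon

variable (P : DelzantPolygon)

lemma not_isHonest_of_ldist {v : ℝ × ℝ × ℝ} {p q : ℝ × ℝ} (hv : P.IsHonest v) (hpq : p ≠ q)
    (hp : aff v p = 0) (hq : aff v q = 0) {k : Fin P.numEdges} (hkp : P.ldist k p = 0)
    (hkq : P.ldist k q = 0) : False := by
  obtain ⟨c, hc⟩ := exists_eq_smul_lineVec hpq hp hq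
  obtain ⟨d, hd⟩ := exists_eq_smul_lineVec (v := P.ldistVec k) hpq (by rw [aff_ldistVec, hkp])
    (by rw [aff_ldistVec, hkq])
  have hd0 : d ≠ 0 := by
    rintro rfl
    rw [zero_smul] at hd
    rcases P.ldistVec_ne k with h | h <;> exact h (by rw [hd]; rfl)
  have hval : ∀ z, aff v z = c / d * P.ldist k z := fun z => by
    rw [hc, ← aff_ldistVec, hd, aff_smul, aff_smul]; field_simp
  obtain ⟨⟨z, hz, hz0⟩, w, hw, hw0⟩ := hv
  rw [hval] at hz0 hw0
  have h1 := P.mem_carrier_iff.1 hz k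
  have h2 := P.mem_carrier_iff.1 hw k
  rcases le_total 0 (c / d) with h | h
  · nlinarith [mul_nonneg h h1]
  · nlinarith [mul_nonneg (neg_nonneg.2 h) h2]

lemma ldist_eq_zero_of_between {k : Fin P.numEdges} {p q : ℝ × ℝ} (hp : p ∈ P.carrier)
    (hq : q ∈ P.carrier) {s : ℝ} (h0 : 0 < s) (h1 : s < 1)
    (h : P.ldist k (s • p + (1 - s) • q) = 0) : P.ldist k p = 0 ∧ P.ldist k q = 0 := by
  rw [P.ldist_combo k (by ring)] at h
  have hp' := P.mem_carrier_iff.1 hp k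
  have hq' := P.mem_carrier_iff.1 hq k
  constructor
  · nlinarith [mul_nonneg (sub_pos.2 h1).le hq', mul_nonneg h0.le hp']
  · nlinarith [mul_nonneg (sub_pos.2 h1).le hq', mul_nonneg h0.le hp']

/-- A line cutting the polygon meets the boundary in two points only. -/
lemma eq_or_eq_of_boundary_zero {v : ℝ × ℝ × ℝ} (hv : P.IsHonest v) {p q r : ℝ × ℝ}
    {i j k : Fin P.numEdges} (hpq : p ≠ q) (hp : p ∈ P.carrier) (hq : q ∈ P.carrier)
    (hr : r ∈ P.carrier) (hip : P.ldist i p = 0) (hjq : P.ldist j q = 0) (hkr : P.ldist k r = 0)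
    (hp0 : aff v p = 0) (hq0 : aff v q = 0) (hr0 : aff v r = 0) : r = p ∨ r = q := by
  by_contra! hne
  -- write `r = p + s (q - p)`
  obtain ⟨s, hs⟩ : ∃ s : ℝ, r = (1 - s) • p + s • q := by
    obtain ⟨c, hc⟩ := exists_eq_smul_lineVec hpq hp0 hq0
    have hc0 : c ≠ 0 := by
      rintro rfl
      obtain ⟨⟨z, -, hz⟩, -⟩ := hv
      rw [hc, zero_smul] at hz
      simp [aff] at hz
    rw [hc, aff_smul, aff_lineVec] at hr0
    have hdet := (mul_eq_zero.1 hr0).resolve_left hc0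
    by_cases h1 : q.1 - p.1 = 0
    · have h2 : q.2 - p.2 ≠ 0 := fun h2 => hpq (Prod.ext (by linarith) (by linarith))
      rw [h1] at hdet
      have h3 : r.1 - p.1 = 0 := (mul_eq_zero.1 (by linarith : (q.2 - p.2) * (r.1 - p.1) = 0)).resolve_left h2
      refine ⟨(r.2 - p.2) / (q.2 - p.2), Prod.ext ?_ ?_⟩
      · simp only [Prod.fst_add, Prod.smul_fst, smul_eq_mul]
        linear_combination h3 - (r.2 - p.2) / (q.2 - p.2) * h1
      · simp only [Prod.snd_add, Prod.smul_snd, smul_eq_mul]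
        field_simp; ring
    · refine ⟨(r.1 - p.1) / (q.1 - p.1), Prod.ext ?_ ?_⟩
      · simp only [Prod.fst_add, Prod.smul_fst, smul_eq_mul]
        field_simp; ring
      · simp only [Prod.snd_add, Prod.smul_snd, smul_eq_mul]
        field_simp
        linear_combination hdet
  have hs0 : s ≠ 0 := by rintro rfl; exact hne.1 (by rw [hs]; simp)
  have hs1 : s ≠ 1 := by rintro rfl; exact hne.2 (by rw [hs]; simp)
  rcases lt_or_gt_of_ne hs0 with h | h
  · -- `p` lies between `r` and `q`
    have e : p = (1 / (1 - s)) • r + (1 - 1 / (1 - s)) • q := by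
      have : (1 - s) ≠ 0 := by linarith
      rw [hs]
      ext <;> simp only [Prod.fst_add, Prod.smul_fst, Prod.snd_add, Prod.smul_snd, smul_eq_mul] <;>
        field_simp <;> ring
    have hb := P.ldist_eq_zero_of_between (k := i) hr hq (s := 1 / (1 - s)) (by
      apply one_div_pos.2; linarith) (by rw [div_lt_one] <;> linarith) (by rw [← e]; exact hip)
    exact P.not_isHonest_of_ldist hv hne.2 hr0 hq0 hb.1 hb.2
  rcases lt_or_gt_of_ne hs1 with h' | h'
  · have hb := P.ldist_eq_zero_of_between (k := k) hp hq (s := 1 - s) (by linarith) (by linarith)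
      (by rw [sub_sub_cancel, ← hs]; exact hkr)
    exact P.not_isHonest_of_ldist hv hpq hp0 hq0 hb.1 hb.2
  · -- `q` lies between `r` and `p`
    have e : q = (1 / s) • r + (1 - 1 / s) • p := by
      rw [hs]
      ext <;> simp only [Prod.fst_add, Prod.smul_fst, Prod.snd_add, Prod.smul_snd, smul_eq_mul] <;>
        field_simp <;> ring
    have hb := P.ldist_eq_zero_of_between (k := j) hr hp (s := 1 / s) (by positivity)
      (by rw [div_lt_one] <;> linarith) (by rw [← e]; exact hjq)
    exact P.not_isHonest_of_ldist hv hne.1 hr0 hp0 hb.1 hb.2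

/-- A ray from an interior point leaves the polygon through a boundary point. -/
lemma exists_exit {o d : ℝ × ℝ} (ho : o ∈ interior P.carrier) (hd : d ≠ 0) :
    ∃ t : ℝ, 0 < t ∧ o + t • d ∈ P.carrier ∧ ∃ k, P.ldist k (o + t • d) = 0 := by
  have hemb : IsClosedEmbedding fun t : ℝ => o + t • d :=
    (Homeomorph.addLeft o).isClosedEmbedding.comp (isClosedEmbedding_smul_left hd)
  set S : Set ℝ := (fun t : ℝ => o + t • d) ⁻¹' P.carrier with hS
  have hSc : IsCompact S := hemb.isCompact_preimage P.isCompact_carrier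
  have h0 : ∀ᶠ t in 𝓝 (0 : ℝ), t ∈ S := by
    exact hemb.continuous.tendsto' 0 o (by simp) (mem_interior_iff_mem_nhds.1 ho)
  have hmem := hSc.sSup_mem ⟨0, h0.self_of_nhds⟩
  obtain ⟨t, ht, ht0⟩ := ((h0.filter_mono nhdsWithin_le_nhds).and
    (eventually_mem_nhdsWithin (a := (0 : ℝ)) (s := Ioi 0))).exists
  refine ⟨sSup S, lt_of_lt_of_le ht0 (le_csSup hSc.bddAbove ht), hmem, ?_⟩
  by_contra! hcon
  have hev : ∀ᶠ s in 𝓝 (sSup S), s ∈ S := by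
    have : ∀ k, ∀ᶠ s in 𝓝 (sSup S), 0 ≤ P.ldist k (o + s • d) := by
      intro k
      have hpos := lt_of_le_of_ne (P.mem_carrier_iff.1 hmem k) (hcon k).symm
      have hc : Continuous fun s : ℝ => P.ldist k (o + s • d) :=
        (P.continuous_ldist k).comp hemb.continuous
      exact (hc.continuousAt.eventually (lt_mem_nhds hpos)).mono fun s hs => hs.le
    filter_upwards [eventually_all.2 this] with s hs
    exact P.mem_carrier_iff.2 hs
  obtain ⟨s, hs, hs0⟩ := ((hev.filter_mono nhdsWithin_le_nhds).and
    (eventually_mem_nhdsWithin (a := sSup S) (s := Ioi (sSup S)))).exists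
  exact not_lt.2 (le_csSup hSc.bddAbove hs) hs0

/-- A line cutting the polygon meets the interior. -/
lemma IsHonest.exists_interior_zero {P : DelzantPolygon} {v : ℝ × ℝ × ℝ} (hv : P.IsHonest v) :
    ∃ o ∈ interior P.carrier, aff v o = 0 := by
  obtain ⟨o, ho⟩ := P.interior_carrier_nonempty
  have main : ∀ w ∈ P.carrier, aff v o * aff v w < 0 → ∃ o ∈ interior P.carrier, aff v o = 0 := by
    intro w hw hneg
    have hd : aff v w - aff v o ≠ 0 := by
      intro h; rw [sub_eq_zero.1 h] at hneg; nlinarith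
    refine ⟨(aff v w / (aff v w - aff v o)) • o + (1 - aff v w / (aff v w - aff v o)) • w,
      P.convex_carrier.combo_interior_self_mem_interior ho hw ?_ ?_ (by ring), ?_⟩
    · rcases lt_or_gt_of_ne hd with h | h
      · exact div_pos_of_neg_of_neg (by nlinarith) h
      · exact div_pos (by nlinarith) h
    · rw [sub_nonneg]
      rcases lt_or_gt_of_ne hd with h | h
      · rw [div_le_one_of_neg h]; nlinarith
      · rw [div_le_one h]; nlinarith
    · rw [aff_combo v (by ring)]; field_simp; ring
  obtain ⟨⟨z, hz, hz0⟩, w, hw, hw0⟩ := hv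
  rcases lt_trichotomy (aff v o) 0 with h | h | h
  · exact main w hw (mul_neg_of_neg_of_pos h hw0)
  · exact ⟨o, ho, h⟩
  · exact main z hz (mul_neg_of_pos_of_neg h hz0)

lemma IsHonest.exists_chord {P : DelzantPolygon} {v : ℝ × ℝ × ℝ} (hv : P.IsHonest v) :
    ∃ i j x y, P.edgeLine i x ∈ P.carrier ∧ P.edgeLine j y ∈ P.carrier ∧
      P.edgeLine i x ≠ P.edgeLine j y ∧ aff v (P.edgeLine i x) = 0 ∧
      aff v (P.edgeLine j y) = 0 := by
  obtain ⟨o, ho, ho0⟩ := hv.exists_interior_zero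
  have hd : ((-v.2.1, v.1) : ℝ × ℝ) ≠ 0 := by
    intro h
    rw [Prod.mk_eq_zero, neg_eq_zero] at h
    obtain ⟨⟨z, -, hz⟩, w, -, hw⟩ := hv
    simp only [aff, h.1, h.2] at hz hw
    linarith
  obtain ⟨s, hs, hsm, i, hi⟩ := P.exists_exit ho hd
  obtain ⟨t, ht, htm, j, hj⟩ := P.exists_exit ho (neg_ne_zero.2 hd)
  obtain ⟨x, hx⟩ := P.exists_edgeLine_eq hi
  obtain ⟨y, hy⟩ := P.exists_edgeLine_eq hj
  have hz : ∀ r : ℝ, aff v (o + r • (-v.2.1, v.1)) = 0 := fun r => by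
    simp only [aff, Prod.fst_add, Prod.snd_add, Prod.smul_fst, Prod.smul_snd, smul_eq_mul] at ho0 ⊢
    linear_combination ho0
  refine ⟨i, j, x, y, hx ▸ hsm, hy ▸ htm, ?_, hx ▸ hz s, ?_⟩
  · rw [hx, hy]
    intro h
    have h1 := add_left_cancel h
    rw [smul_neg, ← neg_smul] at h1
    have := smul_left_injective ℝ hd h1
    linarith
  · rw [hy, smul_neg, ← neg_smul]; exact hz _

lemma aff_lineVec_edgeLine_left (i : Fin P.numEdges) (x t : ℝ) (q : ℝ × ℝ) :
    aff (lineVec (P.edgeLine i x) q) (P.edgeLine i t) = (t - x) * P.ldist i q := by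
  have h := P.ldist_edgeLine_self i x
  rw [aff_lineVec, ← sub_zero (P.ldist i q), ← h]
  simp only [ldist, edgeLine_fst, edgeLine_snd]
  ring

lemma aff_lineVec_edgeLine_right (j : Fin P.numEdges) (y t : ℝ) (p : ℝ × ℝ) :
    aff (lineVec p (P.edgeLine j y)) (P.edgeLine j t) = (y - t) * P.ldist j p := by
  have h := P.aff_lineVec_edgeLine_left j y t p
  rw [lineVec_swap, aff_neg] at h
  linarith

lemma integral_max_mul_right {x b c U : ℝ} (hx : x ∈ Icc b c) (hU : 0 ≤ U) :
    ∫ t in Icc b c, max ((t - x) * U) 0 = U * (c - x) ^ 2 / 2 := by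
  rw [integral_Icc_eq_integral_Ioc, ← intervalIntegral.integral_of_le (hx.1.trans hx.2),
    ← intervalIntegral.integral_add_adjacent_intervals (b := x)
      (Continuous.intervalIntegrable (by fun_prop) _ _)
      (Continuous.intervalIntegrable (by fun_prop) _ _)]
  have e1 : ∫ t in b..x, max ((t - x) * U) 0 = ∫ t in b..x, (0 : ℝ) := by
    refine intervalIntegral.integral_congr fun t ht => ?_
    rw [uIcc_of_le hx.1] at ht
    exact max_eq_right (mul_nonpos_of_nonpos_of_nonneg (by linarith [ht.2]) hU)
  have e2 : ∫ t in x..c, max ((t - x) * U) 0 = ∫ t in x..c, (t - x) * U := by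
    refine intervalIntegral.integral_congr fun t ht => ?_
    rw [uIcc_of_le hx.2] at ht
    exact max_eq_left (mul_nonneg (by linarith [ht.1]) hU)
  rw [e1, e2, intervalIntegral.integral_zero, intervalIntegral.integral_mul_const,
    intervalIntegral.integral_comp_sub_right (fun t => t), integral_id]
  ring

lemma integral_max_mul_left {y b c V : ℝ} (hy : y ∈ Icc b c) (hV : 0 ≤ V) :
    ∫ t in Icc b c, max ((y - t) * V) 0 = V * (y - b) ^ 2 / 2 := by
  have h := integral_max_mul_right (x := -y) (b := -c) (c := -b)
    ⟨neg_le_neg hy.2, neg_le_neg hy.1⟩ hV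
  rw [integral_Icc_eq_integral_Ioc,
    ← intervalIntegral.integral_of_le (neg_le_neg (hy.1.trans hy.2))] at h
  have := intervalIntegral.integral_comp_neg (a := b) (b := c) fun t => max ((t - -y) * V) 0
  rw [integral_Icc_eq_integral_Ioc, ← intervalIntegral.integral_of_le (hy.1.trans hy.2)]
  have e : (fun t => max ((y - t) * V) 0) = fun t => max ((-t - -y) * V) 0 := by
    ext t; ring_nf
  rw [e, this, h]; ring

lemma edgeInt_crease_left {i : Fin P.numEdges} {x : ℝ} {q : ℝ × ℝ}
    (hx : P.edgeLine i x ∈ P.carrier) (hq : q ∈ P.carrier) :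
    P.edgeInt i (crease (lineVec (P.edgeLine i x) q)) = P.ldist i q * (P.hi i - x) ^ 2 / 2 := by
  simp only [edgeInt, crease, aff_lineVec_edgeLine_left]
  exact integral_max_mul_right (P.edgeLine_mem_carrier_iff.1 hx) (P.mem_carrier_iff.1 hq i)

lemma edgeInt_crease_right {j : Fin P.numEdges} {y : ℝ} {p : ℝ × ℝ}
    (hy : P.edgeLine j y ∈ P.carrier) (hp : p ∈ P.carrier) :
    P.edgeInt j (crease (lineVec p (P.edgeLine j y))) = P.ldist j p * (y - P.lo j) ^ 2 / 2 := by
  simp only [edgeInt, crease, aff_lineVec_edgeLine_right]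
  exact integral_max_mul_left (P.edgeLine_mem_carrier_iff.1 hy) (P.mem_carrier_iff.1 hp j)

lemma aff_edgeLine_combo (v : ℝ × ℝ × ℝ) (k : Fin P.numEdges) {t : ℝ}
    (ht : t ∈ Icc (P.lo k) (P.hi k)) : ∃ s ∈ Icc (0 : ℝ) 1,
      aff v (P.edgeLine k t) = (1 - s) * aff v (P.edgeLine k (P.lo k)) +
        s * aff v (P.edgeLine k (P.hi k)) := by
  have hd : 0 < P.hi k - P.lo k := by linarith [P.lo_lt_hi k]
  refine ⟨(t - P.lo k) / (P.hi k - P.lo k), ⟨div_nonneg (by linarith [ht.1]) hd.le,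
    (div_le_one hd).2 (by linarith [ht.2])⟩, ?_⟩
  rw [← aff_combo v (by ring), ← P.edgeLine_combo k (by ring)]
  congr 2
  field_simp
  ring

lemma edgeInt_crease_of_nonneg {v : ℝ × ℝ × ℝ} {k : Fin P.numEdges}
    (h1 : 0 ≤ aff v (P.edgeLine k (P.lo k))) (h2 : 0 ≤ aff v (P.edgeLine k (P.hi k))) :
    P.edgeInt k (crease v) = P.edgeInt k (aff v) := by
  refine setIntegral_congr_fun measurableSet_Icc fun t ht => max_eq_left ?_
  obtain ⟨s, hs, he⟩ := P.aff_edgeLine_combo v k ht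
  rw [he]
  exact add_nonneg (mul_nonneg (by linarith [hs.2]) h1) (mul_nonneg hs.1 h2)

lemma edgeInt_crease_of_nonpos {v : ℝ × ℝ × ℝ} {k : Fin P.numEdges}
    (h1 : aff v (P.edgeLine k (P.lo k)) ≤ 0) (h2 : aff v (P.edgeLine k (P.hi k)) ≤ 0) :
    P.edgeInt k (crease v) = 0 := by
  refine setIntegral_eq_zero_of_forall_eq_zero fun t ht => max_eq_right ?_
  obtain ⟨s, hs, he⟩ := P.aff_edgeLine_combo v k ht
  rw [he]
  nlinarith [mul_nonneg (sub_nonneg.2 hs.2) (neg_nonneg.2 h1), mul_nonneg hs.1 (neg_nonneg.2 h2)]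

/-- The coefficients of the affine function vanishing on the line through the points with parameters
`z.1` and `z.2` on the edges `i` and `j`. -/
noncomputable def chordVec (i j : Fin P.numEdges) (z : ℝ × ℝ) : ℝ × ℝ × ℝ :=
  lineVec (P.edgeLine i z.1) (P.edgeLine j z.2)

end DelzantPolygon

/-! ### Strict positivity of the Futaki invariant on creases -/

lemma aff_mem_ratField {p q e : ℝ × ℝ} (hp : p.1 ∈ ratField ∧ p.2 ∈ ratField)
    (hq : q.1 ∈ ratField ∧ q.2 ∈ ratField) (he : e.1 ∈ ratField ∧ e.2 ∈ ratField) :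
    aff (lineVec p q) e ∈ ratField := by
  rw [aff_lineVec]
  exact sub_mem (mul_mem (sub_mem hq.1 hp.1) (sub_mem he.2 hp.2))
    (mul_mem (sub_mem hq.2 hp.2) (sub_mem he.1 hp.1))

namespace DelzantPolygon

variable (P : DelzantPolygon)

lemma edgeLine_mem {k : Fin P.numEdges} {t : ℝ} (ht : t ∈ ratField) :
    (P.edgeLine k t).1 ∈ ratField ∧ (P.edgeLine k t).2 ∈ ratField :=
  ⟨P.edgeLine_fst_mem ht, P.edgeLine_snd_mem ht⟩

lemma param_mem {k : Fin P.numEdges} {t : ℝ}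
    (h : (P.edgeLine k t).1 ∈ ratField ∧ (P.edgeLine k t).2 ∈ ratField) : t ∈ ratField := by
  rw [← P.edgeLine_leftInverse k t]
  have h1 := intCast_mem_ratField (P.h k).1
  have h2 := intCast_mem_ratField (P.h k).2
  exact div_mem (add_mem (mul_mem (neg_mem h2) h.1) (mul_mem h1 h.2))
    (add_mem (pow_mem h1 2) (pow_mem h2 2))

lemma edgeInt_chordVec_mem (i j k : Fin P.numEdges) {z : ℝ × ℝ} (h1 : z.1 ∈ ratField)
    (h2 : z.2 ∈ ratField) : P.edgeInt k (aff (P.chordVec i j z)) ∈ ratField := by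
  rw [edgeInt_aff]
  exact div_mem (mul_mem (sub_mem (P.hi_mem k) (P.lo_mem k)) (add_mem
    (aff_mem_ratField (P.edgeLine_mem h1) (P.edgeLine_mem h2) (P.edgeLine_mem (P.lo_mem k)))
    (aff_mem_ratField (P.edgeLine_mem h1) (P.edgeLine_mem h2) (P.edgeLine_mem (P.hi_mem k)))))
    (ofNat_mem_ratField 2)

lemma aff_chordVec (i j : Fin P.numEdges) (z e : ℝ × ℝ) : aff (P.chordVec i j z) e =
    aff (P.chordVec i j (0, 0)) e +
      (aff (P.chordVec i j (1, 0)) e - aff (P.chordVec i j (0, 0)) e) * z.1 +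
      (aff (P.chordVec i j (0, 1)) e - aff (P.chordVec i j (0, 0)) e) * z.2 +
      P.cross i j * z.1 * z.2 := by
  simp only [chordVec, aff_lineVec, edgeLine_fst, edgeLine_snd, cross]
  ring

lemma edgeInt_chordVec (i j k : Fin P.numEdges) (z : ℝ × ℝ) :
    P.edgeInt k (aff (P.chordVec i j z)) = P.edgeInt k (aff (P.chordVec i j (0, 0))) +
      (P.edgeInt k (aff (P.chordVec i j (1, 0))) - P.edgeInt k (aff (P.chordVec i j (0, 0)))) * z.1 +
      (P.edgeInt k (aff (P.chordVec i j (0, 1))) - P.edgeInt k (aff (P.chordVec i j (0, 0)))) * z.2 +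
      (P.hi k - P.lo k) * P.cross i j * z.1 * z.2 := by
  simp only [edgeInt_aff]
  rw [P.aff_chordVec i j z, P.aff_chordVec i j z (P.edgeLine k (P.hi k))]
  ring

/-- The chord crease in the affine coordinates `ldist i`, `ldist j`. -/
lemma cross_mul_aff_chordVec (i j : Fin P.numEdges) (z e : ℝ × ℝ) :
    P.cross i j * aff (P.chordVec i j z) e =
      P.ldist i (P.edgeLine j z.2) * P.ldist j e + P.ldist j (P.edgeLine i z.1) * P.ldist i e -
        P.ldist j (P.edgeLine i z.1) * P.ldist i (P.edgeLine j z.2) := by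
  have h1 := P.ldist_edgeLine_self i z.1
  have h2 := P.ldist_edgeLine_self j z.2
  rw [chordVec, aff_lineVec]
  generalize P.edgeLine i z.1 = p at *
  generalize P.edgeLine j z.2 = q at *
  simp only [ldist, cross] at *
  linear_combination -(((P.h j).1 : ℝ) * e.1 + (P.h j).2 * e.2 - P.c j) * h1 -
    (((P.h i).1 : ℝ) * (e.1 - p.1) + (P.h i).2 * (e.2 - p.2)) * h2

lemma cross_mul_edgeInt_chordVec (i j k : Fin P.numEdges) (z : ℝ × ℝ) :
    P.cross i j * P.edgeInt k (aff (P.chordVec i j z)) =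
      P.ldist i (P.edgeLine j z.2) * P.edgeInt k (aff (P.ldistVec j)) +
        P.ldist j (P.edgeLine i z.1) * P.edgeInt k (aff (P.ldistVec i)) -
        P.ldist j (P.edgeLine i z.1) * P.ldist i (P.edgeLine j z.2) * (P.hi k - P.lo k) := by
  simp only [edgeInt_aff, aff_ldistVec]
  linear_combination (P.hi k - P.lo k) / 2 *
    (P.cross_mul_aff_chordVec i j z (P.edgeLine k (P.lo k)) +
      P.cross_mul_aff_chordVec i j z (P.edgeLine k (P.hi k)))

lemma edgeInt_ldistVec_mem (j k : Fin P.numEdges) :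
    P.edgeInt k (aff (P.ldistVec j)) ∈ ratField := by
  rw [edgeInt_aff, aff_ldistVec, aff_ldistVec]
  have h1 := P.edgeLine_mem (k := k) (P.lo_mem k)
  have h2 := P.edgeLine_mem (k := k) (P.hi_mem k)
  exact div_mem (mul_mem (sub_mem (P.hi_mem k) (P.lo_mem k))
    (add_mem (P.ldist_mem h1.1 h1.2) (P.ldist_mem h2.1 h2.2))) (ofNat_mem_ratField 2)

lemma continuous_aff_chordVec (i j : Fin P.numEdges) (e : ℝ × ℝ) :
    Continuous fun z => aff (P.chordVec i j z) e := by
  have := fun z => P.aff_chordVec i j z e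
  rw [funext this]
  fun_prop

lemma eventually_isHonest {i j : Fin P.numEdges} {z₀ : ℝ × ℝ}
    (hv : P.IsHonest (P.chordVec i j z₀)) : ∀ᶠ z in 𝓝 z₀, P.IsHonest (P.chordVec i j z) := by
  obtain ⟨⟨a, ha, ha0⟩, b, hb, hb0⟩ := hv
  filter_upwards [(P.continuous_aff_chordVec i j a).continuousAt.eventually (gt_mem_nhds ha0),
    (P.continuous_aff_chordVec i j b).continuousAt.eventually (lt_mem_nhds hb0)] with z h1 h2
  exact ⟨⟨a, ha, h1⟩, b, hb, h2⟩

variable {P}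

lemma IsHonest.chord_ne {i j : Fin P.numEdges} {z : ℝ × ℝ} (hv : P.IsHonest (P.chordVec i j z)) :
    P.edgeLine i z.1 ≠ P.edgeLine j z.2 := by
  intro h
  obtain ⟨⟨a, -, ha⟩, -⟩ := hv
  rw [chordVec, h, aff_lineVec] at ha
  linarith

lemma IsHonest.ne {i j : Fin P.numEdges} {z : ℝ × ℝ} (hv : P.IsHonest (P.chordVec i j z)) :
    i ≠ j := by
  rintro rfl
  exact P.not_isHonest_of_ldist hv hv.chord_ne (aff_lineVec_left _ _) (aff_lineVec_right _ _)
    (P.ldist_edgeLine_self i _) (P.ldist_edgeLine_self i _)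

lemma IsHonest.ldist_pos_left {i j : Fin P.numEdges} {z : ℝ × ℝ}
    (hv : P.IsHonest (P.chordVec i j z)) (hp : P.edgeLine i z.1 ∈ P.carrier) :
    0 < P.ldist j (P.edgeLine i z.1) := by
  refine lt_of_le_of_ne (P.mem_carrier_iff.1 hp j) fun h => ?_
  exact P.not_isHonest_of_ldist hv hv.chord_ne (aff_lineVec_left _ _) (aff_lineVec_right _ _)
    h.symm (P.ldist_edgeLine_self j _)

lemma IsHonest.ldist_pos_right {i j : Fin P.numEdges} {z : ℝ × ℝ}
    (hv : P.IsHonest (P.chordVec i j z)) (hq : P.edgeLine j z.2 ∈ P.carrier) :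
    0 < P.ldist i (P.edgeLine j z.2) := by
  refine lt_of_le_of_ne (P.mem_carrier_iff.1 hq i) fun h => ?_
  exact P.not_isHonest_of_ldist hv hv.chord_ne (aff_lineVec_left _ _) (aff_lineVec_right _ _)
    (P.ldist_edgeLine_self i _) h.symm

/-- The chords near a given chord, where an end point `p` with rational parameter is kept fixed;
this matters if `p` is a vertex. -/
def chordFilter (z₀ : ℝ × ℝ) : Filter (ℝ × ℝ) :=
  𝓝 z₀ ⊓ 𝓟 {z | z₀.1 ∈ ratField → z.1 = z₀.1}

/-- Moving the chord does not change the sign of the crease function at the vertices. -/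
lemma eventually_sign {i j : Fin P.numEdges} {z₀ : ℝ × ℝ} (hv : P.IsHonest (P.chordVec i j z₀))
    (hp : P.edgeLine i z₀.1 ∈ P.carrier) (hq : P.edgeLine j z₀.2 ∈ P.carrier)
    (hy : z₀.2 ∉ ratField) {k : Fin P.numEdges} {t : ℝ} (ht : t ∈ ratField)
    (htm : P.edgeLine k t ∈ P.carrier) :
    ∀ᶠ z in chordFilter z₀,
      (0 ≤ aff (P.chordVec i j z₀) (P.edgeLine k t) →
        0 ≤ aff (P.chordVec i j z) (P.edgeLine k t)) ∧
      (aff (P.chordVec i j z₀) (P.edgeLine k t) ≤ 0 →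
        aff (P.chordVec i j z) (P.edgeLine k t) ≤ 0) := by
  have hc := (P.continuous_aff_chordVec i j (P.edgeLine k t)).continuousAt (x := z₀)
  rcases lt_trichotomy (aff (P.chordVec i j z₀) (P.edgeLine k t)) 0 with h | h | h
  · filter_upwards [(hc.eventually (gt_mem_nhds h)).filter_mono inf_le_left] with z hz
    exact ⟨fun h' => absurd h' (not_le.2 h), fun _ => le_of_lt hz⟩
  · rcases P.eq_or_eq_of_boundary_zero hv hv.chord_ne hp hq htm (P.ldist_edgeLine_self i _)
      (P.ldist_edgeLine_self j _) (P.ldist_edgeLine_self k _) (aff_lineVec_left _ _)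
      (aff_lineVec_right _ _) h with he | he
    · have hx : z₀.1 ∈ ratField := P.param_mem (he ▸ P.edgeLine_mem ht)
      have : ∀ᶠ z in chordFilter z₀, z.1 = z₀.1 := by
        filter_upwards [mem_inf_of_right (mem_principal_self _)] with z hz using hz hx
      filter_upwards [this] with z hz
      have : aff (P.chordVec i j z) (P.edgeLine k t) = 0 := by
        rw [he, chordVec, hz, aff_lineVec_left]
      exact ⟨fun _ => this.ge, fun _ => this.le⟩
    · exact absurd (P.param_mem (he ▸ P.edgeLine_mem ht)) hy
  · filter_upwards [(hc.eventually (lt_mem_nhds h)).filter_mono inf_le_left] with z hz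
    exact ⟨fun _ => le_of_lt hz, fun h' => absurd h' (not_le.2 h)⟩

/-- An edge not containing the end points of the chord in its interior lies on one side. -/
lemma IsHonest.same_sign {i j : Fin P.numEdges} {z₀ : ℝ × ℝ}
    (hv : P.IsHonest (P.chordVec i j z₀)) (hp : P.edgeLine i z₀.1 ∈ P.carrier)
    (hq : P.edgeLine j z₀.2 ∈ P.carrier) {k : Fin P.numEdges} (hki : k ≠ i) (hkj : k ≠ j) :
    (0 ≤ aff (P.chordVec i j z₀) (P.edgeLine k (P.lo k)) ∧
      0 ≤ aff (P.chordVec i j z₀) (P.edgeLine k (P.hi k))) ∨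
    (aff (P.chordVec i j z₀) (P.edgeLine k (P.lo k)) ≤ 0 ∧
      aff (P.chordVec i j z₀) (P.edgeLine k (P.hi k)) ≤ 0) := by
  by_contra hcon
  push Not at hcon
  have hc : Continuous fun t => aff (P.chordVec i j z₀) (P.edgeLine k t) :=
    (continuous_aff _).comp (P.continuous_edgeLine k)
  have hzero : ∃ t ∈ Ioo (P.lo k) (P.hi k), aff (P.chordVec i j z₀) (P.edgeLine k t) = 0 := by
    have hle := (P.lo_lt_hi k).le
    rcases lt_or_ge (aff (P.chordVec i j z₀) (P.edgeLine k (P.lo k))) 0 with h | h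
    · exact intermediate_value_Ioo hle hc.continuousOn ⟨h, hcon.2 h.le⟩
    · have h2 := hcon.1 h
      refine intermediate_value_Ioo' hle hc.continuousOn ⟨h2, ?_⟩
      by_contra h3
      exact not_lt.2 h2.le (hcon.2 (not_lt.1 h3))
  obtain ⟨t, ht, h0⟩ := hzero
  rcases P.eq_or_eq_of_boundary_zero hv hv.chord_ne hp hq
    (P.edgeLine_mem_carrier_iff.2 (Ioo_subset_Icc_self ht)) (P.ldist_edgeLine_self i _)
    (P.ldist_edgeLine_self j _) (P.ldist_edgeLine_self k _) (aff_lineVec_left _ _)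
    (aff_lineVec_right _ _) h0 with he | he
  · have := P.ldist_edgeLine_pos hki.symm ht
    rw [he, P.ldist_edgeLine_self] at this
    exact lt_irrefl _ this
  · have := P.ldist_edgeLine_pos hkj.symm ht
    rw [he, P.ldist_edgeLine_self] at this
    exact lt_irrefl _ this

/-- The edge integrals of the creases near a given one: the set `S` of edges on the positive side
does not change. -/
lemma IsHonest.exists_local_form {i j : Fin P.numEdges} {z₀ : ℝ × ℝ}
    (hv : P.IsHonest (P.chordVec i j z₀)) (hp : P.edgeLine i z₀.1 ∈ P.carrier)
    (hq : P.edgeLine j z₀.2 ∈ P.carrier) (hy : z₀.2 ∉ ratField) :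
    ∃ S : Finset (Fin P.numEdges), ∀ᶠ z in chordFilter z₀, ∀ W : Fin P.numEdges → ℝ,
      ∑ k, W k * P.edgeInt k (crease (P.chordVec i j z)) =
        W i * (P.ldist i (P.edgeLine j z.2) * (P.hi i - z.1) ^ 2 / 2) +
        W j * (P.ldist j (P.edgeLine i z.1) * (z.2 - P.lo j) ^ 2 / 2) +
        ∑ k ∈ S, W k * P.edgeInt k (aff (P.chordVec i j z)) := by
  classical
  set S : Finset (Fin P.numEdges) := Finset.univ.filter fun k => k ≠ i ∧ k ≠ j ∧
    0 ≤ aff (P.chordVec i j z₀) (P.edgeLine k (P.lo k)) ∧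
    0 ≤ aff (P.chordVec i j z₀) (P.edgeLine k (P.hi k)) with hS
  refine ⟨S, ?_⟩
  have hio : ∀ {k : Fin P.numEdges} {t : ℝ}, P.edgeLine k t ∈ P.carrier → t ∉ ratField →
      t ∈ Ioo (P.lo k) (P.hi k) := by
    intro k t ht hirr
    obtain ⟨h1, h2⟩ := P.edgeLine_mem_carrier_iff.1 ht
    exact ⟨lt_of_le_of_ne h1 fun h => hirr (h ▸ P.lo_mem k),
      lt_of_le_of_ne h2 fun h => hirr (h.symm ▸ P.hi_mem k)⟩
  have hpe : ∀ᶠ z in chordFilter z₀, P.edgeLine i z.1 ∈ P.carrier := by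
    by_cases hx : z₀.1 ∈ ratField
    · filter_upwards [mem_inf_of_right (mem_principal_self _)] with z hz
      rw [hz hx]; exact hp
    · refine Eventually.filter_mono inf_le_left ?_
      filter_upwards [continuous_fst.continuousAt.eventually (Ioo_mem_nhds (hio hp hx).1
        (hio hp hx).2)] with z hz
      exact P.edgeLine_mem_carrier_iff.2 (Ioo_subset_Icc_self hz)
  have hqe : ∀ᶠ z in chordFilter z₀, P.edgeLine j z.2 ∈ P.carrier := by
    refine Eventually.filter_mono inf_le_left ?_
    filter_upwards [continuous_snd.continuousAt.eventually (Ioo_mem_nhds (hio hq hy).1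
      (hio hq hy).2)] with z hz
    exact P.edgeLine_mem_carrier_iff.2 (Ioo_subset_Icc_self hz)
  filter_upwards [hpe, hqe,
    eventually_all.2 fun k => eventually_sign hv hp hq hy (P.lo_mem k) (P.edgeLine_lo_mem k),
    eventually_all.2 fun k => eventually_sign hv hp hq hy (P.hi_mem k) (P.edgeLine_hi_mem k)]
    with z hzp hzq hlo hhi W
  have hij := hv.ne
  have hterm : ∀ k, W k * P.edgeInt k (crease (P.chordVec i j z)) =
      (if k = i then W i * (P.ldist i (P.edgeLine j z.2) * (P.hi i - z.1) ^ 2 / 2) else 0) +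
      (if k = j then W j * (P.ldist j (P.edgeLine i z.1) * (z.2 - P.lo j) ^ 2 / 2) else 0) +
      (if k ∈ S then W k * P.edgeInt k (aff (P.chordVec i j z)) else 0) := by
    intro k
    by_cases hki : k = i
    · subst hki
      have hkS : k ∉ S := by simp [hS]
      rw [if_pos rfl, if_neg hij, if_neg hkS, chordVec, P.edgeInt_crease_left hzp hzq]
      ring
    by_cases hkj : k = j
    · subst hkj
      have hkS : k ∉ S := by simp [hS]
      rw [if_neg hki, if_pos rfl, if_neg hkS, chordVec, P.edgeInt_crease_right hzq hzp]
      ring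
    rw [if_neg hki, if_neg hkj, zero_add, zero_add]
    by_cases hkS : k ∈ S
    · have hk := (Finset.mem_filter.1 hkS).2
      rw [if_pos hkS, P.edgeInt_crease_of_nonneg ((hlo k).1 hk.2.2.1) ((hhi k).1 hk.2.2.2)]
    · have hk : ¬ (0 ≤ aff (P.chordVec i j z₀) (P.edgeLine k (P.lo k)) ∧
          0 ≤ aff (P.chordVec i j z₀) (P.edgeLine k (P.hi k))) := fun h =>
        hkS (Finset.mem_filter.2 ⟨Finset.mem_univ k, hki, hkj, h⟩)
      have h2 := (hv.same_sign hp hq hki hkj).resolve_left hk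
      rw [if_neg hkS, P.edgeInt_crease_of_nonpos ((hlo k).2 h2.1) ((hhi k).2 h2.2), mul_zero]
  rw [Finset.sum_congr rfl fun k _ => hterm k, Finset.sum_add_distrib, Finset.sum_add_distrib]
  simp

lemma dense_ratField : Dense (ratField : Set ℝ) := Rat.denseRange_cast

/-- A crease through a rational boundary point has positive Futaki invariant: rotating it about
that point, the Futaki invariant is a rational quadratic polynomial in the other end point. -/
lemma IsHonest.futaki_pos_of_left_mem (hP : P.IsKPolystable) {i j : Fin P.numEdges} {z₀ : ℝ × ℝ}
    (hv : P.IsHonest (P.chordVec i j z₀)) (hp : P.edgeLine i z₀.1 ∈ P.carrier)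
    (hq : P.edgeLine j z₀.2 ∈ P.carrier) (hx : z₀.1 ∈ ratField) :
    0 < P.futaki (crease (P.chordVec i j z₀)) := by
  have hrat : ∀ y ∈ ratField, P.IsHonest (P.chordVec i j (z₀.1, y)) →
      0 < P.futaki (crease (P.chordVec i j (z₀.1, y))) := by
    intro y hy hh
    have h1 := P.edgeLine_mem (k := i) hx
    have h2 := P.edgeLine_mem (k := j) hy
    exact P.futaki_crease_rat_pos hP (neg_mem (sub_mem h2.2 h1.2)) (sub_mem h2.1 h1.1)
      (sub_mem (mul_mem h2.2 h1.1) (mul_mem h2.1 h1.2)) hh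
  by_cases hy : z₀.2 ∈ ratField
  · exact hrat z₀.2 hy hv
  refine lt_of_le_of_ne (P.futaki_crease_nonneg hP _) fun h0 => ?_
  obtain ⟨S, hS⟩ := hv.exists_local_form hp hq hy
  set p := P.edgeLine i z₀.1 with hpdef
  set W : Fin P.numEdges → ℝ := fun k => 1 - P.avgConst / 3 * P.ldist k p with hW
  have ha := P.avgConst_mem hP
  have hWm : ∀ k, W k ∈ ratField := fun k => sub_mem (one_mem _) (mul_mem (div_mem ha
    (ofNat_mem_ratField 3)) (P.ldist_mem (P.edgeLine_fst_mem hx) (P.edgeLine_snd_mem hx)))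
  set L : Fin P.numEdges → ℝ × ℝ → ℝ := fun k z => P.edgeInt k (aff (P.chordVec i j z)) with hL
  set α : ℝ := W j * P.ldist j p / 2 with hα
  set β : ℝ := W i * (P.cross j i * (P.hi i - z₀.1) ^ 2 / 2) - W j * P.ldist j p * P.lo j +
    ∑ k ∈ S, W k * (L k (0, 1) - L k (0, 0) + (P.hi k - P.lo k) * P.cross i j * z₀.1) with hβ
  set γ : ℝ := W i * (P.ldist i (P.edgeLine j 0) * (P.hi i - z₀.1) ^ 2 / 2) +
    W j * P.ldist j p * P.lo j ^ 2 / 2 +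
    ∑ k ∈ S, W k * (L k (0, 0) + (L k (1, 0) - L k (0, 0)) * z₀.1) with hγ
  have hαm : α ∈ ratField := div_mem (mul_mem (hWm j)
    (P.ldist_mem (P.edgeLine_fst_mem hx) (P.edgeLine_snd_mem hx))) (ofNat_mem_ratField 2)
  have hLm : ∀ k {z : ℝ × ℝ}, z.1 ∈ ratField → z.2 ∈ ratField → L k z ∈ ratField :=
    fun k z h1 h2 => P.edgeInt_chordVec_mem i j k h1 h2
  have hβm : β ∈ ratField := by
    refine add_mem (sub_mem (mul_mem (hWm i) (div_mem (mul_mem (P.cross_mem _ _)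
      (pow_mem (sub_mem (P.hi_mem i) hx) 2)) (ofNat_mem_ratField 2))) (mul_mem (mul_mem (hWm j)
      (P.ldist_mem (P.edgeLine_fst_mem hx) (P.edgeLine_snd_mem hx))) (P.lo_mem j)))
      (sum_mem fun k _ => mul_mem (hWm k) (add_mem (sub_mem (hLm k (zero_mem _) (one_mem _))
        (hLm k (zero_mem _) (zero_mem _))) (mul_mem (mul_mem (sub_mem (P.hi_mem k) (P.lo_mem k))
        (P.cross_mem _ _)) hx)))
  have hform : ∀ᶠ t in 𝓝 (0 : ℝ), P.futaki (crease (P.chordVec i j (z₀.1, z₀.2 + t))) =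
      α * (z₀.2 + t) ^ 2 + β * (z₀.2 + t) + γ := by
    have hten : Tendsto (fun t : ℝ => (z₀.1, z₀.2 + t)) (𝓝 0) (chordFilter z₀) := by
      refine tendsto_inf.2 ⟨?_, tendsto_principal.2 (Eventually.of_forall fun t _ => rfl)⟩
      have hc : Continuous fun t : ℝ => (z₀.1, z₀.2 + t) := by fun_prop
      exact hc.tendsto' 0 z₀ (by simp)
    filter_upwards [hten.eventually hS] with t ht
    rw [P.futaki_crease_eq (P.chordVec i j (z₀.1, z₀.2 + t)) (p := p) (aff_lineVec_left _ _), ht W]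
    have hsum : ∑ k ∈ S, W k * P.edgeInt k (aff (P.chordVec i j (z₀.1, z₀.2 + t))) =
        (∑ k ∈ S, W k * (L k (0, 1) - L k (0, 0) + (P.hi k - P.lo k) * P.cross i j * z₀.1)) *
          (z₀.2 + t) + ∑ k ∈ S, W k * (L k (0, 0) + (L k (1, 0) - L k (0, 0)) * z₀.1) := by
      rw [Finset.sum_mul, ← Finset.sum_add_distrib]
      refine Finset.sum_congr rfl fun k _ => ?_
      rw [P.edgeInt_chordVec i j k (z₀.1, z₀.2 + t)]
      ring
    rw [hsum, P.ldist_edgeLine i j (z₀.2 + t), hα, hβ, hγ]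
    ring
  have hval := hform.self_of_nhds
  rw [add_zero, ← h0] at hval
  have hmin := quadratic_local_min (α := α) (β := 2 * α * z₀.2 + β) (by
    filter_upwards [hform] with t ht
    have := P.futaki_crease_nonneg hP (P.chordVec i j (z₀.1, z₀.2 + t))
    rw [ht] at this
    linarith)
  by_cases hα0 : α = 0
  · -- the Futaki invariant vanishes identically near `z₀`, hence at a rational chord
    have hβ0 : β = 0 := by rw [hα0] at hmin; linarith [hmin.1]
    have hγ0 : γ = 0 := by rw [hα0, hβ0] at hval; linarith
    have hc : Continuous fun t : ℝ => (z₀.1, z₀.2 + t) := by fun_prop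
    have hh := (hc.tendsto' 0 z₀ (by simp)).eventually (P.eventually_isHonest hv)
    obtain ⟨ε, hε, hball⟩ := Metric.eventually_nhds_iff.1 (hform.and hh)
    obtain ⟨y, hy1, hy2⟩ := dense_ratField.exists_mem_open
      (isOpen_lt ((continuous_id.sub continuous_const).dist continuous_const)
        continuous_const : IsOpen {y : ℝ | dist (y - z₀.2) 0 < ε}) ⟨z₀.2, by simpa using hε⟩
    have hb := hball hy2
    rw [add_sub_cancel, hα0, hβ0, hγ0] at hb
    have := hrat y hy1 hb.2
    rw [hb.1] at this
    linarith
  · apply hy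
    rw [show z₀.2 = -β / (2 * α) by
      rw [eq_div_iff (mul_ne_zero two_ne_zero hα0)]; linarith [hmin.1]]
    exact div_mem (neg_mem hβm) (mul_mem (ofNat_mem_ratField 2) hαm)

lemma IsHonest.neg {v : ℝ × ℝ × ℝ} (hv : P.IsHonest v) : P.IsHonest (-v) := by
  obtain ⟨⟨z, hz, hz0⟩, w, hw, hw0⟩ := hv
  exact ⟨⟨w, hw, by rw [aff_neg]; linarith⟩, z, hz, by rw [aff_neg]; linarith⟩

lemma IsHonest.futaki_pos_of_right_mem (hP : P.IsKPolystable) {i j : Fin P.numEdges} {z₀ : ℝ × ℝ}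
    (hv : P.IsHonest (P.chordVec i j z₀)) (hp : P.edgeLine i z₀.1 ∈ P.carrier)
    (hq : P.edgeLine j z₀.2 ∈ P.carrier) (hy : z₀.2 ∈ ratField) :
    0 < P.futaki (crease (P.chordVec i j z₀)) := by
  have he : P.chordVec j i z₀.swap = -P.chordVec i j z₀ := lineVec_swap _ _
  rw [← P.futaki_crease_neg hP, ← he]
  exact IsHonest.futaki_pos_of_left_mem hP (he ▸ hv.neg) hq hp hy

lemma chordFilter_of_notMem {z₀ : ℝ × ℝ} (h : z₀.1 ∉ ratField) : chordFilter z₀ = 𝓝 z₀ := by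
  have : {z : ℝ × ℝ | z₀.1 ∈ ratField → z.1 = z₀.1} = univ :=
    eq_univ_of_forall fun z hz => absurd hz h
  rw [chordFilter, this, principal_univ, inf_top_eq]

/-- Creases joining two parallel edges: here the Futaki invariant is a rational quadratic
polynomial in the end points. -/
lemma IsHonest.futaki_ne_zero_of_parallel (hP : P.IsKPolystable) {i j : Fin P.numEdges}
    {z₀ : ℝ × ℝ} (hv : P.IsHonest (P.chordVec i j z₀)) (hp : P.edgeLine i z₀.1 ∈ P.carrier)
    (hq : P.edgeLine j z₀.2 ∈ P.carrier) (hx : z₀.1 ∉ ratField) (hy : z₀.2 ∉ ratField)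
    (hcr : P.cross i j = 0) (h0 : P.futaki (crease (P.chordVec i j z₀)) = 0) : False := by
  obtain ⟨S, hS⟩ := hv.exists_local_form hp hq hy
  rw [chordFilter_of_notMem hx] at hS
  have ha := P.avgConst_mem hP
  set a := P.avgConst with hadef
  set L : Fin P.numEdges → ℝ × ℝ → ℝ := fun k z => P.edgeInt k (aff (P.chordVec i j z)) with hL
  have hLm : ∀ k {z : ℝ × ℝ}, z.1 ∈ ratField → z.2 ∈ ratField → L k z ∈ ratField :=
    fun k z h1 h2 => P.edgeInt_chordVec_mem i j k h1 h2
  have zm := zero_mem ratField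
  have om := one_mem ratField
  have hl : ∀ k l, P.ldist k (P.edgeLine l 0) ∈ ratField := fun k l =>
    P.ldist_mem (P.edgeLine_fst_mem zm) (P.edgeLine_snd_mem zm)
  have a3 : a / 3 ∈ ratField := div_mem ha (ofNat_mem_ratField 3)
  have two := ofNat_mem_ratField 2
  obtain ⟨A, hA⟩ : ∃ A : Fin P.numEdges → ℝ, A = fun k => L k (0, 0) := ⟨_, rfl⟩
  obtain ⟨B, hB⟩ : ∃ B : Fin P.numEdges → ℝ, B = fun k => L k (1, 0) - L k (0, 0) := ⟨_, rfl⟩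
  obtain ⟨C, hC⟩ : ∃ C : Fin P.numEdges → ℝ, C = fun k => L k (0, 1) - L k (0, 0) := ⟨_, rfl⟩
  have hAm : ∀ k, A k ∈ ratField := fun k => hA ▸ hLm k zm zm
  have hBm : ∀ k, B k ∈ ratField := fun k => hB ▸ sub_mem (hLm k om zm) (hLm k zm zm)
  have hCm : ∀ k, C k ∈ ratField := fun k => hC ▸ sub_mem (hLm k zm om) (hLm k zm zm)
  obtain ⟨δ, hδ⟩ : ∃ δ : Fin P.numEdges → ℝ, δ = fun k => P.ldist k (P.edgeLine i 0) := ⟨_, rfl⟩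
  have hδm : ∀ k, δ k ∈ ratField := fun k => hδ ▸ hl k i
  obtain ⟨c, hc⟩ : ∃ c : Fin P.numEdges → ℝ, c = fun k => P.cross i k := ⟨_, rfl⟩
  have hcm : ∀ k, c k ∈ ratField := fun k => hc ▸ P.cross_mem i k
  obtain ⟨u, hu⟩ : ∃ u, u = P.ldist j (P.edgeLine i 0) := ⟨_, rfl⟩
  obtain ⟨v, hv'⟩ : ∃ v, v = P.ldist i (P.edgeLine j 0) := ⟨_, rfl⟩
  have hum : u ∈ ratField := hu ▸ hl j i
  have hvm : v ∈ ratField := hv' ▸ hl i j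
  set α : ℝ := v / 2 + ∑ k ∈ S, -(a / 3) * c k * B k with hα
  set g : ℝ := ∑ k ∈ S, -(a / 3) * c k * C k with hg
  set β : ℝ := (1 - a / 3 * u) * u / 2 with hβ
  set d : ℝ := -v * P.hi i + ∑ k ∈ S, ((1 - a / 3 * δ k) * B k - a / 3 * c k * A k) with hd
  set e : ℝ := -(1 - a / 3 * u) * u * P.lo j + ∑ k ∈ S, (1 - a / 3 * δ k) * C k with he
  set f : ℝ := v * P.hi i ^ 2 / 2 + (1 - a / 3 * u) * u * P.lo j ^ 2 / 2 +
    ∑ k ∈ S, (1 - a / 3 * δ k) * A k with hf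
  have hform : ∀ᶠ z in 𝓝 z₀, P.futaki (crease (P.chordVec i j z)) =
      α * z.1 ^ 2 + g * z.1 * z.2 + β * z.2 ^ 2 + d * z.1 + e * z.2 + f := by
    filter_upwards [hS] with z hz
    rw [P.futaki_crease_eq (P.chordVec i j z) (p := P.edgeLine i z.1) (aff_lineVec_left _ _),
      hz fun k => 1 - P.avgConst / 3 * P.ldist k (P.edgeLine i z.1)]
    have hsum : ∑ k ∈ S, (1 - P.avgConst / 3 * P.ldist k (P.edgeLine i z.1)) *
        P.edgeInt k (aff (P.chordVec i j z)) =
        (∑ k ∈ S, -(a / 3) * c k * B k) * z.1 ^ 2 + g * z.1 * z.2 +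
        (∑ k ∈ S, ((1 - a / 3 * δ k) * B k - a / 3 * c k * A k)) * z.1 +
        (∑ k ∈ S, (1 - a / 3 * δ k) * C k) * z.2 + ∑ k ∈ S, (1 - a / 3 * δ k) * A k := by
      simp only [hg, Finset.sum_mul, ← Finset.sum_add_distrib]
      refine Finset.sum_congr rfl fun k _ => ?_
      rw [P.edgeInt_chordVec i j k z, hcr, P.ldist_edgeLine k i, hA, hB, hC, hδ, hc]
      ring
    rw [hsum, P.ldist_edgeLine_self, P.ldist_edgeLine i j, P.ldist_edgeLine j i, P.cross_swap j i,
      hcr, ← hu, ← hv', hα, hβ, hd, he, hf]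
    ring
  have hfreq := exists_rational_zero_of_local_min (x := z₀.1) (y := z₀.2)
    (α := α) (g := g) (β := β) (d := d) (e := e) (f := f)
    (add_mem (div_mem hvm two) (sum_mem fun k _ => mul_mem (mul_mem (neg_mem a3) (hcm k)) (hBm k)))
    (sum_mem fun k _ => mul_mem (mul_mem (neg_mem a3) (hcm k)) (hCm k))
    (div_mem (mul_mem (sub_mem om (mul_mem a3 hum)) hum) two)
    (add_mem (mul_mem (neg_mem hvm) (P.hi_mem i)) (sum_mem fun k _ => sub_mem (mul_mem (sub_mem om
      (mul_mem a3 (hδm k))) (hBm k)) (mul_mem (mul_mem a3 (hcm k)) (hAm k))))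
    (add_mem (mul_mem (mul_mem (neg_mem (sub_mem om (mul_mem a3 hum))) hum) (P.lo_mem j))
      (sum_mem fun k _ => mul_mem (sub_mem om (mul_mem a3 (hδm k))) (hCm k)))
    (by rw [← hform.self_of_nhds, h0])
    (hform.mono fun z hz => hz ▸ P.futaki_crease_nonneg hP _)
  have hio : ∀ {k : Fin P.numEdges} {t : ℝ}, P.edgeLine k t ∈ P.carrier → t ∉ ratField →
      t ∈ Ioo (P.lo k) (P.hi k) := by
    intro k t ht hirr
    obtain ⟨h1, h2⟩ := P.edgeLine_mem_carrier_iff.1 ht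
    exact ⟨lt_of_le_of_ne h1 fun h => hirr (h ▸ P.lo_mem k),
      lt_of_le_of_ne h2 fun h => hirr (h.symm ▸ P.hi_mem k)⟩
  have hpe : ∀ᶠ z : ℝ × ℝ in 𝓝 z₀, P.edgeLine i z.1 ∈ P.carrier := by
    filter_upwards [continuous_fst.continuousAt.eventually (Ioo_mem_nhds (hio hp hx).1
      (hio hp hx).2)] with z hz
    exact P.edgeLine_mem_carrier_iff.2 (Ioo_subset_Icc_self hz)
  have hqe : ∀ᶠ z : ℝ × ℝ in 𝓝 z₀, P.edgeLine j z.2 ∈ P.carrier := by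
    filter_upwards [continuous_snd.continuousAt.eventually (Ioo_mem_nhds (hio hq hy).1
      (hio hq hy).2)] with z hz
    exact P.edgeLine_mem_carrier_iff.2 (Ioo_subset_Icc_self hz)
  obtain ⟨z, ⟨hzr, hz0⟩, hzf, hzh, hzp, hzq⟩ :=
    (hfreq.and_eventually (hform.and ((P.eventually_isHonest hv).and (hpe.and hqe)))).exists
  rw [hz0] at hzf
  rcases hzr with hzr | hzr
  · exact (hzh.futaki_pos_of_left_mem hP hzp hzq hzr).ne' hzf
  · exact (hzh.futaki_pos_of_right_mem hP hzp hzq hzr).ne' hzf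

/-- Creases joining two edges that are not parallel: in the coordinates `U`, `V` given by the
lattice distances of the end points to the opposite edge, the Futaki invariant is a multiple of
`U V (U + V) - (a / 3) U² V² + g U V + e U + f V`. -/
lemma IsHonest.futaki_ne_zero_of_cross_ne (hP : P.IsKPolystable) {i j : Fin P.numEdges}
    {z₀ : ℝ × ℝ} (hv : P.IsHonest (P.chordVec i j z₀)) (hp : P.edgeLine i z₀.1 ∈ P.carrier)
    (hq : P.edgeLine j z₀.2 ∈ P.carrier) (hx : z₀.1 ∉ ratField) (hy : z₀.2 ∉ ratField)
    (hcr : P.cross i j ≠ 0) (h0 : P.futaki (crease (P.chordVec i j z₀)) = 0) : False := by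
  obtain ⟨S, hS⟩ := hv.exists_local_form hp hq hy
  rw [chordFilter_of_notMem hx] at hS
  have ham := P.avgConst_mem hP
  have hU0 := hv.ldist_pos_left hp
  have hV0 := hv.ldist_pos_right hq
  have zm := zero_mem ratField
  have om := one_mem ratField
  have hl : ∀ k l, P.ldist k (P.edgeLine l 0) ∈ ratField := fun k l =>
    P.ldist_mem (P.edgeLine_fst_mem zm) (P.edgeLine_snd_mem zm)
  have three := ofNat_mem_ratField 3
  have a3 : P.avgConst / 3 ∈ ratField := div_mem ham three
  have two := ofNat_mem_ratField 2
  obtain ⟨a, ha⟩ : ∃ a, a = P.avgConst := ⟨_, rfl⟩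
  obtain ⟨D, hD⟩ : ∃ D, D = P.cross i j := ⟨_, rfl⟩
  have hDm : D ∈ ratField := hD ▸ P.cross_mem i j
  rw [← hD] at hcr
  obtain ⟨u, hu⟩ : ∃ u, u = P.ldist j (P.edgeLine i 0) := ⟨_, rfl⟩
  obtain ⟨v, hv'⟩ : ∃ v, v = P.ldist i (P.edgeLine j 0) := ⟨_, rfl⟩
  have hum : u ∈ ratField := hu ▸ hl j i
  have hvm : v ∈ ratField := hv' ▸ hl i j
  have hUx : ∀ x, P.ldist j (P.edgeLine i x) = u + D * x := fun x => by
    rw [P.ldist_edgeLine j i, hu, hD]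
  have hVy : ∀ y, P.ldist i (P.edgeLine j y) = v - D * y := fun y => by
    rw [P.ldist_edgeLine i j, P.cross_swap, hv', hD]; ring
  obtain ⟨Qi, hQi⟩ : ∃ Q : Fin P.numEdges → ℝ, Q = fun k => P.edgeInt k (aff (P.ldistVec i)) :=
    ⟨_, rfl⟩
  obtain ⟨Qj, hQj⟩ : ∃ Q : Fin P.numEdges → ℝ, Q = fun k => P.edgeInt k (aff (P.ldistVec j)) :=
    ⟨_, rfl⟩
  obtain ⟨l, hl'⟩ : ∃ l : Fin P.numEdges → ℝ, l = fun k => P.hi k - P.lo k := ⟨_, rfl⟩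
  have hQim : ∀ k, Qi k ∈ ratField := fun k => hQi ▸ P.edgeInt_ldistVec_mem i k
  have hQjm : ∀ k, Qj k ∈ ratField := fun k => hQj ▸ P.edgeInt_ldistVec_mem j k
  have hlm : ∀ k, l k ∈ ratField := fun k => hl' ▸ sub_mem (P.hi_mem k) (P.lo_mem k)
  -- the weights at the two end points as affine functions of `U` and `V`
  obtain ⟨γ, hγ⟩ : ∃ γ : Fin P.numEdges → ℝ, γ = fun k => P.cross i k / D := ⟨_, rfl⟩
  obtain ⟨β, hβ⟩ : ∃ β : Fin P.numEdges → ℝ,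
    β = fun k => P.ldist k (P.edgeLine i 0) - P.cross i k * u / D := ⟨_, rfl⟩
  obtain ⟨γ', hγ'⟩ : ∃ γ : Fin P.numEdges → ℝ, γ = fun k => -P.cross j k / D := ⟨_, rfl⟩
  obtain ⟨β', hβ'⟩ : ∃ β : Fin P.numEdges → ℝ,
    β = fun k => P.ldist k (P.edgeLine j 0) + P.cross j k * v / D := ⟨_, rfl⟩
  have hγm : ∀ k, γ k ∈ ratField := fun k => hγ ▸ div_mem (P.cross_mem i k) hDm
  have hβm : ∀ k, β k ∈ ratField := fun k => hβ ▸ sub_mem (hl k i)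
    (div_mem (mul_mem (P.cross_mem i k) hum) hDm)
  set Ut := u + D * P.hi i with hUt
  set Vs := v - D * P.lo j with hVs
  have hUtm : Ut ∈ ratField := add_mem hum (mul_mem hDm (P.hi_mem i))
  have hVsm : Vs ∈ ratField := sub_mem hvm (mul_mem hDm (P.lo_mem j))
  set n1 := ∑ k ∈ S, 2 * D * (1 - a / 3 * β k) * Qi k with hn1
  set n2 := ∑ k ∈ S, 2 * D * (1 - a / 3 * β k) * Qj k with hn2
  set n3 := ∑ k ∈ S, 2 * D * (-(1 - a / 3 * β k) * l k - a / 3 * γ k * Qj k) with hn3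
  set n4 := ∑ k ∈ S, 2 * D * (-(a / 3) * γ k * Qi k) with hn4
  set n6 := ∑ k ∈ S, 2 * D * (a / 3 * γ k * l k) with hn6
  set m1 := ∑ k ∈ S, 2 * D * (1 - a / 3 * β' k) * Qi k with hm1
  set m2 := ∑ k ∈ S, 2 * D * (1 - a / 3 * β' k) * Qj k with hm2
  set m3 := ∑ k ∈ S, 2 * D * (-(1 - a / 3 * β' k) * l k - a / 3 * γ' k * Qi k) with hm3
  set m4 := ∑ k ∈ S, 2 * D * (-(a / 3) * γ' k * Qj k) with hm4
  set m6 := ∑ k ∈ S, 2 * D * (a / 3 * γ' k * l k) with hm6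
  set U₀ := P.ldist j (P.edgeLine i z₀.1) with hU₀
  set V₀ := P.ldist i (P.edgeLine j z₀.2) with hV₀
  set ψ : ℝ × ℝ → ℝ × ℝ := fun w => ((w.1 - u) / D, (v - w.2) / D) with hψ
  have hψ0 : ψ (U₀, V₀) = z₀ := by
    refine Prod.ext ?_ ?_
    · simp only [hψ, hU₀, hUx]; field_simp; ring
    · simp only [hψ, hV₀, hVy]; field_simp; ring
  have hψc : Tendsto ψ (𝓝 (U₀, V₀)) (𝓝 z₀) := by
    have : Continuous ψ := by fun_prop
    exact this.tendsto' _ _ hψ0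
  have hforms : ∀ᶠ w : ℝ × ℝ in 𝓝 (U₀, V₀),
      2 * D ^ 2 * P.futaki (crease (P.chordVec i j (ψ w))) =
        w.2 * (Ut - w.1) ^ 2 + (1 - a / 3 * w.1) * (w.1 * (Vs - w.2) ^ 2) +
        (n1 * w.1 + n2 * w.2 + n3 * w.1 * w.2 + n4 * w.1 ^ 2 + n6 * w.1 ^ 2 * w.2) ∧
      2 * D ^ 2 * P.futaki (crease (P.chordVec i j (ψ w))) =
        (1 - a / 3 * w.2) * (w.2 * (Ut - w.1) ^ 2) + w.1 * (Vs - w.2) ^ 2 +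
        (m1 * w.1 + m2 * w.2 + m3 * w.1 * w.2 + m4 * w.2 ^ 2 + m6 * w.1 * w.2 ^ 2) := by
    filter_upwards [hψc.eventually hS] with w hw
    have eU : P.ldist j (P.edgeLine i (ψ w).1) = w.1 := by
      rw [hUx]; simp only [hψ]; field_simp; ring
    have eV : P.ldist i (P.edgeLine j (ψ w).2) = w.2 := by
      rw [hVy]; simp only [hψ]; field_simp; ring
    have e1 : D * (P.hi i - (ψ w).1) = Ut - w.1 := by
      simp only [hψ, hUt]; field_simp; ring
    have e2 : D * ((ψ w).2 - P.lo j) = Vs - w.2 := by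
      simp only [hψ, hVs]; field_simp
      ring
    have eI : ∀ k, D * P.edgeInt k (aff (P.chordVec i j (ψ w))) =
        w.2 * Qj k + w.1 * Qi k - w.1 * w.2 * l k := fun k => by
      rw [hD, P.cross_mul_edgeInt_chordVec i j k, eU, eV, hQi, hQj, hl']
    have ewp : ∀ k, P.ldist k (P.edgeLine i (ψ w).1) = β k + γ k * w.1 := fun k => by
      rw [P.ldist_edgeLine k i, hβ, hγ]; simp only [hψ]; field_simp; ring
    have ewq : ∀ k, P.ldist k (P.edgeLine j (ψ w).2) = β' k + γ' k * w.2 := fun k => by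
      rw [P.ldist_edgeLine k j, hβ', hγ']; simp only [hψ]; field_simp; ring
    constructor
    · rw [P.futaki_crease_eq (P.chordVec i j (ψ w)) (p := P.edgeLine i (ψ w).1)
        (aff_lineVec_left _ _),
        hw fun k => 1 - P.avgConst / 3 * P.ldist k (P.edgeLine i (ψ w).1)]
      have hsum : 2 * D ^ 2 * ∑ k ∈ S, (1 - P.avgConst / 3 * P.ldist k (P.edgeLine i (ψ w).1)) *
          P.edgeInt k (aff (P.chordVec i j (ψ w))) =
          n1 * w.1 + n2 * w.2 + n3 * w.1 * w.2 + n4 * w.1 ^ 2 + n6 * w.1 ^ 2 * w.2 := by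
        simp only [hn1, hn2, hn3, hn4, hn6, Finset.sum_mul, ← Finset.sum_add_distrib,
          Finset.mul_sum]
        refine Finset.sum_congr rfl fun k _ => ?_
        rw [ewp k, ← ha]
        linear_combination 2 * D * (1 - a / 3 * (β k + γ k * w.1)) * eI k
      rw [mul_add, hsum]
      rw [P.ldist_edgeLine_self, eU, eV, ← ha]
      linear_combination (w.2 * (D * (P.hi i - (ψ w).1) + (Ut - w.1))) * e1 +
        ((1 - a / 3 * w.1) * w.1 * (D * ((ψ w).2 - P.lo j) + (Vs - w.2))) * e2
    · rw [P.futaki_crease_eq (P.chordVec i j (ψ w)) (p := P.edgeLine j (ψ w).2)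
        (aff_lineVec_right _ _),
        hw fun k => 1 - P.avgConst / 3 * P.ldist k (P.edgeLine j (ψ w).2)]
      have hsum : 2 * D ^ 2 * ∑ k ∈ S, (1 - P.avgConst / 3 * P.ldist k (P.edgeLine j (ψ w).2)) *
          P.edgeInt k (aff (P.chordVec i j (ψ w))) =
          m1 * w.1 + m2 * w.2 + m3 * w.1 * w.2 + m4 * w.2 ^ 2 + m6 * w.1 * w.2 ^ 2 := by
        simp only [hm1, hm2, hm3, hm4, hm6, Finset.sum_mul, ← Finset.sum_add_distrib,
          Finset.mul_sum]
        refine Finset.sum_congr rfl fun k _ => ?_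
        rw [ewq k, ← ha]
        linear_combination 2 * D * (1 - a / 3 * (β' k + γ' k * w.2)) * eI k
      rw [mul_add, hsum]
      rw [P.ldist_edgeLine_self, eU, eV, ← ha]
      linear_combination ((1 - a / 3 * w.2) * w.2 * (D * (P.hi i - (ψ w).1) + (Ut - w.1))) * e1 +
        (w.1 * (D * ((ψ w).2 - P.lo j) + (Vs - w.2))) * e2
  obtain ⟨h4, h6⟩ := matching_coefficients (hforms.mono fun w hw => hw.1.symm.trans hw.2)
  have hcanon : ∀ᶠ w : ℝ × ℝ in 𝓝 (U₀, V₀),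
      2 * D ^ 2 * P.futaki (crease (P.chordVec i j (ψ w))) =
        w.1 * w.2 * (w.1 + w.2) - a / 3 * w.1 ^ 2 * w.2 ^ 2 + (n3 - 2 * Ut - 2 * Vs) * w.1 * w.2 +
        (Vs ^ 2 + n1) * w.1 + (Ut ^ 2 + n2) * w.2 := by
    filter_upwards [hforms] with w hw
    rw [hw.1, h4, h6]; ring
  have hDpos : 0 < 2 * D ^ 2 := by positivity
  rw [← ha] at a3 ham
  have hres := mem_ratField_of_local_min (a := a) (U := U₀) (V := V₀) (g := n3 - 2 * Ut - 2 * Vs)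
    (e := Vs ^ 2 + n1) (f := Ut ^ 2 + n2) (ha ▸ P.avgConst_pos) ham
    (sub_mem (sub_mem (sum_mem fun k _ => mul_mem (mul_mem two hDm) (sub_mem (mul_mem (neg_mem
      (sub_mem om (mul_mem a3 (hβm k)))) (hlm k)) (mul_mem (mul_mem a3 (hγm k)) (hQjm k))))
      (mul_mem two hUtm)) (mul_mem two hVsm))
    (add_mem (pow_mem hVsm 2) (sum_mem fun k _ => mul_mem (mul_mem (mul_mem two hDm)
      (sub_mem om (mul_mem a3 (hβm k)))) (hQim k)))
    (add_mem (pow_mem hUtm 2) (sum_mem fun k _ => mul_mem (mul_mem (mul_mem two hDm)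
      (sub_mem om (mul_mem a3 (hβm k)))) (hQjm k)))
    hU0 hV0 (by rw [← hcanon.self_of_nhds, hψ0, h0, mul_zero])
    (hcanon.mono fun w hw => hw ▸ mul_nonneg hDpos.le (P.futaki_crease_nonneg hP _))
  rcases hres with h | h
  · refine hx ?_
    rw [show z₀.1 = (U₀ - u) / D by rw [hU₀, hUx]; field_simp; ring]
    exact div_mem (sub_mem h hum) hDm
  · refine hy ?_
    rw [show z₀.2 = (v - V₀) / D by rw [hV₀, hVy]; field_simp; ring]
    exact div_mem (sub_mem hvm h) hDm

/-- Every crease cutting the polygon, rational or not, has positive Futaki invariant. -/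
theorem IsHonest.futaki_pos (hP : P.IsKPolystable) {v : ℝ × ℝ × ℝ} (hv : P.IsHonest v) :
    0 < P.futaki (crease v) := by
  obtain ⟨i, j, x, y, hp, hq, hpq, hp0, hq0⟩ := hv.exists_chord
  have hchord : ∀ {w : ℝ × ℝ × ℝ}, P.IsHonest w → w = P.chordVec i j (x, y) →
      0 < P.futaki (crease w) := by
    rintro w hw rfl
    by_cases hx : x ∈ ratField
    · exact hw.futaki_pos_of_left_mem hP hp hq hx
    by_cases hy : y ∈ ratField
    · exact hw.futaki_pos_of_right_mem hP hp hq hy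
    refine lt_of_le_of_ne (P.futaki_crease_nonneg hP _) fun h0 => ?_
    by_cases hcr : P.cross i j = 0
    · exact hw.futaki_ne_zero_of_parallel hP hp hq hx hy hcr h0.symm
    · exact hw.futaki_ne_zero_of_cross_ne hP hp hq hx hy hcr h0.symm
  have hpos : ∀ {w : ℝ × ℝ × ℝ} {c : ℝ}, 0 < c → P.IsHonest w →
      w = c • P.chordVec i j (x, y) → 0 < P.futaki (crease w) := by
    intro w c hc hw he
    have hw' : P.IsHonest (P.chordVec i j (x, y)) := by
      obtain ⟨⟨z, hz, hz0⟩, z', hz', hz0'⟩ := hw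
      rw [he, aff_smul] at hz0 hz0'
      exact ⟨⟨z, hz, by nlinarith⟩, z', hz', by nlinarith⟩
    have : crease w = fun z => c * crease (P.chordVec i j (x, y)) z := by
      ext z; rw [he, crease_smul hc.le]
    rw [this, futaki_const_mul]
    exact mul_pos hc (hchord hw' rfl)
  obtain ⟨c, hc⟩ := exists_eq_smul_lineVec hpq hp0 hq0
  rcases lt_trichotomy c 0 with h | h | h
  · rw [← P.futaki_crease_neg hP]
    exact hpos (neg_pos.2 h) hv.neg (by rw [hc, neg_smul]; rfl)
  · obtain ⟨⟨z, -, hz⟩, -⟩ := hv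
    rw [hc, h, zero_smul] at hz
    simp [aff] at hz
  · exact hpos h hv hc

end DelzantPolygon

/-! ### A uniform lower bound on creases -/

namespace DelzantPolygon

variable (P : DelzantPolygon)

lemma ae_area_aff_neg {v : ℝ × ℝ × ℝ} (hv : v ≠ 0) (hneg : ∀ z ∈ P.carrier, aff v z ≤ 0) :
    ∀ᵐ z ∂P.areaMeasure, aff v z < 0 := by
  have hne : ∀ᵐ z ∂P.areaMeasure, aff v z ≠ 0 := by
    by_cases h : v.1 ≠ 0 ∨ v.2.1 ≠ 0
    · exact ae_restrict_of_ae (measure_eq_zero_iff_ae_notMem.1 (volume_aff_eq_zero h))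
    · push Not at h
      refine Eventually.of_forall fun z hz => hv ?_
      simp only [aff, h.1, h.2, zero_mul, zero_add] at hz
      exact Prod.ext h.1 (Prod.ext h.2 hz)
  filter_upwards [hne, P.ae_area_mem] with z h1 h2
  exact lt_of_le_of_ne (hneg z h2) h1

/-- If `aff v ≤ 0` on the polygon, the area of `{aff w > 0}` tends to zero as `w → v`. -/
lemma tendsto_area_aff_pos {v : ℝ × ℝ × ℝ} (hv : v ≠ 0) (hneg : ∀ z ∈ P.carrier, aff v z ≤ 0) :
    Tendsto (fun w => ∫ z, {z | 0 < aff w z}.indicator (1 : ℝ × ℝ → ℝ) z ∂P.areaMeasure) (𝓝 v)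
      (𝓝 (0 : ℝ)) := by
  have hz : (0 : ℝ) = ∫ _z, (0 : ℝ) ∂P.areaMeasure := by simp
  rw [hz]
  refine tendsto_integral_filter_of_dominated_convergence (fun _ => 1) ?_ ?_
    (integrable_const _) ?_
  · refine Eventually.of_forall fun w => Measurable.aestronglyMeasurable ?_
    exact measurable_one.indicator (measurableSet_lt measurable_const (continuous_aff w).measurable)
  · refine Eventually.of_forall fun w => Eventually.of_forall fun z => ?_
    by_cases h : 0 < aff w z <;> simp [indicator, h]
  · filter_upwards [P.ae_area_aff_neg hv hneg] with z h
    have hc : Continuous fun w : ℝ × ℝ × ℝ => aff w z := by unfold aff; fun_prop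
    refine tendsto_const_nhds.congr' ?_
    filter_upwards [hc.continuousAt.eventually_lt_const h] with w hw
    simp [indicator, hw.not_gt]

/-- Near a nonzero affine function which is nonpositive on the polygon, the boundary term
dominates: the crease is supported on a set of small area. -/
lemma eventually_half_integral_le_futaki (hP : P.IsKPolystable) {v : ℝ × ℝ × ℝ} (hv : v ≠ 0)
    (hneg : ∀ z ∈ P.carrier, aff v z ≤ 0) :
    ∀ᶠ w in 𝓝 v, 1 / 2 * ∫ z, crease w z ∂P.boundaryMeasure ≤ P.futaki (crease w) := by
  obtain ⟨C, hC, hsq⟩ := P.exists_integral_sq_le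
  have ha := P.avgConst_pos
  set a := P.avgConst with ha'
  set τ : ℝ := 1 / (2 * a * C ^ 2) with hτ
  have hτ0 : 0 < τ := by positivity
  filter_upwards [(P.tendsto_area_aff_pos hv hneg).eventually_le_const
    (show (0 : ℝ) < τ ^ 2 * C ^ 2 by positivity)] with w hw
  set m := ∫ z, {z | 0 < aff w z}.indicator (1 : ℝ × ℝ → ℝ) z ∂P.areaMeasure with hm
  set A := ∫ z, crease w z ∂P.boundaryMeasure with hA
  have hA0 : 0 ≤ A := integral_nonneg fun z => crease_nonneg w z
  rcases hA0.eq_or_lt with h0 | h0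
  · rw [← h0, mul_zero]
    exact P.futaki_crease_nonneg hP w
  have hint := hsq (crease w) (continuous_crease w) (crease_nonneg w)
    (convexOn_crease _ P.convex_carrier w)
  have hmi : Integrable ({z | 0 < aff w z}.indicator (1 : ℝ × ℝ → ℝ)) P.areaMeasure :=
    (integrable_const (1 : ℝ)).indicator
      (measurableSet_lt measurable_const (continuous_aff w).measurable)
  have hsi : Integrable (fun z => crease w z ^ 2) P.areaMeasure :=
    P.integrable_area_of_continuous ((continuous_crease w).pow 2)
  -- the weighted arithmetic-geometric inequality `h ≤ (t h² + 1 / t) / 2` with `t = τ / A`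
  have key : ∫ z, crease w z ∂P.areaMeasure ≤
      ∫ z, (τ / A / 2 * crease w z ^ 2 + A / τ / 2 * {z | 0 < aff w z}.indicator (1 : ℝ × ℝ → ℝ) z)
        ∂P.areaMeasure := by
    refine integral_mono (P.integrable_area_of_continuous (continuous_crease w))
      ((hsi.const_mul _).add (hmi.const_mul _)) fun z => ?_
    by_cases h : 0 < aff w z
    · have e : {z | 0 < aff w z}.indicator (1 : ℝ × ℝ → ℝ) z = 1 := by simp [indicator, h]
      simp only [e]
      have : 0 ≤ (τ * crease w z - A) ^ 2 / (2 * A * τ) := by positivity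
      have e2 : τ / A / 2 * crease w z ^ 2 + A / τ / 2 * 1 - crease w z =
          (τ * crease w z - A) ^ 2 / (2 * A * τ) := by field_simp; ring
      linarith
    · have e : crease w z = 0 := max_eq_right (not_lt.1 h)
      have e' : {z | 0 < aff w z}.indicator (1 : ℝ × ℝ → ℝ) z = 0 := by simp [indicator, h]
      simp only [e, e']
      simp
  rw [integral_add (hsi.const_mul _) (hmi.const_mul _), integral_const_mul, integral_const_mul]
    at key
  have k1 : τ / A / 2 * ∫ z, crease w z ^ 2 ∂P.areaMeasure ≤ τ / A / 2 * (C * A) ^ 2 :=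
    mul_le_mul_of_nonneg_left hint (by positivity)
  have k2 : A / τ / 2 * m ≤ A / τ / 2 * (τ ^ 2 * C ^ 2) :=
    mul_le_mul_of_nonneg_left hw (by positivity)
  have k3 : τ / A / 2 * (C * A) ^ 2 + A / τ / 2 * (τ ^ 2 * C ^ 2) = A / (2 * a) := by
    rw [hτ]; field_simp; ring
  have k4 : ∫ z, crease w z ∂P.areaMeasure ≤ A / (2 * a) := by linarith
  have k5 : a * ∫ z, crease w z ∂P.areaMeasure ≤ a * (A / (2 * a)) :=
    mul_le_mul_of_nonneg_left k4 ha.le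
  have k6 : a * (A / (2 * a)) = A / 2 := by field_simp
  rw [futaki]
  linarith

/-- Creases are uniformly stable. The bound is invariant under `v ↦ -v` and homogeneous in `v`, so
it suffices to have it near each point of the unit sphere. -/
theorem exists_mul_min_le_futaki_crease (hP : P.IsKPolystable) : ∃ δ > 0, ∀ v,
    δ * min (∫ z, crease v z ∂P.boundaryMeasure) (∫ z, crease (-v) z ∂P.boundaryMeasure) ≤
      P.futaki (crease v) := by
  set m : ℝ × ℝ × ℝ → ℝ := fun v =>
    min (∫ z, crease v z ∂P.boundaryMeasure) (∫ z, crease (-v) z ∂P.boundaryMeasure) with hm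
  have hm0 : ∀ v, 0 ≤ m v := fun v =>
    le_min (integral_nonneg fun z => crease_nonneg v z) (integral_nonneg fun z => crease_nonneg _ z)
  have hmc : Continuous m := P.continuous_integral_boundary_crease.min
    (P.continuous_integral_boundary_crease.comp continuous_neg)
  have hmn : ∀ v, m (-v) = m v := fun v => by simp only [hm, neg_neg, min_comm]
  have hloc : ∀ v, v ≠ 0 → ∃ δ > 0, ∀ᶠ w in 𝓝 v, δ * m w ≤ P.futaki (crease w) := by
    intro v hv
    by_cases hneg : ∀ z ∈ P.carrier, aff v z ≤ 0
    · refine ⟨1 / 2, by norm_num, ?_⟩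
      filter_upwards [P.eventually_half_integral_le_futaki hP hv hneg] with w hw
      exact (mul_le_mul_of_nonneg_left (min_le_left _ _) (by norm_num)).trans hw
    by_cases hpos : ∀ z ∈ P.carrier, 0 ≤ aff v z
    · refine ⟨1 / 2, by norm_num, ?_⟩
      have hc : Tendsto (fun w : ℝ × ℝ × ℝ => -w) (𝓝 v) (𝓝 (-v)) := continuous_neg.tendsto v
      filter_upwards [hc.eventually (P.eventually_half_integral_le_futaki hP (neg_ne_zero.2 hv)
        fun z hz => by rw [aff_neg]; linarith [hpos z hz])] with w hw
      rw [P.futaki_crease_neg hP] at hw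
      exact (mul_le_mul_of_nonneg_left (min_le_right _ _) (by norm_num)).trans hw
    push Not at hneg hpos
    have hf : 0 < P.futaki (crease v) := IsHonest.futaki_pos hP ⟨hpos, hneg⟩
    have hm1 : 0 < m v + 1 := by linarith [hm0 v]
    refine ⟨P.futaki (crease v) / (m v + 1), by positivity, ?_⟩
    have hlt : P.futaki (crease v) / (m v + 1) * m v < P.futaki (crease v) := by
      rw [div_mul_eq_mul_div, div_lt_iff₀ hm1]
      nlinarith
    have := (hmc.const_mul (P.futaki (crease v) / (m v + 1))).continuousAt.eventually_lt
      P.continuous_futaki_crease.continuousAt hlt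
    filter_upwards [this] with w hw using hw.le
  obtain ⟨δ, hδ, h⟩ : ∃ δ > 0, ∀ w ∈ Metric.sphere (0 : ℝ × ℝ × ℝ) 1,
      δ * m w ≤ P.futaki (crease w) := by
    refine (isCompact_sphere (0 : ℝ × ℝ × ℝ) 1).induction_on
      (p := fun s => ∃ δ > 0, ∀ w ∈ s, δ * m w ≤ P.futaki (crease w)) ⟨1, one_pos, by simp⟩
      ?_ ?_ ?_
    · rintro s t hst ⟨δ, hδ, h⟩
      exact ⟨δ, hδ, fun w hw => h w (hst hw)⟩
    · rintro s t ⟨δ, hδ, h⟩ ⟨δ', hδ', h'⟩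
      refine ⟨min δ δ', lt_min hδ hδ', ?_⟩
      rintro w (hw | hw)
      · exact (mul_le_mul_of_nonneg_right (min_le_left _ _) (hm0 w)).trans (h w hw)
      · exact (mul_le_mul_of_nonneg_right (min_le_right _ _) (hm0 w)).trans (h' w hw)
    · intro v hv
      obtain ⟨δ, hδ, h⟩ := hloc v (by rintro rfl; simp at hv)
      exact ⟨_, mem_nhdsWithin_of_mem_nhds h, δ, hδ, fun w hw => hw⟩
  refine ⟨δ, hδ, fun v => ?_⟩
  rcases eq_or_ne v 0 with rfl | hv
  · have : ∀ z, crease 0 z = 0 := fun z => by simp [crease, aff]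
    have e : crease 0 = fun _ => 0 := funext this
    simp [e, futaki]
  have hr : 0 < ‖v‖ := norm_pos_iff.2 hv
  have hu := h (‖v‖⁻¹ • v) (by simp [norm_smul, hr.ne'])
  have hfe : P.futaki (crease (‖v‖⁻¹ • v)) = ‖v‖⁻¹ * P.futaki (crease v) := by
    rw [← P.futaki_const_mul]
    congr 1
    ext z
    rw [crease_smul (by positivity)]
  have hme : m (‖v‖⁻¹ • v) = ‖v‖⁻¹ * m v := by
    simp only [hm, ← smul_neg, crease_smul (inv_nonneg.2 hr.le), integral_const_mul]
    rw [mul_min_of_nonneg _ _ (inv_nonneg.2 hr.le)]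
  rw [hfe, hme] at hu
  have : ‖v‖⁻¹ * (δ * m v) ≤ ‖v‖⁻¹ * P.futaki (crease v) := by linarith
  exact le_of_mul_le_mul_left this (inv_pos.2 hr)

end DelzantPolygon

/-! ### Dominating a convex function by a sum of creases -/

/-- The barycentric coordinate of `b` with respect to the triangle `p`, `q`, `b`, as the
coefficients of an affine function. -/
noncomputable def baryVec (p q b : ℝ × ℝ) : ℝ × ℝ × ℝ :=
  (aff (lineVec p q) b)⁻¹ • lineVec p q

lemma aff_baryVec (p q b z : ℝ × ℝ) :
    aff (baryVec p q b) z = (aff (lineVec p q) b)⁻¹ * aff (lineVec p q) z := by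
  rw [baryVec, aff_smul]

@[simp] lemma aff_baryVec_fst (p q b : ℝ × ℝ) : aff (baryVec p q b) p = 0 := by
  simp [aff_baryVec]

@[simp] lemma aff_baryVec_snd (p q b : ℝ × ℝ) : aff (baryVec p q b) q = 0 := by
  simp [aff_baryVec]

lemma aff_baryVec_self {p q b : ℝ × ℝ} (h : aff (lineVec p q) b ≠ 0) :
    aff (baryVec p q b) b = 1 := by
  rw [aff_baryVec, inv_mul_cancel₀ h]

lemma aff_lineVec_rotate (p q b : ℝ × ℝ) : aff (lineVec q b) p = aff (lineVec p q) b := by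
  simp only [aff_lineVec]; ring

/-- An affine function is determined by its values on the vertices of a triangle. -/
lemma aff_eq_bary {p q b : ℝ × ℝ} (h : aff (lineVec p q) b ≠ 0) (v : ℝ × ℝ × ℝ) (z : ℝ × ℝ) :
    aff v z = aff (baryVec q b p) z * aff v p + aff (baryVec b p q) z * aff v q +
      aff (baryVec p q b) z * aff v b := by
  simp only [aff_baryVec, aff_lineVec_rotate]
  field_simp
  simp only [aff_lineVec]
  simp only [aff]
  ring

/-- The functions that are finite sums of creases. -/
def creaseSums : AddSubmonoid (ℝ × ℝ → ℝ) := AddSubmonoid.closure (range crease)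

lemma creaseSums_nonneg {u : ℝ × ℝ → ℝ} (hu : u ∈ creaseSums) (z : ℝ × ℝ) : 0 ≤ u z := by
  induction hu using AddSubmonoid.closure_induction with
  | mem u hu =>
    obtain ⟨v, rfl⟩ := hu
    exact crease_nonneg v z
  | zero => exact le_rfl
  | add u w _ _ h1 h2 => exact add_nonneg h1 h2

lemma continuous_of_mem_creaseSums {u : ℝ × ℝ → ℝ} (hu : u ∈ creaseSums) : Continuous u := by
  induction hu using AddSubmonoid.closure_induction with
  | mem u hu =>
    obtain ⟨v, rfl⟩ := hu
    exact continuous_crease v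
  | zero => exact continuous_const
  | add u w _ _ h1 h2 => exact h1.add h2

namespace DelzantPolygon

variable (P : DelzantPolygon)

/-- `z` is a boundary point of the polygon. -/
def IsBdry (z : ℝ × ℝ) : Prop := z ∈ P.carrier ∧ ∃ k, P.ldist k z = 0

/-- On the part `{aff v > 0}` of the polygon, the sum of creases `u` lies above `f`, but below it
at the nodes `B`; on the rest of the polygon `u` vanishes. -/
structure IsCreaseApprox (B : Finset (ℝ × ℝ)) (v : ℝ × ℝ × ℝ) (f u : ℝ × ℝ → ℝ) : Prop where
  mem : u ∈ creaseSums
  eq_zero : ∀ z ∈ P.carrier, aff v z ≤ 0 → u z = 0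
  le_node : ∀ b ∈ B, 0 < aff v b → u b ≤ f b
  ge : ∀ z ∈ P.carrier, 0 < aff v z → f z ≤ u z

lemma ldist_eq_bary {p q b : ℝ × ℝ} (h : aff (lineVec p q) b ≠ 0) (k : Fin P.numEdges)
    (z : ℝ × ℝ) : P.ldist k z = aff (baryVec q b p) z * P.ldist k p +
      aff (baryVec b p q) z * P.ldist k q + aff (baryVec p q b) z * P.ldist k b := by
  simp only [← aff_ldistVec]
  exact aff_eq_bary h _ z

lemma not_ldist_eq_zero {p q b : ℝ × ℝ} (h : aff (lineVec p q) b ≠ 0) {k : Fin P.numEdges}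
    (hp : P.ldist k p = 0) (hq : P.ldist k q = 0) : P.ldist k b ≠ 0 := by
  intro hb
  have hz : ∀ z, aff (P.ldistVec k) z = 0 := fun z => by
    rw [aff_ldistVec, P.ldist_eq_bary h, hp, hq, hb]; ring
  have h0 := hz (0, 0)
  have h1 := hz (1, 0)
  have h2 := hz (0, 1)
  simp only [aff] at h0 h1 h2
  rcases P.ldistVec_ne k with h | h <;> apply h <;> linarith

/-- The sector opposite to a boundary vertex of a triangle contains no points of the polygon. -/
lemma bary_not_both_neg {p q b z : ℝ × ℝ} (h : aff (lineVec p q) b ≠ 0) (hp : p ∈ P.carrier)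
    (hq : q ∈ P.carrier) (hb : P.IsBdry b) (hz : z ∈ P.carrier)
    (h1 : aff (baryVec q b p) z < 0) (h2 : aff (baryVec b p q) z < 0) : False := by
  obtain ⟨-, k, hk⟩ := hb
  have e := P.ldist_eq_bary h k z
  have hp' := P.mem_carrier_iff.1 hp k
  have hq' := P.mem_carrier_iff.1 hq k
  have hz' := P.mem_carrier_iff.1 hz k
  rw [hk, mul_zero, add_zero] at e
  have e1 : P.ldist k p = 0 := by nlinarith [mul_nonneg (neg_nonneg.2 h2.le) hq']
  have e2 : P.ldist k q = 0 := by nlinarith [mul_nonneg (neg_nonneg.2 h1.le) hp']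
  exact P.not_ldist_eq_zero h e1 e2 hk

variable {P}

/-- Gluing along the sides `b p` and `b q` of a triangle with vertices on the boundary. -/
lemma IsCreaseApprox.triangle {B : Finset (ℝ × ℝ)} {p q b : ℝ × ℝ} {f u₁ u₂ : ℝ × ℝ → ℝ}
    (hB : ∀ c ∈ B, c ∈ P.carrier) (h : aff (lineVec p q) b ≠ 0) (hp : p ∈ P.carrier)
    (hq : q ∈ P.carrier) (hb : P.IsBdry b) (hf : ConvexOn ℝ P.carrier f) (hfp : f p ≤ 0)
    (hfq : f q ≤ 0) (hfb : f b ≤ 0) (h₁ : P.IsCreaseApprox B (-baryVec b p q) f u₁)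
    (h₂ : P.IsCreaseApprox B (-baryVec q b p) f u₂) :
    (∀ c ∈ B, 0 ≤ f c → (u₁ + u₂) c ≤ f c) ∧
    (∀ z ∈ P.carrier, 0 ≤ aff (baryVec p q b) z → f z ≤ (u₁ + u₂) z) ∧
    (∀ z ∈ P.carrier, 0 ≤ aff (baryVec q b p) z → 0 ≤ aff (baryVec b p q) z →
      (u₁ + u₂) z = 0) := by
  have hz : ∀ z ∈ P.carrier, 0 ≤ aff (baryVec q b p) z → 0 ≤ aff (baryVec b p q) z →
      (u₁ + u₂) z = 0 := fun z hz ha hb => by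
    rw [Pi.add_apply, h₁.eq_zero z hz (by rw [aff_neg]; linarith),
      h₂.eq_zero z hz (by rw [aff_neg]; linarith), add_zero]
  refine ⟨fun c hc h0 => ?_, fun z hzP hzb => ?_, hz⟩
  · rcases lt_or_ge (aff (baryVec b p q) c) 0 with h1 | h1
    · have h2 : 0 ≤ aff (baryVec q b p) c := by
        by_contra! h2
        exact P.bary_not_both_neg h hp hq hb (hB c hc) h2 h1
      rw [Pi.add_apply, h₂.eq_zero c (hB c hc) (by rw [aff_neg]; linarith), add_zero]
      exact h₁.le_node c hc (by rw [aff_neg]; linarith)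
    rcases lt_or_ge (aff (baryVec q b p) c) 0 with h2 | h2
    · rw [Pi.add_apply, h₁.eq_zero c (hB c hc) (by rw [aff_neg]; linarith), zero_add]
      exact h₂.le_node c hc (by rw [aff_neg]; linarith)
    · rw [hz c (hB c hc) h2 h1]; exact h0
  · rcases lt_or_ge (aff (baryVec b p q) z) 0 with h1 | h1
    · have := h₁.ge z hzP (by rw [aff_neg]; linarith)
      have := creaseSums_nonneg h₂.mem z
      rw [Pi.add_apply]; linarith
    rcases lt_or_ge (aff (baryVec q b p) z) 0 with h2 | h2
    · have := h₂.ge z hzP (by rw [aff_neg]; linarith)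
      have := creaseSums_nonneg h₁.mem z
      rw [Pi.add_apply]; linarith
    · rw [hz z hzP h2 h1]
      have hmem := (hf.convex_le 0).sum_mem (t := (Finset.univ : Finset (Fin 3)))
        (w := ![aff (baryVec q b p) z, aff (baryVec b p q) z, aff (baryVec p q b) z])
        (z := ![p, q, b]) (by
          intro i _; fin_cases i <;> assumption) (by
          have := aff_eq_bary h (0, 0, 1) z
          rw [Fin.sum_univ_three]
          simp only [aff, zero_mul, zero_add, mul_one] at this
          exact this.symm) (by
          intro i _
          fin_cases i
          · exact ⟨hp, hfp⟩
          · exact ⟨hq, hfq⟩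
          · exact ⟨hb.1, hfb⟩)
      have e : z = ∑ i : Fin 3, ![aff (baryVec q b p) z, aff (baryVec b p q) z,
          aff (baryVec p q b) z] i • (![p, q, b] : Fin 3 → ℝ × ℝ) i := by
        rw [Fin.sum_univ_three]
        have e1 := aff_eq_bary h (1, 0, 0) z
        have e2 := aff_eq_bary h (0, 1, 0) z
        simp only [aff, one_mul, zero_mul, add_zero, zero_add] at e1 e2
        exact Prod.ext e1 e2
      rw [← e] at hmem
      exact hmem.2

/-- On the part `{aff v > 0}` cut off by a chord with end points `p` and `q`, a convex function
which is nonpositive at `p` and `q` has an approximation by creases. The first crease is the largest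
multiple of `aff v` lying below `f` at the nodes; it touches `f` at a node `b`, and the chords
`b p` and `b q` cut off fewer nodes. -/
lemma exists_isCreaseApprox {B : Finset (ℝ × ℝ)} (hB : ∀ b ∈ B, P.IsBdry b)
    (hconv : P.carrier ⊆ convexHull ℝ (B : Set (ℝ × ℝ))) {f : ℝ × ℝ → ℝ} {p q : ℝ × ℝ}
    {v : ℝ × ℝ × ℝ} (hf : ConvexOn ℝ P.carrier f) (hp : P.IsBdry p) (hq : P.IsBdry q)
    (hpq : p ≠ q) (hvp : aff v p = 0) (hvq : aff v q = 0) (hneg : ∃ z ∈ P.carrier, aff v z < 0)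
    (hfp : f p ≤ 0) (hfq : f q ≤ 0) (hfB : ∀ b ∈ B, 0 < aff v b → 0 ≤ f b) :
    ∃ u, P.IsCreaseApprox B v f u := by
  classical
  induction hn : (B.filter fun b => 0 < aff v b).card using Nat.strong_induction_on
    generalizing f p q v with
  | _ n ih =>
  rcases (B.filter fun b => 0 < aff v b).eq_empty_or_nonempty with he | hne
  · have hle : ∀ z ∈ P.carrier, aff v z ≤ 0 := by
      have hc : Convex ℝ {z | aff v z ≤ 0} := by
        simpa using (convexOn_aff univ convex_univ v).convex_le 0
      refine fun z hz => convexHull_min ?_ hc (hconv hz)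
      intro b hb
      by_contra hcon
      exact Finset.notMem_empty b (he ▸ Finset.mem_filter.2 ⟨hb, not_le.1 hcon⟩)
    exact ⟨0, zero_mem _, fun _ _ _ => rfl,
      fun b hb h => absurd h (hle b (hB b hb).1).not_gt,
      fun z hz h => absurd h (hle z hz).not_gt⟩
  obtain ⟨b, hb, hmin⟩ := Finset.exists_min_image _ (fun b => f b / aff v b) hne
  simp only [Finset.mem_filter] at hb hmin
  obtain ⟨hbB, hvb⟩ := hb
  have hbP := hB b hbB
  set c := f b / aff v b with hc
  have hc0 : 0 ≤ c := div_nonneg (hfB b hbB hvb) hvb.le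
  have hv : P.IsHonest v := ⟨hneg, b, hbP.1, hvb⟩
  have hD : aff (lineVec p q) b ≠ 0 := by
    obtain ⟨r, hr⟩ := exists_eq_smul_lineVec hpq hvp hvq
    intro h
    rw [hr, aff_smul, h, mul_zero] at hvb
    exact lt_irrefl _ hvb
  have hbp : b ≠ p := by rintro rfl; linarith
  have hbq : q ≠ b := by rintro rfl; linarith
  have hval : ∀ z, aff v z = aff (baryVec p q b) z * aff v b := fun z => by
    have := aff_eq_bary hD v z
    rw [hvp, hvq] at this
    linarith
  set g : ℝ × ℝ → ℝ := fun z => f z + aff ((-c) • v) z with hg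
  have hgv : ∀ z, g z = f z - c * aff v z := fun z => by
    rw [hg]; simp only; rw [aff_smul]; ring
  have hgc : ConvexOn ℝ P.carrier g := hf.add (convexOn_aff _ P.convex_carrier _)
  have hgp : g p ≤ 0 := by rw [hgv, hvp]; linarith
  have hgq : g q ≤ 0 := by rw [hgv, hvq]; linarith
  have hgb : g b ≤ 0 := by
    rw [hgv, hc, div_mul_cancel₀ _ hvb.ne', sub_self]
  have hgB : ∀ d ∈ B, 0 < aff v d → 0 ≤ g d := fun d hd h => by
    have := hmin d ⟨hd, h⟩
    rw [le_div_iff₀ h] at this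
    rw [hgv]; linarith
  -- on the far side of the chord the two other barycentric coordinates are nonnegative
  have hsep : ∀ z ∈ P.carrier, aff v z ≤ 0 →
      0 ≤ aff (baryVec b p q) z ∧ 0 ≤ aff (baryVec q b p) z := by
    intro z hz hvz
    have hAb : aff (baryVec p q b) z ≤ 0 := by
      rw [hval z] at hvz
      by_contra! h
      exact absurd hvz (mul_pos h hvb).not_ge
    have aux : ∀ k (s t A : ℝ), P.ldist k z = s * t + A * P.ldist k b → A ≤ 0 → 0 < t → 0 ≤ s := by
      intro k s t A e hA ht
      have h1 := P.mem_carrier_iff.1 hz k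
      have h2 := P.mem_carrier_iff.1 hbP.1 k
      by_contra! hs
      nlinarith [mul_nonneg (neg_nonneg.2 hA) h2, mul_pos (neg_pos.2 hs) ht]
    constructor
    · obtain ⟨k, hk⟩ := hp.2
      have e := P.ldist_eq_bary hD k z
      rw [hk, mul_zero, zero_add] at e
      refine aux k _ _ _ e hAb (lt_of_le_of_ne (P.mem_carrier_iff.1 hq.1 k) fun h => ?_)
      exact P.not_isHonest_of_ldist hv hpq hvp hvq hk h.symm
    · obtain ⟨k, hk⟩ := hq.2
      have e := P.ldist_eq_bary hD k z
      rw [hk, mul_zero, add_zero] at e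
      refine aux k _ _ _ e hAb (lt_of_le_of_ne (P.mem_carrier_iff.1 hp.1 k) fun h => ?_)
      exact P.not_isHonest_of_ldist hv hpq hvp hvq h.symm hk
  have hsub : ∀ w : ℝ × ℝ × ℝ, (∀ z ∈ P.carrier, aff v z ≤ 0 → aff w z ≤ 0) → aff w b = 0 →
      (B.filter fun d => 0 < aff w d).card < n ∧ ∀ d ∈ B, 0 < aff w d → 0 ≤ g d := by
    intro w hw hwb
    have hpos : ∀ d ∈ B, 0 < aff w d → 0 < aff v d := fun d hd h => by
      by_contra! hcon
      exact absurd h (hw d (hB d hd).1 hcon).not_gt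
    refine ⟨?_, fun d hd h => hgB d hd (hpos d hd h)⟩
    rw [← hn]
    refine Finset.card_lt_card ⟨fun d hd => ?_, fun hcon => ?_⟩
    · rw [Finset.mem_filter] at hd ⊢
      exact ⟨hd.1, hpos d hd.1 hd.2⟩
    · have := hcon (Finset.mem_filter.2 ⟨hbB, hvb⟩)
      rw [Finset.mem_filter, hwb] at this
      exact lt_irrefl _ this.2
  have hD₁ : aff (lineVec b p) q ≠ 0 := by rwa [← aff_lineVec_rotate]
  have hD₂ : aff (lineVec q b) p ≠ 0 := by rwa [aff_lineVec_rotate]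
  obtain ⟨s₁, t₁⟩ := hsub (-baryVec b p q)
    (fun z hz h => by rw [aff_neg]; linarith [(hsep z hz h).1]) (by simp [aff_neg])
  obtain ⟨s₂, t₂⟩ := hsub (-baryVec q b p)
    (fun z hz h => by rw [aff_neg]; linarith [(hsep z hz h).2]) (by simp [aff_neg])
  obtain ⟨u₁, hu₁⟩ := ih _ s₁ hgc hbP hp hbp (by simp [aff_neg]) (by simp [aff_neg])
    ⟨q, hq.1, by rw [aff_neg, aff_baryVec_self hD₁]; norm_num⟩ hgb hgp t₁ rfl
  obtain ⟨u₂, hu₂⟩ := ih _ s₂ hgc hq hbP hbq (by simp [aff_neg]) (by simp [aff_neg])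
    ⟨p, hp.1, by rw [aff_neg, aff_baryVec_self hD₂]; norm_num⟩ hgq hgb t₂ rfl
  obtain ⟨k1, k2, k3⟩ := hu₁.triangle (fun c hc => (hB c hc).1) hD hp.1 hq.1 hbP hgc hgp hgq hgb hu₂
  have hcr : ∀ z, 0 < aff v z → crease (c • v) z = c * aff v z := fun z hz => by
    rw [crease_smul hc0, crease, max_eq_left hz.le]
  refine ⟨crease (c • v) + (u₁ + u₂), ?_, fun z hz h => ?_, fun d hd h => ?_, fun z hz h => ?_⟩
  · exact add_mem (AddSubmonoid.subset_closure ⟨_, rfl⟩) (add_mem hu₁.mem hu₂.mem)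
  · obtain ⟨h1, h2⟩ := hsep z hz h
    rw [Pi.add_apply, k3 z hz h2 h1, crease_smul hc0, crease, max_eq_right h]
    simp
  · have := k1 d hd (hgB d hd h)
    rw [hgv] at this
    rw [Pi.add_apply, hcr d h]
    linarith
  · have := k2 z hz (by
      rw [hval z] at h
      exact ((pos_iff_pos_of_mul_pos h).2 hvb).le)
    rw [hgv] at this
    rw [Pi.add_apply, hcr z h]
    linarith

end DelzantPolygon

namespace DelzantPolygon

variable (P : DelzantPolygon)

lemma ldist_pos_of_mem_interior {o : ℝ × ℝ} (ho : o ∈ interior P.carrier)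
    (k : Fin P.numEdges) : 0 < P.ldist k o := by
  have hn := P.normSq_pos k
  set d : ℝ × ℝ := (-((P.h k).1 : ℝ), -((P.h k).2 : ℝ)) with hd
  have hd0 : d ≠ 0 := by
    intro h
    have h1 := congrArg Prod.fst h
    have h2 := congrArg Prod.snd h
    simp only [hd, Prod.fst_zero, Prod.snd_zero, neg_eq_zero] at h1 h2
    rw [h1, h2] at hn
    norm_num at hn
  obtain ⟨t, ht, hmem, -⟩ := P.exists_exit ho hd0
  have h1 := P.mem_carrier_iff.1 hmem k
  have e : P.ldist k (o + t • d) =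
      P.ldist k o - t * (((P.h k).1 : ℝ) ^ 2 + ((P.h k).2 : ℝ) ^ 2) := by
    simp only [ldist, hd, Prod.fst_add, Prod.snd_add, Prod.smul_fst, Prod.smul_snd, smul_eq_mul]
    ring
  nlinarith [mul_pos ht hn]

/-- The polygon is the convex hull of its vertices. -/
lemma carrier_subset_convexHull {B : Set (ℝ × ℝ)} (hlo : ∀ k, P.edgeLine k (P.lo k) ∈ B)
    (hhi : ∀ k, P.edgeLine k (P.hi k) ∈ B) : P.carrier ⊆ convexHull ℝ B := by
  have hc := convex_convexHull ℝ B
  have hbd : ∀ z ∈ P.carrier, (∃ k, P.ldist k z = 0) → z ∈ convexHull ℝ B := by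
    rintro z hz ⟨k, hk⟩
    have hmem : z ∈ P.edge k := P.mem_edge_iff.2 ⟨hz, hk⟩
    rw [edge_eq_image] at hmem
    obtain ⟨t, ht, rfl⟩ := hmem
    have hl : 0 < P.hi k - P.lo k := sub_pos.2 (P.lo_lt_hi k)
    have e : t = (P.hi k - t) / (P.hi k - P.lo k) * P.lo k +
        (t - P.lo k) / (P.hi k - P.lo k) * P.hi k := by field_simp; ring
    have hs : (P.hi k - t) / (P.hi k - P.lo k) + (t - P.lo k) / (P.hi k - P.lo k) = 1 := by
      field_simp; ring
    rw [e, P.edgeLine_combo k hs]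
    exact hc (subset_convexHull ℝ B (hlo k)) (subset_convexHull ℝ B (hhi k))
      (div_nonneg (sub_nonneg.2 ht.2) hl.le) (div_nonneg (sub_nonneg.2 ht.1) hl.le) hs
  obtain ⟨o, ho⟩ := P.interior_carrier_nonempty
  have hray : ∀ d : ℝ × ℝ, d ≠ 0 → o + d ∈ P.carrier → o ∈ convexHull ℝ B →
      o + d ∈ convexHull ℝ B := by
    intro d hd hmem hoB
    obtain ⟨t, ht, hmt, k, hk⟩ := P.exists_exit ho hd
    have h1t : 1 ≤ t := by
      by_contra! hlt
      have e : o + t • d = t • (o + d) + (1 - t) • o := by module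
      rw [e] at hk
      exact (P.ldist_pos_of_mem_interior ho k).ne'
        (P.ldist_eq_zero_of_between hmem (interior_subset ho) ht hlt hk).2
    have e : o + d = (1 / t) • (o + t • d) + (1 - 1 / t) • o := by
      rw [smul_add, smul_smul, one_div_mul_cancel ht.ne', sub_smul]
      module
    rw [e]
    exact hc (hbd _ hmt ⟨k, hk⟩) hoB (by positivity)
      (sub_nonneg.2 ((div_le_one ht).2 h1t)) (by ring)
  have hoB : o ∈ convexHull ℝ B := by
    obtain ⟨t, ht, hmt, hk⟩ := P.exists_exit ho (d := ((1 : ℝ), (0 : ℝ))) (by simp)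
    obtain ⟨s, hs, hms, hl⟩ := P.exists_exit ho (d := ((-1 : ℝ), (0 : ℝ))) (by simp)
    have e : o = (s / (s + t)) • (o + t • ((1 : ℝ), (0 : ℝ))) +
        (t / (s + t)) • (o + s • ((-1 : ℝ), (0 : ℝ))) := by
      ext
      · simp; field_simp; ring
      · simp; field_simp
    rw [e]
    exact hc (hbd _ hmt hk) (hbd _ hms hl) (by positivity) (by positivity) (by field_simp)
  intro z hz
  rcases eq_or_ne z o with rfl | hne
  · exact hoB
  · have := hray (z - o) (sub_ne_zero.2 hne) (by rwa [add_sub_cancel]) hoB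
    rwa [add_sub_cancel] at this

/-- A convex function on the polygon lies below the sum of an affine function and finitely many
creases which does not exceed it at given boundary points. The affine function interpolates at two
neighbouring nodes on an edge and is as large as the values at the other nodes permit. -/
theorem exists_aff_add_creaseSum {B : Finset (ℝ × ℝ)} (hB : ∀ b ∈ B, P.IsBdry b)
    (hlo : ∀ k, P.edgeLine k (P.lo k) ∈ B) (hhi : ∀ k, P.edgeLine k (P.hi k) ∈ B)
    {f : ℝ × ℝ → ℝ} (hf : ConvexOn ℝ P.carrier f) :
    ∃ l, ∃ u ∈ creaseSums, (∀ z ∈ P.carrier, f z ≤ aff l z + u z) ∧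
      ∀ b ∈ B, aff l b + u b ≤ f b := by
  classical
  have hconv := P.carrier_subset_convexHull (B := (B : Set (ℝ × ℝ))) hlo hhi
  let k : Fin P.numEdges := ⟨0, P.numEdges_pos⟩
  have hinj := (P.isClosedEmbedding_edgeLine k).injective
  -- `q` is the node on the edge next to the end point `p`
  have hfin : (P.edgeLine k ⁻¹' B ∩ Ioi (P.lo k)).Finite :=
    ((B.finite_toSet).preimage hinj.injOn).subset inter_subset_left
  obtain ⟨t₁, ⟨ht₁B, ht₁⟩, hmin⟩ := exists_min_image _ id hfin ⟨P.hi k, hhi k, P.lo_lt_hi k⟩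
  simp only [mem_inter_iff, mem_preimage, mem_Ioi, id] at ht₁ hmin
  set p := P.edgeLine k (P.lo k) with hp
  set q := P.edgeLine k t₁ with hq
  have hpq : p ≠ q := fun h => ht₁.ne (hinj h)
  have hpk : P.ldist k p = 0 := P.ldist_edgeLine_self k _
  have hqk : P.ldist k q = 0 := P.ldist_edgeLine_self k _
  have hpB := hB p (hlo k)
  have hqB := hB q ht₁B
  obtain ⟨r, hr⟩ := exists_eq_smul_lineVec (v := P.ldistVec k) hpq (by rw [aff_ldistVec, hpk])
    (by rw [aff_ldistVec, hqk])
  have hdet : ∀ b, 0 < P.ldist k b → aff (lineVec p q) b ≠ 0 := by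
    intro b hb h
    rw [← aff_ldistVec, hr, aff_smul, h, mul_zero] at hb
    exact lt_irrefl _ hb
  obtain ⟨b₁, hb₁B, hb₁⟩ : ∃ b ∈ B, 0 < P.ldist k b := by
    by_contra! hcon
    obtain ⟨o, ho⟩ := P.interior_carrier_nonempty
    have hc : Convex ℝ {z | aff (P.ldistVec k) z ≤ 0} := by
      simpa using (convexOn_aff univ convex_univ (P.ldistVec k)).convex_le 0
    have := convexHull_min (fun b hb => by
      rw [mem_ofPred_eq, aff_ldistVec]; exact hcon b hb) hc (hconv (interior_subset ho))
    rw [mem_ofPred_eq, aff_ldistVec] at this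
    exact absurd (P.ldist_pos_of_mem_interior ho k) this.not_gt
  set w := f p • baryVec q b₁ p + f q • baryVec b₁ p q with hw
  have hD₁ := hdet b₁ hb₁
  have hwp : aff w p = f p := by
    rw [hw, aff_add, aff_smul, aff_smul, aff_baryVec_snd,
      aff_baryVec_self (by rwa [aff_lineVec_rotate])]
    ring
  have hwq : aff w q = f q := by
    rw [hw, aff_add, aff_smul, aff_smul, aff_baryVec_fst,
      aff_baryVec_self (by rwa [← aff_lineVec_rotate])]
    ring
  obtain ⟨b, hb, hbmin⟩ := Finset.exists_min_image (B.filter fun b => 0 < P.ldist k b)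
    (fun b => (f b - aff w b) / P.ldist k b) ⟨b₁, Finset.mem_filter.2 ⟨hb₁B, hb₁⟩⟩
  simp only [Finset.mem_filter] at hb hbmin
  obtain ⟨hbB, hbk⟩ := hb
  have hbP := hB b hbB
  set c := (f b - aff w b) / P.ldist k b with hc
  set l := w + c • P.ldistVec k with hl
  have haffl : ∀ z, aff l z = aff w z + c * P.ldist k z := fun z => by
    rw [hl, aff_add, aff_smul, aff_ldistVec]
  set g : ℝ × ℝ → ℝ := fun z => f z + aff (-l) z with hg
  have hgl : ∀ z, g z = f z - aff l z := fun z => by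
    rw [hg]; simp only; rw [aff_neg]; ring
  have hgc : ConvexOn ℝ P.carrier g := hf.add (convexOn_aff _ P.convex_carrier _)
  have hgp : g p = 0 := by rw [hgl, haffl, hwp, hpk]; ring
  have hgq : g q = 0 := by rw [hgl, haffl, hwq, hqk]; ring
  have hgb : g b = 0 := by rw [hgl, haffl, hc, div_mul_cancel₀ _ hbk.ne']; ring
  have hgB : ∀ d ∈ B, 0 ≤ g d := by
    intro d hd
    have hdP := hB d hd
    rcases (P.mem_carrier_iff.1 hdP.1 k).eq_or_lt with h0 | h0
    · obtain ⟨t, rfl⟩ := P.exists_edgeLine_eq h0.symm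
      have ht := P.edgeLine_mem_carrier_iff.1 hdP.1
      rcases ht.1.eq_or_lt with hlt | hlt
      · rw [← hlt, ← hp, hgp]
      have h1t := hmin t ⟨hd, hlt⟩
      have hs : (t - t₁) / (t - P.lo k) + (t₁ - P.lo k) / (t - P.lo k) = 1 := by
        have : t - P.lo k ≠ 0 := by linarith
        field_simp; ring
      have hpos : 0 < (t₁ - P.lo k) / (t - P.lo k) := div_pos (by linarith) (by linarith)
      have e : q = ((t - t₁) / (t - P.lo k)) • p +
          ((t₁ - P.lo k) / (t - P.lo k)) • P.edgeLine k t := by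
        rw [hq, hp, ← P.edgeLine_combo k hs]
        congr 1
        have : t - P.lo k ≠ 0 := by linarith
        field_simp; ring
      have hcx := hgc.2 hpB.1 hdP.1
        (div_nonneg (by linarith : (0 : ℝ) ≤ t - t₁) (by linarith : (0 : ℝ) ≤ t - P.lo k)) hpos.le hs
      rw [← e, hgq, hgp, smul_zero, zero_add, smul_eq_mul] at hcx
      by_contra! hneg
      nlinarith
    · have := hbmin d ⟨hd, h0⟩
      rw [le_div_iff₀ h0] at this
      rw [hgl, haffl]; linarith
  have hD := hdet b hbk
  have hbp : b ≠ p := by rintro h; rw [h, hpk] at hbk; exact lt_irrefl _ hbk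
  have hqb : q ≠ b := by rintro h; rw [← h, hqk] at hbk; exact lt_irrefl _ hbk
  obtain ⟨u₁, hu₁⟩ := exists_isCreaseApprox (v := -baryVec b p q) hB hconv hgc hbP hpB hbp
    (by simp [aff_neg]) (by simp [aff_neg])
    ⟨q, hqB.1, by rw [aff_neg, aff_baryVec_self (by rwa [← aff_lineVec_rotate])]; norm_num⟩
    hgb.le hgp.le fun d hd _ => hgB d hd
  obtain ⟨u₂, hu₂⟩ := exists_isCreaseApprox (v := -baryVec q b p) hB hconv hgc hqB hbP hqb
    (by simp [aff_neg]) (by simp [aff_neg])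
    ⟨p, hpB.1, by rw [aff_neg, aff_baryVec_self (by rwa [aff_lineVec_rotate])]; norm_num⟩
    hgq.le hgb.le fun d hd _ => hgB d hd
  obtain ⟨k1, k2, -⟩ := hu₁.triangle (fun c hc => (hB c hc).1) hD hpB.1 hqB.1 hbP hgc hgp.le
    hgq.le hgb.le hu₂
  refine ⟨l, u₁ + u₂, add_mem hu₁.mem hu₂.mem, fun z hz => ?_, fun d hd => ?_⟩
  · have := k2 z hz (by
      have e := P.ldist_eq_bary hD k z
      rw [hpk, hqk, mul_zero, mul_zero, zero_add, zero_add] at e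
      have h0 := P.mem_carrier_iff.1 hz k
      by_contra! hneg
      nlinarith)
    rw [hgl] at this
    linarith
  · have := k1 d hd (hgB d hd)
    rw [hgl] at this
    linarith

end DelzantPolygon

/-! ### Convex functions on the polygon -/

/-- Convex functions which dominate a convex function `φ` on an interval and do not exceed it at
equidistant nodes converge to `φ` in mean. -/
lemma tendsto_setIntegral_of_le_nodes {φ : ℝ → ℝ} {lo hi M : ℝ} (hlt : lo < hi)
    (hφ : ConvexOn ℝ (Icc lo hi) φ) (hM : ∀ t ∈ Icc lo hi, |φ t| ≤ M) {G : ℕ → ℝ → ℝ}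
    (hGc : ∀ n, Continuous (G n)) (hG : ∀ n, ConvexOn ℝ (Icc lo hi) (G n))
    (hle : ∀ n, ∀ t ∈ Icc lo hi, φ t ≤ G n t)
    (hnode : ∀ n i : ℕ, i ≤ n + 1 → G n (lo + (hi - lo) * (i / (n + 1))) ≤
      φ (lo + (hi - lo) * (i / (n + 1)))) :
    Tendsto (fun n => ∫ t in Icc lo hi, G n t) atTop (𝓝 (∫ t in Icc lo hi, φ t)) := by
  have hl : 0 < hi - lo := sub_pos.2 hlt
  have hnode0 : ∀ n, G n lo ≤ φ lo := fun n => by simpa using hnode n 0 (Nat.zero_le _)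
  have hnode1 : ∀ n, G n hi ≤ φ hi := fun n => by
    have := hnode n (n + 1) le_rfl
    rwa [Nat.cast_add, Nat.cast_one, div_self (by positivity), mul_one, add_sub_cancel] at this
  have hmlo : lo ∈ Icc lo hi := left_mem_Icc.2 hlt.le
  have hmhi : hi ∈ Icc lo hi := right_mem_Icc.2 hlt.le
  refine tendsto_integral_of_dominated_convergence (fun _ => M)
    (fun n => (hGc n).aestronglyMeasurable) (integrable_const _) (fun n => ?_) ?_
  · refine (ae_restrict_iff' measurableSet_Icc).2 (Eventually.of_forall fun t ht => ?_)
    have h1 := (hG n).le_max_of_mem_Icc hmlo hmhi ht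
    have h2 := max_le ((hnode0 n).trans (le_of_abs_le (hM lo hmlo)))
      ((hnode1 n).trans (le_of_abs_le (hM hi hmhi)))
    exact abs_le.2 ⟨(neg_le_of_abs_le (hM t ht)).trans (hle n t ht), h1.trans h2⟩
  rw [← restrict_Ioo_eq_restrict_Icc]
  refine (ae_restrict_iff' measurableSet_Ioo).2 (Eventually.of_forall fun t ht => ?_)
  have hcont : ContinuousAt φ t := by
    have := hφ.continuousOn_interior
    rw [interior_Icc] at this
    exact this.continuousAt (Ioo_mem_nhds ht.1 ht.2)
  rw [Metric.tendsto_atTop]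
  intro ε hε
  obtain ⟨δ, hδ, hφδ⟩ := Metric.continuousAt_iff.1 hcont ε hε
  obtain ⟨N, hN⟩ := exists_nat_gt ((hi - lo) / δ)
  refine ⟨N, fun n hn => ?_⟩
  have hn1 : (0 : ℝ) < n + 1 := by positivity
  have hmesh : (hi - lo) / (n + 1) < δ := by
    rw [div_lt_iff₀ hδ] at hN
    rw [div_lt_iff₀ hn1]
    have : (N : ℝ) ≤ n := by exact_mod_cast hn
    nlinarith
  -- `t` lies between the nodes number `i` and `i + 1`
  set y : ℝ := (t - lo) / (hi - lo) * (n + 1) with hy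
  have hy0 : 0 ≤ y := mul_nonneg (div_nonneg (sub_nonneg.2 ht.1.le) hl.le) hn1.le
  have hyn : y < n + 1 := by
    have : (t - lo) / (hi - lo) < 1 := (div_lt_one hl).2 (by linarith [ht.2])
    nlinarith
  set i := ⌊y⌋₊ with hi'
  have hi1 : (i : ℝ) ≤ y := Nat.floor_le hy0
  have hi2 : y < i + 1 := Nat.lt_floor_add_one y
  have hin : i + 1 ≤ n + 1 := by
    have : (i : ℝ) < n + 1 := hi1.trans_lt hyn
    exact_mod_cast this
  have hty : t = lo + (hi - lo) * (y / (n + 1)) := by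
    rw [hy]; field_simp; ring
  set x := lo + (hi - lo) * ((i : ℝ) / (n + 1)) with hx
  set x' := lo + (hi - lo) * (((i + 1 : ℕ) : ℝ) / (n + 1)) with hx'
  have hxt : x ≤ t := by rw [hx, hty]; gcongr
  have htx : t ≤ x' := by rw [hx', hty]; push_cast; gcongr
  have hxx : x' - x = (hi - lo) / (n + 1) := by rw [hx, hx']; push_cast; field_simp; ring
  have hx0 : lo ≤ x := by
    rw [hx]; exact le_add_of_nonneg_right (by positivity)
  have hx1 : x' ≤ hi := by
    have : ((i + 1 : ℕ) : ℝ) / (n + 1) ≤ 1 := (div_le_one hn1).2 (by exact_mod_cast hin)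
    rw [hx']; nlinarith
  have hmx : x ∈ Icc lo hi := ⟨hx0, by linarith⟩
  have hmx' : x' ∈ Icc lo hi := ⟨by linarith, hx1⟩
  have hd : ∀ s, |s - t| < δ → φ s < φ t + ε := fun s hs => by
    have := hφδ (x := s) (by rwa [Real.dist_eq])
    rw [Real.dist_eq] at this
    linarith [(abs_lt.1 this).2]
  have h1 := hd x (by rw [abs_lt]; constructor <;> linarith)
  have h2 := hd x' (by rw [abs_lt]; constructor <;> linarith)
  have hmax := (hG n).le_max_of_mem_Icc hmx hmx' ⟨hxt, htx⟩
  have hGt : G n t < φ t + ε := hmax.trans_lt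
    (max_lt ((hnode n i (by omega)).trans_lt h1) ((hnode n (i + 1) hin).trans_lt h2))
  rw [Real.dist_eq, abs_lt]
  have := hle n t (Ioo_subset_Icc_self ht)
  constructor <;> linarith

namespace DelzantPolygon

variable (P : DelzantPolygon)

/-- A convex function on the polygon is bounded: above by its values at the vertices, and below
because of its value at an interior point, which lies between any point and another one in the
polygon. -/
lemma exists_abs_le_of_convexOn {f : ℝ × ℝ → ℝ} (hf : ConvexOn ℝ P.carrier f) :
    ∃ M, ∀ z ∈ P.carrier, |f z| ≤ M := by
  classical
  set B : Finset (ℝ × ℝ) := Finset.univ.image (fun k => P.edgeLine k (P.lo k)) ∪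
    Finset.univ.image (fun k => P.edgeLine k (P.hi k)) with hB
  have hBP : (B : Set (ℝ × ℝ)) ⊆ P.carrier := by
    intro b hb
    simp only [hB, Finset.coe_union, Finset.coe_image, Finset.coe_univ, image_univ, mem_union,
      mem_range] at hb
    rcases hb with ⟨k, rfl⟩ | ⟨k, rfl⟩
    · exact P.edgeLine_lo_mem k
    · exact P.edgeLine_hi_mem k
  have hconv := P.carrier_subset_convexHull (B := (B : Set (ℝ × ℝ)))
    (fun k => by simp [hB]) (fun k => by simp [hB])
  set M := ∑ b ∈ B, |f b| with hM
  have hup : ∀ z ∈ P.carrier, f z ≤ M := fun z hz => by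
    obtain ⟨b, hb, hfb⟩ := hf.exists_ge_of_mem_convexHull hBP (hconv hz)
    exact hfb.trans ((le_abs_self _).trans
      (Finset.single_le_sum (f := fun b => |f b|) (fun b _ => abs_nonneg _) hb))
  obtain ⟨o, ho⟩ := P.interior_carrier_nonempty
  obtain ⟨r, hr, hball⟩ := Metric.mem_nhds_iff.1 (mem_interior_iff_mem_nhds.1 ho)
  obtain ⟨R, hR⟩ := P.isCompact_carrier.isBounded.exists_norm_le
  have hR0 : 0 ≤ R := (norm_nonneg o).trans (hR o (interior_subset ho))
  set s : ℝ := r / (2 * R + 1) with hs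
  have hs0 : 0 < s := by positivity
  have hopp : ∀ z ∈ P.carrier, o - s • (z - o) ∈ P.carrier := fun z hz => by
    refine hball ?_
    rw [mem_ball_iff_norm, sub_sub_cancel_left, norm_neg, norm_smul, Real.norm_of_nonneg hs0.le]
    have h1 : ‖z - o‖ ≤ 2 * R := by
      linarith [norm_sub_le z o, hR z hz, hR o (interior_subset ho)]
    calc s * ‖z - o‖ ≤ s * (2 * R) := by gcongr
      _ < s * (2 * R + 1) := by nlinarith
      _ = r := by rw [hs]; field_simp
  refine ⟨max M (-(((1 + s) * f o - M) / s)), fun z hz => abs_le.2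
    ⟨neg_le.1 (le_max_of_le_right ?_), le_max_of_le_left (hup z hz)⟩⟩
  have hcx := hf.2 hz (hopp z hz) (show 0 ≤ s / (1 + s) by positivity)
    (show 0 ≤ 1 / (1 + s) by positivity) (by field_simp; ring)
  have e : (s / (1 + s)) • z + (1 / (1 + s)) • (o - s • (z - o)) = o := by
    ext <;> simp <;> field_simp <;> ring
  rw [e, smul_eq_mul, smul_eq_mul] at hcx
  have h2 := hup _ (hopp z hz)
  have h3 : (1 + s) * f o ≤ s * f z + f (o - s • (z - o)) := by
    have := mul_le_mul_of_nonneg_left hcx (show (0 : ℝ) ≤ 1 + s by positivity)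
    have e2 : (1 + s) * (s / (1 + s) * f z + 1 / (1 + s) * f (o - s • (z - o))) =
      s * f z + f (o - s • (z - o)) := by field_simp
    linarith
  rw [neg_le_neg_iff, div_le_iff₀ hs0]
  linarith

lemma memLp_area_of_convexOn {f : ℝ × ℝ → ℝ} (hf : ConvexOn ℝ P.carrier f) (p : ENNReal) :
    MemLp f p P.areaMeasure := by
  obtain ⟨M, hM⟩ := P.exists_abs_le_of_convexOn hf
  refine MemLp.of_bound ?_ M (P.ae_area_mem.mono hM)
  have : P.areaMeasure = volume.restrict (interior P.carrier) :=
    (Measure.restrict_congr_set (interior_ae_eq_of_null_frontier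
      (P.convex_carrier.addHaar_frontier volume))).symm
  rw [this]
  exact hf.continuousOn_interior.aestronglyMeasurable isOpen_interior.measurableSet

lemma convexOn_comp_edgeLine {f : ℝ × ℝ → ℝ} (hf : ConvexOn ℝ P.carrier f)
    (k : Fin P.numEdges) :
    ConvexOn ℝ (Icc (P.lo k) (P.hi k)) fun t => f (P.edgeLine k t) := by
  refine ⟨convex_Icc _ _, fun t ht s hs a b ha hb hab => ?_⟩
  simp only [smul_eq_mul]
  rw [P.edgeLine_combo k hab]
  exact hf.2 (P.edgeLine_mem_carrier_iff.2 ht) (P.edgeLine_mem_carrier_iff.2 hs) ha hb hab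

lemma integrable_boundary_of_convexOn {f : ℝ × ℝ → ℝ} (hf : ConvexOn ℝ P.carrier f) :
    Integrable f P.boundaryMeasure := by
  obtain ⟨M, hM⟩ := P.exists_abs_le_of_convexOn hf
  refine P.integrable_boundary_iff.2 fun k => ?_
  have hc := (P.convexOn_comp_edgeLine hf k).continuousOn_interior
  rw [interior_Icc] at hc
  rw [IntegrableOn]
  refine Integrable.of_bound ?_ M ?_
  · rw [← restrict_Ioo_eq_restrict_Icc]
    exact hc.aestronglyMeasurable measurableSet_Ioo
  · exact (ae_restrict_iff' measurableSet_Icc).2 (Eventually.of_forall fun t ht =>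
      hM _ (P.edgeLine_mem_carrier_iff.2 ht))

lemma convexOn_of_mem_creaseSums {u : ℝ × ℝ → ℝ} (hu : u ∈ creaseSums) :
    ConvexOn ℝ P.carrier u := by
  induction hu using AddSubmonoid.closure_induction with
  | mem u hu =>
    obtain ⟨v, rfl⟩ := hu
    exact convexOn_crease _ P.convex_carrier v
  | zero => exact convexOn_const 0 P.convex_carrier
  | add u w _ _ h1 h2 => exact h1.add h2

/-- The nodes dividing each edge into `n + 1` equal parts. -/
noncomputable def nodes (n : ℕ) : Finset (ℝ × ℝ) :=
  open Classical in Finset.univ.biUnion fun k => (Finset.range (n + 2)).image fun i : ℕ =>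
    P.edgeLine k (P.lo k + (P.hi k - P.lo k) * (i / (n + 1)))

lemma mem_nodes {n : ℕ} {z : ℝ × ℝ} : z ∈ P.nodes n ↔ ∃ k, ∃ i : ℕ, i ≤ n + 1 ∧
    P.edgeLine k (P.lo k + (P.hi k - P.lo k) * (i / (n + 1))) = z := by
  simp only [nodes, Finset.mem_biUnion, Finset.mem_univ, true_and, Finset.mem_image,
    Finset.mem_range]
  refine exists_congr fun k => exists_congr fun i => and_congr_left fun _ => by omega

lemma isBdry_of_mem_nodes {n : ℕ} {z : ℝ × ℝ} (hz : z ∈ P.nodes n) : P.IsBdry z := by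
  obtain ⟨k, i, hi, rfl⟩ := P.mem_nodes.1 hz
  refine ⟨P.edgeLine_mem_carrier_iff.2 ⟨?_, ?_⟩, k, P.ldist_edgeLine_self k _⟩
  · exact le_add_of_nonneg_right (mul_nonneg (sub_nonneg.2 (P.lo_lt_hi k).le) (by positivity))
  · have h1 : (i : ℝ) / (n + 1) ≤ 1 := (div_le_one (by positivity)).2 (by exact_mod_cast hi)
    nlinarith [P.lo_lt_hi k]

/-- A convex function on the polygon is approximated from above, in mean on the boundary, by sums
of an affine function and creases. -/
theorem exists_creaseSum_approx {f : ℝ × ℝ → ℝ} (hf : ConvexOn ℝ P.carrier f) {ε : ℝ}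
    (hε : 0 < ε) : ∃ l, ∃ u ∈ creaseSums, (∀ z ∈ P.carrier, f z ≤ aff l z + u z) ∧
      ∫ z, (aff l z + u z) ∂P.boundaryMeasure ≤ (∫ z, f z ∂P.boundaryMeasure) + ε := by
  have hdec := fun n => P.exists_aff_add_creaseSum (B := P.nodes n)
    (fun b hb => P.isBdry_of_mem_nodes hb)
    (fun k => P.mem_nodes.2 ⟨k, 0, Nat.zero_le _, by simp⟩)
    (fun k => P.mem_nodes.2 ⟨k, n + 1, le_rfl, by
      rw [Nat.cast_add, Nat.cast_one, div_self (by positivity), mul_one, add_sub_cancel]⟩) hf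
  choose l u hu hge hnode using hdec
  have hcont : ∀ n, Continuous fun z => aff (l n) z + u n z := fun n =>
    (continuous_aff _).add (continuous_of_mem_creaseSums (hu n))
  have hcx : ∀ n, ConvexOn ℝ P.carrier fun z => aff (l n) z + u n z := fun n =>
    (convexOn_aff _ P.convex_carrier _).add (P.convexOn_of_mem_creaseSums (hu n))
  obtain ⟨M, hM⟩ := P.exists_abs_le_of_convexOn hf
  have hlim : Tendsto (fun n => ∫ z, (aff (l n) z + u n z) ∂P.boundaryMeasure) atTop
      (𝓝 (∫ z, f z ∂P.boundaryMeasure)) := by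
    rw [P.integral_boundary (P.integrable_boundary_of_convexOn hf)]
    simp_rw [fun n => P.integral_boundary (P.integrable_boundary_of_continuous (hcont n))]
    refine tendsto_finsetSum _ fun k _ => ?_
    refine tendsto_setIntegral_of_le_nodes (M := M) (P.lo_lt_hi k) (P.convexOn_comp_edgeLine hf k)
      (fun t ht => hM _ (P.edgeLine_mem_carrier_iff.2 ht))
      (fun n => (hcont n).comp (P.continuous_edgeLine k))
      (fun n => P.convexOn_comp_edgeLine (hcx n) k)
      (fun n t ht => hge n _ (P.edgeLine_mem_carrier_iff.2 ht))
      (fun n i hi => hnode n _ (P.mem_nodes.2 ⟨k, i, hi, rfl⟩))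
  obtain ⟨n, hn⟩ := (hlim.eventually_le_const (lt_add_of_pos_right _ hε)).exists
  exact ⟨l n, u n, hu n, hge n, hn⟩

end DelzantPolygon

/-! ### From creases to convex functions -/

namespace DelzantPolygon

variable (P : DelzantPolygon)

/-- A very negative value of a convex function at one point makes its mean very negative: on the
copy of the polygon shrunk to half its size about `y`, the function is at most the average of its
value at `y` and its values on the polygon. -/
lemma integral_le_of_convexOn {w u : ℝ × ℝ → ℝ} (hw : ConvexOn ℝ P.carrier w)
    (hu : Continuous u) (hu0 : ∀ z, 0 ≤ u z) (hwu : ∀ z ∈ P.carrier, w z ≤ u z) {y : ℝ × ℝ}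
    (hy : y ∈ P.carrier) :
    7 * ∫ z, w z ∂P.areaMeasure ≤
      P.areaMeasure.real univ * w y + 8 * ∫ z, u z ∂P.areaMeasure := by
  have hint : ∀ {g : ℝ × ℝ → ℝ}, ConvexOn ℝ P.carrier g → Integrable g P.areaMeasure :=
    fun hg => (P.memLp_area_of_convexOn hg 1).integrable le_rfl
  have hmid : ConvexOn ℝ P.carrier fun z => w ((1 / 2 : ℝ) • z + (1 / 2 : ℝ) • y) := by
    refine ⟨P.convex_carrier, fun z hz x hx a b ha hb hab => ?_⟩
    have hin : ∀ z ∈ P.carrier, (1 / 2 : ℝ) • z + (1 / 2 : ℝ) • y ∈ P.carrier := fun z hz =>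
      P.convex_carrier hz hy (by norm_num) (by norm_num) (by norm_num)
    have e : (1 / 2 : ℝ) • (a • z + b • x) + (1 / 2 : ℝ) • y =
        a • ((1 / 2 : ℝ) • z + (1 / 2 : ℝ) • y) + b • ((1 / 2 : ℝ) • x + (1 / 2 : ℝ) • y) := by
      have hb' : b = 1 - a := by linarith
      rw [hb']; module
    simp only
    rw [e]
    exact hw.2 (hin z hz) (hin x hx) ha hb hab
  -- the integral over the shrunk copy of the polygon
  set Q : Set (ℝ × ℝ) := {x | (2 : ℝ) • x - y ∈ P.carrier} with hQ
  have hQm : MeasurableSet Q := by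
    have hc : Continuous fun x : ℝ × ℝ => (2 : ℝ) • x - y := by fun_prop
    exact hc.measurable P.measurableSet_carrier
  have hQP : Q ⊆ P.carrier := fun x hx => by
    have e : x = (1 / 2 : ℝ) • ((2 : ℝ) • x - y) + (1 / 2 : ℝ) • y := by module
    rw [e]
    exact P.convex_carrier hx hy (by norm_num) (by norm_num) (by norm_num)
  have hscale : ∫ x in Q, w x =
      1 / 4 * ∫ z, w ((1 / 2 : ℝ) • z + (1 / 2 : ℝ) • y) ∂P.areaMeasure := by
    set G : ℝ × ℝ → ℝ := P.carrier.indicator fun z => w ((1 / 2 : ℝ) • z + (1 / 2 : ℝ) • y)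
      with hG
    have e1 : ∀ x, Q.indicator w x = G ((2 : ℝ) • x - y) := fun x => by
      have e : (1 / 2 : ℝ) • ((2 : ℝ) • x - y) + (1 / 2 : ℝ) • y = x := by module
      by_cases hx : x ∈ Q
      · rw [indicator_of_mem hx, hG, indicator_of_mem (show (2 : ℝ) • x - y ∈ P.carrier from hx), e]
      · rw [indicator_of_notMem hx, hG,
          indicator_of_notMem (show (2 : ℝ) • x - y ∉ P.carrier from hx)]
    rw [← integral_indicator hQm]
    simp_rw [e1]
    rw [Measure.integral_comp_smul volume (fun x => G (x - y)) 2, integral_sub_right_eq_self G y,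
      hG, integral_indicator P.measurableSet_carrier, Module.finrank_prod, Module.finrank_self,
      smul_eq_mul, areaMeasure]
    norm_num
  have h1 : ∫ z, w ((1 / 2 : ℝ) • z + (1 / 2 : ℝ) • y) ∂P.areaMeasure ≤
      ∫ z, (1 / 2 * w z + 1 / 2 * w y) ∂P.areaMeasure := by
    refine integral_mono_ae (hint hmid) (((hint hw).const_mul _).add (integrable_const _)) ?_
    filter_upwards [P.ae_area_mem] with z hz
    exact hw.2 hz hy (by norm_num) (by norm_num) (by norm_num)
  rw [integral_add ((hint hw).const_mul _) (integrable_const _), integral_const_mul,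
    integral_const, smul_eq_mul] at h1
  have hwQ : Integrable (Q.indicator w) P.areaMeasure := (hint hw).indicator hQm
  have hui := P.integrable_area_of_continuous hu
  have h2 : ∫ z, w z ∂P.areaMeasure ≤ ∫ z, (Q.indicator w z + u z) ∂P.areaMeasure := by
    refine integral_mono_ae (hint hw) (hwQ.add hui) ?_
    filter_upwards [P.ae_area_mem] with z hz
    by_cases h : z ∈ Q
    · rw [indicator_of_mem h]; linarith [hu0 z]
    · rw [indicator_of_notMem h, zero_add]; exact hwu z hz
  rw [integral_add hwQ hui] at h2
  have h3 : ∫ z, Q.indicator w z ∂P.areaMeasure = ∫ x in Q, w x := by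
    rw [integral_indicator hQm, areaMeasure, Measure.restrict_restrict hQm,
      inter_eq_left.2 hQP]
  rw [h3, hscale] at h2
  linarith

/-- Up to an affine function, a sum of creases satisfies the uniform bound: each crease is replaced
by the one of `(aff v)⁺` and `(-aff v)⁺` with the smaller boundary integral. -/
lemma exists_normalized_creaseSum (hP : P.IsKPolystable) {δ : ℝ}
    (hδ : ∀ v, δ * min (∫ z, crease v z ∂P.boundaryMeasure)
      (∫ z, crease (-v) z ∂P.boundaryMeasure) ≤ P.futaki (crease v))
    {u : ℝ × ℝ → ℝ} (hu : u ∈ creaseSums) :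
    ∃ u' ∈ creaseSums, ∃ v, (∀ z, u z = u' z + aff v z) ∧
      δ * ∫ z, u' z ∂P.boundaryMeasure ≤ P.futaki u' := by
  induction hu using AddSubmonoid.closure_induction with
  | mem u hu =>
    obtain ⟨v, rfl⟩ := hu
    have h := hδ v
    rcases min_choice (∫ z, crease v z ∂P.boundaryMeasure)
      (∫ z, crease (-v) z ∂P.boundaryMeasure) with hm | hm
    · rw [hm] at h
      exact ⟨crease v, AddSubmonoid.subset_closure ⟨_, rfl⟩, 0, fun z => by simp [aff], h⟩
    · rw [hm, ← P.futaki_crease_neg hP] at h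
      exact ⟨crease (-v), AddSubmonoid.subset_closure ⟨_, rfl⟩, v,
        fun z => crease_sub_crease_neg v z, h⟩
  | zero => exact ⟨0, zero_mem _, 0, fun z => by simp [aff], by simp [futaki]⟩
  | add u₁ u₂ _ _ h₁ h₂ =>
    obtain ⟨w₁, hw₁, v₁, e₁, i₁⟩ := h₁
    obtain ⟨w₂, hw₂, v₂, e₂, i₂⟩ := h₂
    have c₁ := continuous_of_mem_creaseSums hw₁
    have c₂ := continuous_of_mem_creaseSums hw₂
    refine ⟨w₁ + w₂, add_mem hw₁ hw₂, v₁ + v₂, fun z => ?_, ?_⟩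
    · rw [Pi.add_apply, Pi.add_apply, e₁, e₂, aff_add]; ring
    · have hf := P.futaki_add (P.integrable_boundary_of_continuous c₁)
        (P.integrable_area_of_continuous c₁) (P.integrable_boundary_of_continuous c₂)
        (P.integrable_area_of_continuous c₂)
      have hi := integral_add (P.integrable_boundary_of_continuous c₁)
        (P.integrable_boundary_of_continuous c₂)
      change δ * ∫ z, (w₁ z + w₂ z) ∂P.boundaryMeasure ≤ P.futaki fun z => w₁ z + w₂ z
      rw [hf, hi, mul_add]
      exact add_le_add i₁ i₂

set_option synthInstance.maxHeartbeats 200000 in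
lemma proj_eq_zero {g : ℝ × ℝ → ℝ} (hg : MemLp g 2 P.areaMeasure) {l : ℝ × ℝ × ℝ}
    (h : ∀ z, g z = aff l z) : P.proj (hg.toLp g) = 0 := by
  refine (Submodule.starProjection_apply_eq_zero_iff (P.affineLpᗮ)).2
    (Submodule.le_orthogonal_orthogonal _ ?_)
  obtain ⟨k, hk⟩ : ∃ k : (ℝ × ℝ) →ᵃ[ℝ] ℝ, ∀ z, k z = aff l z := by
    refine ⟨(l.1 • LinearMap.fst ℝ ℝ ℝ + l.2.1 • LinearMap.snd ℝ ℝ ℝ).toAffineMap +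
      AffineMap.const ℝ (ℝ × ℝ) l.2.2, fun z => ?_⟩
    simp [aff]
  exact ⟨k, hg.coeFn_toLp.trans (Eventually.of_forall fun z => (h z).trans (hk z).symm)⟩

/-- The projection forgets affine functions and does not increase norms. -/
lemma norm_proj_sq_le {f : ℝ × ℝ → ℝ} (hf : MemLp f 2 P.areaMeasure) (l : ℝ × ℝ × ℝ) :
    ‖P.proj (hf.toLp f)‖ ^ 2 ≤ ∫ z, (f z - aff l z) ^ 2 ∂P.areaMeasure := by
  have hl : MemLp (aff l) 2 P.areaMeasure :=
    P.memLp_area_of_convexOn (convexOn_aff _ P.convex_carrier l) 2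
  have e : P.proj (hf.toLp f) = P.proj ((hf.sub hl).toLp (f - aff l)) := by
    rw [MemLp.toLp_sub hf hl, map_sub, P.proj_eq_zero hl fun z => rfl, sub_zero]
  have hle : ‖P.proj (hf.toLp f)‖ ≤ ‖(hf.sub hl).toLp (f - aff l)‖ := by
    rw [e]
    exact P.affineLpᗮ.norm_starProjection_apply_le _
  refine (pow_le_pow_left₀ (norm_nonneg _) hle 2).trans (le_of_eq ?_)
  rw [← real_inner_self_eq_norm_sq, L2.inner_def]
  refine integral_congr_ae ?_
  filter_upwards [(hf.sub hl).coeFn_toLp] with z hz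
  rw [hz]
  simp [sq]

end DelzantPolygon

theorem theorem4p2p1 (P : DelzantPolygon) (hP : P.IsKPolystable) :
    P.IsUniformlyKPolystable := by
  obtain ⟨δ, hδ, hcr⟩ := P.exists_mul_min_le_futaki_crease hP
  obtain ⟨C, hC, hsq⟩ := P.exists_integral_sq_le
  have ha := P.avgConst_pos
  have hV := P.area_pos
  set a := P.avgConst with hadef
  set V := P.areaMeasure.real univ with hVdef
  -- `M E` bounds `f` from below, after normalisation, and `K E` bounds the `L²` norm, for
  -- `E = 𝓛(f) + ε`
  set M : ℝ := (7 / a + 8 / (a * δ)) / V with hM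
  have hM0 : 0 ≤ M := by positivity
  set K : ℝ := (C / δ) ^ 2 + M ^ 2 * V + 1 with hK
  have hK1 : 1 ≤ K := by
    have : 0 ≤ (C / δ) ^ 2 + M ^ 2 * V := by positivity
    linarith
  have hK0 : 0 < K := by linarith
  refine ⟨1 / K, by positivity, fun f hf => ⟨P.integrable_boundary_of_convexOn hf,
    P.memLp_area_of_convexOn hf 2, ?_⟩⟩
  set N := ‖P.proj ((P.memLp_area_of_convexOn hf 2).toLp f)‖ with hN
  suffices h : ∀ ε > 0, N ≤ K * (P.futaki f + ε) by
    have hlim : N ≤ K * P.futaki f := by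
      refine le_of_forall_pos_le_add fun ε hε => ?_
      have := h (ε / K) (by positivity)
      rwa [mul_add, mul_div_cancel₀ _ hK0.ne'] at this
    rw [one_div, inv_mul_le_iff₀ hK0]
    exact hlim
  intro ε hε
  set E := P.futaki f + ε with hE
  have hfb := P.integrable_boundary_of_convexOn hf
  have hfa : Integrable f P.areaMeasure := (P.memLp_area_of_convexOn hf 1).integrable le_rfl
  -- the approximation of `f` from above, normalised by an affine function
  obtain ⟨l₀, u₀, hu₀, hge, happ⟩ := P.exists_creaseSum_approx hf hε
  obtain ⟨u, hu, v, huv, hδu⟩ := P.exists_normalized_creaseSum hP hcr hu₀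
  set l := l₀ + v with hl
  have hsum : ∀ z, aff l₀ z + u₀ z = u z + aff l z := fun z => by
    rw [huv, hl, aff_add]; ring
  simp_rw [hsum] at hge happ
  have huc := continuous_of_mem_creaseSums hu
  have hu0 := creaseSums_nonneg hu
  have hub := P.integrable_boundary_of_continuous huc
  have hua := P.integrable_area_of_continuous huc
  have hlb := P.integrable_boundary_of_continuous (continuous_aff l)
  have hla := P.integrable_area_of_continuous (continuous_aff l)
  have hucx := P.convexOn_of_mem_creaseSums hu
  have hL : P.futaki u ≤ E := by
    rw [← P.futaki_add_aff hP hub hua l]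
    have h1 : ∫ z, f z ∂P.areaMeasure ≤ ∫ z, (u z + aff l z) ∂P.areaMeasure :=
      integral_mono_ae hfa (hua.add hla) (P.ae_area_mem.mono hge)
    have h2 := mul_le_mul_of_nonneg_left h1 ha.le
    rw [hE, DelzantPolygon.futaki, DelzantPolygon.futaki, ← hadef]
    linarith
  set I := ∫ z, u z ∂P.boundaryMeasure with hI
  have hI0 : 0 ≤ I := integral_nonneg hu0
  have hIE : I ≤ E / δ := by
    rw [le_div_iff₀ hδ]; linarith
  have hE0 : 0 ≤ E := by
    have := mul_nonneg hδ.le hI0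
    linarith
  have hAu : ∫ z, u z ∂P.areaMeasure ≤ E / (a * δ) := by
    have h1 : 0 ≤ P.futaki u := (mul_nonneg hδ.le hI0).trans hδu
    rw [DelzantPolygon.futaki, ← hadef, ← hI] at h1
    rw [le_div_iff₀ (by positivity)]
    rw [le_div_iff₀ hδ] at hIE
    nlinarith
  -- the normalised function `w = f - l` lies below `u`
  set w : ℝ × ℝ → ℝ := fun z => f z + aff (-l) z with hw
  have hwl : ∀ z, w z = f z - aff l z := fun z => by
    rw [hw]; simp only; rw [aff_neg]; ring
  have hwc : ConvexOn ℝ P.carrier w := hf.add (convexOn_aff _ P.convex_carrier _)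
  have hwu : ∀ z ∈ P.carrier, w z ≤ u z := fun z hz => by rw [hwl]; linarith [hge z hz]
  -- `𝓛(w) = 𝓛(f)`, and the boundary integral of `w` is at least `I - ε`
  have hwa : -(E / a) ≤ ∫ z, w z ∂P.areaMeasure := by
    have hLw : P.futaki w = P.futaki f := P.futaki_add_aff hP hfb hfa (-l)
    have hwb : ∫ z, w z ∂P.boundaryMeasure =
        (∫ z, f z ∂P.boundaryMeasure) - ∫ z, aff l z ∂P.boundaryMeasure := by
      rw [← integral_sub hfb hlb]
      exact integral_congr_ae (Eventually.of_forall hwl)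
    rw [integral_add hub hlb] at happ
    rw [DelzantPolygon.futaki, ← hadef] at hLw
    rw [← neg_div, div_le_iff₀ ha]
    linarith
  have hlow : ∀ y ∈ P.carrier, -(M * E) ≤ w y := fun y hy => by
    have h := P.integral_le_of_convexOn hwc huc hu0 hwu hy
    have e : M * E * V = 7 * (E / a) + 8 * (E / (a * δ)) := by
      rw [hM]; field_simp
    rw [← hVdef] at h
    by_contra! hcon
    have := mul_lt_mul_of_pos_left hcon hV
    linarith
  have hui : Integrable (fun z => u z ^ 2) P.areaMeasure :=
    P.integrable_area_of_continuous (huc.pow 2)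
  have hsqle : ∫ z, (f z - aff l z) ^ 2 ∂P.areaMeasure ≤
      ∫ z, (u z ^ 2 + (M * E) ^ 2) ∂P.areaMeasure := by
    refine integral_mono_of_nonneg (Eventually.of_forall fun z => sq_nonneg _)
      (hui.add (integrable_const _)) ?_
    filter_upwards [P.ae_area_mem] with z hz
    have h1 := hlow z hz
    have h2 := hwu z hz
    rw [hwl] at h1 h2
    have h3 : 0 ≤ M * E := mul_nonneg hM0 hE0
    rcases le_total 0 (f z - aff l z) with h0 | h0
    · nlinarith [sq_nonneg (M * E)]
    · nlinarith [sq_nonneg (u z)]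
  have hK2 : N ^ 2 ≤ (K * E) ^ 2 := by
    refine (P.norm_proj_sq_le _ l).trans (hsqle.trans ?_)
    rw [integral_add hui (integrable_const _), integral_const, smul_eq_mul, ← hVdef]
    have h1 := hsq u huc hu0 hucx
    have h2 : (C * I) ^ 2 ≤ (C * (E / δ)) ^ 2 :=
      pow_le_pow_left₀ (by positivity) (mul_le_mul_of_nonneg_left hIE hC.le) 2
    have h3 : (C * (E / δ)) ^ 2 + V * (M * E) ^ 2 = (K - 1) * E ^ 2 := by
      rw [hK]; field_simp; ring
    have h4 : (K - 1) * E ^ 2 ≤ K ^ 2 * E ^ 2 :=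
      mul_le_mul_of_nonneg_right (by nlinarith) (sq_nonneg E)
    rw [mul_pow]
    linarith
  exact (pow_le_pow_iff_left₀ (norm_nonneg _) (mul_nonneg hK0.le hE0) two_ne_zero).1 hK2
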